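/- Let $E_8\subset\mathbb R^8$ be the $E_8$ root lattice, $L=\sqrt2E_8=\{\sqrt2\,v\mid v\in E_8\}$, and let $L^*=\{v\in\mathbb R^8\mid (v,L)\subset\mathbb Z\}$ be its dual lattice. Put $R(L)=L^*/L$, which is an $8$-dimensional vector space over $\mathbb F_2$ carrying the quadratic form $q_L(v+L)=(v,v)\bmod 2$. Define $w:R(L)\to\{0,1,2\}$ by $w(0)=0$, $w(a)=1$ if $q_L(a)=1$, and $w(a)=2$ if $a\ne0$ and $q_L(a)=0$. On $R(L)^3$ put $q_L^3(a_1,a_2,a_3)=\sum_i q_L(a_i)$ and $w^3(a_1,a_2,a_3)=\sum_i w(a_i)$, and let $\mathrm{Aut}(R(L)^3,w^3)$ be the subgroup of $\mathrm{GL}(R(L)^3)$ preserving $w^3$. Let $\mathcal S$ be a maximal totally singular subspace of $(R(L)^3,q_L^3)$ such that $w^3(v)\ge4$ for all $v\in\mathcal S\setminus\{0\}$. Let $\mathfrak L(\mathcal S)\subset(L^*)^3\subset\mathbb R^{24}$ be the inverse image of $\mathcal S$ under the canonical map $(L^*)^3\to R(L)^3$, let $\mathrm{Aut}(\mathfrak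 L(\mathcal S))$ be the group of linear isometries of $\mathbb R^{24}$ mapping $\mathfrak L(\mathcal S)$ onto itself, and let $G$ be the stabilizer in $\mathrm{Aut}(\mathfrak L(\mathcal S))$ of the orthogonal direct sum $L^3\subset\mathfrak L(\mathcal S)$ of three copies of $L$. Then: (1) $\mathrm{Aut}(\mathfrak L(\mathcal S))$ acts transitively on the set of all sublattices of $\mathfrak L(\mathcal S)$ isomorphic to the orthogonal direct sum $(\sqrt2E_8)^3$ of three copies of $\sqrt2E_8$. (2) $G$ is isomorphic to an extension of the stabilizer of $\mathcal S$ in $\mathrm{Aut}(R(L)^3,w^3)$ by an elementary abelian $2$-group of order $2^3$ (which is the normal subgroup), and this stabilizer of $\mathcal S$ is a split extension of $\mathrm{SL}_4(2)\times\mathrm{Sym}_3$ by an elementary abelian $2$-group of order $2^{12}$; thus $G$ has the shape $2^3.(2^{12}:(\mathrm{SL}_4(2)\times\mathrm{Sym}_3))$. -/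

import Mathlib

open scoped Pointwise

noncomputable section

/-! ### Lattices in Euclidean spaces -/

section Lattices

variable {E F : Type*} [NormedAddCommGroup E] [InnerProductSpace ℝ E]
  [NormedAddCommGroup F] [InnerProductSpace ℝ F]

/-- The dual lattice `L* = {v | (v, L) ⊆ ℤ}`. -/
abbrev dualLattice (L : Submodule ℤ E) : Submodule ℤ E :=
  LinearMap.BilinForm.dualSubmodule (innerₗ E) L

/-- The discriminant group `R(L) = L* / L` (for `L ⊆ L*`). -/
abbrev DiscGroup (L : Submodule ℤ E) : Type _ :=
  dualLattice L ⧸ L.submoduleOf (dualLattice L)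

/-- The canonical map `φ_L : L* → R(L)`, `v ↦ v + L`. -/
abbrev discMap (L : Submodule ℤ E) : dualLattice L →ₗ[ℤ] DiscGroup L :=
  (L.submoduleOf (dualLattice L)).mkQ

/-- The orthogonal direct sum `L^k` of `k` copies of `L`, inside the orthogonal direct sum
`E^k` of `k` copies of the ambient Euclidean space. -/
def powLattice (L : Submodule ℤ E) (k : ℕ) : Submodule ℤ (PiLp 2 fun _ : Fin k => E) where
  carrier := {x | ∀ i, x i ∈ L}
  add_mem' hx hy i := L.add_mem (hx i) (hy i)
  zero_mem' _ := L.zero_mem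
  smul_mem' c _ hx i := L.smul_mem c (hx i)

/-- The canonical map `φ_L^k : (L*)^k → R(L)^k`, `(v_i) ↦ (φ_L(v_i))`. -/
def discMapPow (L : Submodule ℤ E) (k : ℕ) :
    powLattice (dualLattice L) k →ₗ[ℤ] (Fin k → DiscGroup L) where
  toFun v i := discMap L ⟨v.1 i, v.2 i⟩
  map_add' v w := by
    funext i
    exact (discMap L).map_add ⟨v.1 i, v.2 i⟩ ⟨w.1 i, w.2 i⟩
  map_smul' c v := by
    funext i
    exact (discMap L).map_smul c ⟨v.1 i, v.2 i⟩

/-- The lattice `𝔏(S) = (φ_L^k)⁻¹(S)` attached to a subspace `S` of `R(L)^k`. -/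
def latticeOf (L : Submodule ℤ E) [Module (ZMod 2) (DiscGroup L)] {k : ℕ}
    (S : Submodule (ZMod 2) (Fin k → DiscGroup L)) :
    Submodule ℤ (PiLp 2 fun _ : Fin k => E) :=
  (S.toAddSubgroup.toIntSubmodule.comap (discMapPow L k)).map
    (powLattice (dualLattice L) k).subtype

/-- The group of linear isometries `g` of the ambient space with `g(M) = M`. For a lattice `M`
of full rank this is the automorphism group `Aut(M)`. -/
def latticeAut (M : Submodule ℤ E) : Subgroup (E ≃ₗᵢ[ℝ] E) where
  carrier := {g | ∀ x, g x ∈ M ↔ x ∈ M}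
  one_mem' _ := Iff.rfl
  mul_mem' {g h} hg hh x := (hg (h x)).trans (hh x)
  inv_mem' {g} hg x := by
    have h := hg (g⁻¹ x)
    rw [show g (g⁻¹ x) = x from g.apply_symm_apply x] at h
    exact h.symm

/-- Two lattices are isomorphic when there is a group isomorphism between them that preserves
the inner product. -/
def LatticeIsomorphic (M : Submodule ℤ E) (N : Submodule ℤ F) : Prop :=
  ∃ f : M ≃ₗ[ℤ] N, ∀ x y : M, inner ℝ (f x : F) (f y : F) = inner ℝ (x : E) (y : E)

end Lattices

/-! ### Quadratic spaces over the field with two elements -/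

section QuadraticSpaces

variable {R : Type*} [AddCommGroup R] [Module (ZMod 2) R]

/-- The quadratic form `q^k` on `R^k`, `(a_i) ↦ ∑ q(a_i)`. -/
abbrev quadPow (q : QuadraticForm (ZMod 2) R) (k : ℕ) : QuadraticForm (ZMod 2) (Fin k → R) :=
  QuadraticMap.pi fun _ => q

/-- A subspace is totally singular when `q` vanishes on it. -/
def IsTotallySingular (q : QuadraticForm (ZMod 2) R) (Φ : Submodule (ZMod 2) R) : Prop :=
  ∀ v ∈ Φ, q v = 0

/-- A maximal totally singular subspace. -/
def IsMaxTotallySingular (q : QuadraticForm (ZMod 2) R) (Φ : Submodule (ZMod 2) R) : Prop :=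
  Maximal (IsTotallySingular q) Φ

open scoped Classical in
/-- `w(a) = 0` if `a = 0`, `w(a) = 1` if `q(a) = 1`, and `w(a) = 2` if `a ≠ 0` and
`q(a) = 0`. -/
def wt (q : QuadraticForm (ZMod 2) R) (a : R) : ℕ :=
  if a = 0 then 0 else if q a = 1 then 1 else 2

/-- `w^k(a_1, …, a_k) = ∑ w(a_i)`. -/
def wtPow (q : QuadraticForm (ZMod 2) R) (k : ℕ) (v : Fin k → R) : ℕ :=
  ∑ i, wt q (v i)

/-- `Aut(R^k, w^k)`, the subgroup of `GL(R^k)` preserving `w^k`. -/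
def autWt (q : QuadraticForm (ZMod 2) R) (k : ℕ) :
    Subgroup ((Fin k → R) ≃ₗ[ZMod 2] (Fin k → R)) where
  carrier := {g | ∀ v, wtPow q k (g v) = wtPow q k v}
  one_mem' _ := rfl
  mul_mem' {g h} hg hh v := (hg (h v)).trans (hh v)
  inv_mem' {g} hg v := by
    have h := hg (g⁻¹ v)
    rw [show g (g⁻¹ v) = v from g.apply_symm_apply v] at h
    exact h.symm

/-- The stabilizer `{g ∈ GL(W) | g(S) = S}` of a subspace `S` of `W`. -/
def subspaceStabilizer {W : Type*} [AddCommGroup W] [Module (ZMod 2) W]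
    (S : Submodule (ZMod 2) W) : Subgroup (W ≃ₗ[ZMod 2] W) where
  carrier := {g | ∀ v, g v ∈ S ↔ v ∈ S}
  one_mem' _ := Iff.rfl
  mul_mem' {g h} hg hh v := (hg (h v)).trans (hh v)
  inv_mem' {g} hg v := by
    have h := hg (g⁻¹ v)
    rw [show g (g⁻¹ v) = v from g.apply_symm_apply v] at h
    exact h.symm

end QuadraticSpaces

/-! ### The lattices `E₈` and `√2 E₈` -/

/-- The `E₈` root lattice: vectors of `ℝ⁸` whose coordinates are all integers or all
half-odd-integers, with even coordinate sum. -/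
def latticeE8 : Submodule ℤ (EuclideanSpace ℝ (Fin 8)) where
  carrier := {x | ((∀ i, ∃ n : ℤ, x i = n) ∨ (∀ i, ∃ n : ℤ, x i = n + 1 / 2)) ∧
    ∃ s : ℤ, ∑ i, x i = 2 * s}
  zero_mem' := ⟨Or.inl fun _ => ⟨0, by simp⟩, 0, by simp⟩
  add_mem' := by
    rintro x y ⟨hx, s, hs⟩ ⟨hy, t, ht⟩
    refine ⟨?_, s + t, by simp [Finset.sum_add_distrib, hs, ht]; ring⟩
    rcases hx with hx | hx <;> rcases hy with hy | hy
    · left; intro i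
      obtain ⟨a, ha⟩ := hx i
      obtain ⟨b, hb⟩ := hy i
      exact ⟨a + b, by simp [ha, hb]⟩
    · right; intro i
      obtain ⟨a, ha⟩ := hx i
      obtain ⟨b, hb⟩ := hy i
      exact ⟨a + b, by simp [ha, hb]; ring⟩
    · right; intro i
      obtain ⟨a, ha⟩ := hx i
      obtain ⟨b, hb⟩ := hy i
      exact ⟨a + b, by simp [ha, hb]; ring⟩
    · left; intro i
      obtain ⟨a, ha⟩ := hx i
      obtain ⟨b, hb⟩ := hy i
      exact ⟨a + b + 1, by simp [ha, hb]; ring⟩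
  smul_mem' := by
    rintro c x ⟨hx, s, hs⟩
    refine ⟨?_, c * s, by simp [← Finset.mul_sum, hs]; ring⟩
    rcases hx with hx | hx
    · left; intro i
      obtain ⟨a, ha⟩ := hx i
      exact ⟨c * a, by simp [ha]⟩
    · rcases Int.even_or_odd' c with ⟨d, rfl | rfl⟩
      · left; intro i
        obtain ⟨a, ha⟩ := hx i
        exact ⟨2 * d * a + d, by simp [ha]; ring⟩
      · right; intro i
        obtain ⟨a, ha⟩ := hx i
        exact ⟨(2 * d + 1) * a + d, by simp [ha]; ring⟩

/-- `√2 E₈ = {√2 v | v ∈ E₈}`. -/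
def sqrtTwoE8 : Submodule ℤ (EuclideanSpace ℝ (Fin 8)) :=
  Real.sqrt 2 • latticeE8

theorem latticeE8_even {x : EuclideanSpace ℝ (Fin 8)} (hx : x ∈ latticeE8) :
    ∃ n : ℤ, inner ℝ x x = 2 * (n : ℝ) := by
  obtain ⟨hx, s, hs⟩ := hx
  rcases hx with hx | hx
  · choose a ha using hx
    have hsum : ∑ i, a i = 2 * s := by
      have : ((∑ i, a i : ℤ) : ℝ) = ((2 * s : ℤ) : ℝ) := by
        push_cast; rw [← hs]; simp [ha]
      exact_mod_cast this
    have key : ∀ i, ∃ b : ℤ, a i * a i = a i + 2 * b := by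
      intro i
      obtain ⟨b, hb⟩ := (Int.even_mul_succ_self (a i - 1))
      exact ⟨b, by linarith⟩
    choose b hb using key
    refine ⟨s + ∑ i, b i, ?_⟩
    have : ∑ i, a i * a i = 2 * (s + ∑ i, b i) := by
      simp only [hb, Finset.sum_add_distrib, ← Finset.mul_sum, hsum]; ring
    rw [PiLp.inner_apply]
    simp only [ha]
    have h2 : ((∑ i, a i * a i : ℤ) : ℝ) = ((2 * (s + ∑ i, b i) : ℤ) : ℝ) := by rw [this]
    push_cast at h2 ⊢
    simpa [sq] using h2
  · choose a ha using hx
    have key : ∀ i, ∃ b : ℤ, a i * a i + a i = 2 * b := by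
      intro i
      obtain ⟨b, hb⟩ := (Int.even_mul_succ_self (a i))
      exact ⟨b, by linarith⟩
    choose b hb using key
    refine ⟨1 + ∑ i, b i, ?_⟩
    have h2 : ∀ i, x i * x i = 2 * (b i : ℝ) + 1 / 4 := by
      intro i
      have : ((a i * a i + a i : ℤ) : ℝ) = ((2 * b i : ℤ) : ℝ) := by rw [hb]
      push_cast at this
      rw [ha]; linarith
    rw [PiLp.inner_apply]
    have h3 : ∑ i, x i * x i = 2 * (1 + ∑ i, (b i : ℝ)) := by
      simp only [h2, Finset.sum_add_distrib, ← Finset.mul_sum]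
      norm_num
      ring
    push_cast
    simpa [sq] using h3

theorem latticeE8_integral {x y : EuclideanSpace ℝ (Fin 8)} (hx : x ∈ latticeE8)
    (hy : y ∈ latticeE8) : ∃ n : ℤ, inner ℝ x y = (n : ℝ) := by
  obtain ⟨a, ha⟩ := latticeE8_even hx
  obtain ⟨b, hb⟩ := latticeE8_even hy
  obtain ⟨c, hc⟩ := latticeE8_even (add_mem hx hy)
  refine ⟨c - a - b, ?_⟩
  rw [inner_add_left, inner_add_right, inner_add_right, real_inner_comm x y] at hc
  push_cast
  linarith

/-- The lattice `E₈` contains its dual. -/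
theorem mem_latticeE8_of_dual {x : EuclideanSpace ℝ (Fin 8)}
    (h : ∀ y ∈ latticeE8, ∃ n : ℤ, inner ℝ x y = (n : ℝ)) : x ∈ latticeE8 := by
  have hadd : ∀ i j, ∃ n : ℤ, x i + x j = n := by
    intro i j
    obtain ⟨n, hn⟩ := h (EuclideanSpace.single i 1 + EuclideanSpace.single j 1)
      ⟨Or.inl fun k => ⟨(if k = i then 1 else 0) + (if k = j then 1 else 0), by simp⟩,
        1, by simp [Finset.sum_add_distrib]; norm_num⟩
    refine ⟨n, ?_⟩
    rw [← hn, inner_add_right]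
    simp [EuclideanSpace.inner_single_right]
  have hsub : ∀ i j, ∃ n : ℤ, x i - x j = n := by
    intro i j
    obtain ⟨n, hn⟩ := h (EuclideanSpace.single i 1 - EuclideanSpace.single j 1)
      ⟨Or.inl fun k => ⟨(if k = i then 1 else 0) - (if k = j then 1 else 0), by simp⟩,
        0, by simp [Finset.sum_sub_distrib]⟩
    refine ⟨n, ?_⟩
    rw [← hn, inner_sub_right]
    simp [EuclideanSpace.inner_single_right]
  constructor
  · obtain ⟨m, hm⟩ := hadd 0 0
    rcases Int.even_or_odd' m with ⟨d, rfl | rfl⟩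
    · left; intro i
      obtain ⟨n, hn⟩ := hsub i 0
      refine ⟨n + d, ?_⟩
      push_cast at hm ⊢
      linarith
    · right; intro i
      obtain ⟨n, hn⟩ := hsub i 0
      refine ⟨n + d, ?_⟩
      push_cast at hm ⊢
      linarith
  · obtain ⟨n, hn⟩ := h (WithLp.toLp 2 fun _ => 1 / 2)
      ⟨Or.inr fun _ => ⟨0, by simp⟩, 2, by simp; norm_num⟩
    refine ⟨n, ?_⟩
    rw [← hn, PiLp.inner_apply]
    simp [← Finset.mul_sum]

theorem mem_dual_sqrtTwoE8 {v : EuclideanSpace ℝ (Fin 8)} (hv : v ∈ dualLattice sqrtTwoE8) :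
    Real.sqrt 2 • v ∈ latticeE8 := by
  apply mem_latticeE8_of_dual
  intro y hy
  have h := hv (Real.sqrt 2 • y) (Submodule.smul_mem_pointwise_smul y _ _ hy)
  obtain ⟨n, hn⟩ := Submodule.mem_one.mp h
  refine ⟨n, ?_⟩
  rw [real_inner_smul_left, ← real_inner_smul_right]
  exact hn.symm

theorem inner_dual_sqrtTwoE8 {v : EuclideanSpace ℝ (Fin 8)} (hv : v ∈ dualLattice sqrtTwoE8) :
    ∃ n : ℤ, inner ℝ v v = (n : ℝ) := by
  obtain ⟨n, hn⟩ := latticeE8_even (mem_dual_sqrtTwoE8 hv)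
  refine ⟨n, ?_⟩
  rw [real_inner_smul_left, real_inner_smul_right, ← mul_assoc,
    Real.mul_self_sqrt (by norm_num)] at hn
  linarith

/-- `2 L* ⊆ L` for `L = √2 E₈`. -/
theorem two_smul_dual_sqrtTwoE8 {v : EuclideanSpace ℝ (Fin 8)}
    (hv : v ∈ dualLattice sqrtTwoE8) : 2 • v ∈ sqrtTwoE8 := by
  have h := Submodule.smul_mem_pointwise_smul _ (Real.sqrt 2) _ (mem_dual_sqrtTwoE8 hv)
  rw [smul_smul, Real.mul_self_sqrt (by norm_num)] at h
  have h2 : (2 • v : EuclideanSpace ℝ (Fin 8)) = (2 : ℝ) • v := by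
    rw [two_smul, two_smul]
  rw [h2]
  exact h

/-- `R(√2 E₈)` is a vector space over the field with two elements. -/
instance discGroupModule : Module (ZMod 2) (DiscGroup sqrtTwoE8) :=
  AddCommGroup.zmodModule (n := 2) fun x => by
    induction x using Submodule.Quotient.induction_on with
    | H v =>
      rw [← Submodule.Quotient.mk_smul, Submodule.Quotient.mk_eq_zero]
      exact two_smul_dual_sqrtTwoE8 v.2

theorem inner_dual_sqrtTwoE8' {v w : EuclideanSpace ℝ (Fin 8)}
    (hv : v ∈ dualLattice sqrtTwoE8) (hw : w ∈ dualLattice sqrtTwoE8) :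
    ∃ n : ℤ, 2 * inner ℝ v w = (n : ℝ) := by
  obtain ⟨n, hn⟩ := latticeE8_integral (mem_dual_sqrtTwoE8 hv) (mem_dual_sqrtTwoE8 hw)
  refine ⟨n, ?_⟩
  rw [real_inner_smul_left, real_inner_smul_right, ← mul_assoc,
    Real.mul_self_sqrt (by norm_num)] at hn
  exact hn

/-- The residue mod `2` of `(v, v)`, an integer for `v ∈ L*`, depends only on `v + L`. -/
theorem floor_inner_eq_of_sub_mem {v w : EuclideanSpace ℝ (Fin 8)}
    (hv : v ∈ dualLattice sqrtTwoE8) (hw : w ∈ dualLattice sqrtTwoE8)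
    (h : v - w ∈ sqrtTwoE8) :
    ((⌊(inner ℝ v v : ℝ)⌋ : ℤ) : ZMod 2) = ((⌊(inner ℝ w w : ℝ)⌋ : ℤ) : ZMod 2) := by
  obtain ⟨a, ha⟩ := inner_dual_sqrtTwoE8 hv
  obtain ⟨b, hb⟩ := inner_dual_sqrtTwoE8 hw
  obtain ⟨c, hc⟩ : ∃ c : ℤ, inner ℝ w (v - w) = (c : ℝ) := by
    obtain ⟨c, hc⟩ := Submodule.mem_one.mp (hw _ h)
    exact ⟨c, hc.symm⟩
  obtain ⟨y, hy, hyl⟩ := (Submodule.mem_smul_pointwise_iff_exists _ _ _).mp h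
  obtain ⟨d, hd⟩ := latticeE8_even hy
  have hl : inner ℝ (v - w) (v - w) = 4 * (d : ℝ) := by
    rw [← hyl, real_inner_smul_left, real_inner_smul_right, ← mul_assoc,
      Real.mul_self_sqrt (by norm_num), hd]
    ring
  have hab : a = b + 2 * (c + 2 * d) := by
    have e : inner ℝ v v = inner ℝ w w + 2 * inner ℝ w (v - w) + inner ℝ (v - w) (v - w) := by
      simp only [inner_sub_left, inner_sub_right, real_inner_comm v w]
      ring
    rw [ha, hb, hc, hl] at e
    have : (a : ℝ) = ((b + 2 * (c + 2 * d) : ℤ) : ℝ) := by push_cast; linarith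
    exact_mod_cast this
  rw [ha, hb, Int.floor_intCast, Int.floor_intCast, hab]
  push_cast
  rw [show (2 : ZMod 2) = 0 from rfl]
  ring

/-- The map `R(L) → 𝔽₂`, `v + L ↦ (v, v) mod 2`, for `L = √2 E₈`. -/
def discQuadFun (x : DiscGroup sqrtTwoE8) : ZMod 2 :=
  Quotient.liftOn' x
    (fun v : dualLattice sqrtTwoE8 =>
      ((⌊(inner ℝ (v : EuclideanSpace ℝ (Fin 8)) v : ℝ)⌋ : ℤ) : ZMod 2))
    fun v w h => floor_inner_eq_of_sub_mem v.2 w.2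
      (show v - w ∈ sqrtTwoE8.submoduleOf (dualLattice sqrtTwoE8) from
        (Submodule.quotientRel_def _).mp h)

theorem discQuadFun_mk {v : EuclideanSpace ℝ (Fin 8)} (hv : v ∈ dualLattice sqrtTwoE8)
    {n : ℤ} (hn : inner ℝ v v = (n : ℝ)) :
    discQuadFun (discMap sqrtTwoE8 ⟨v, hv⟩) = (n : ZMod 2) := by
  change ((⌊(inner ℝ v v : ℝ)⌋ : ℤ) : ZMod 2) = n
  rw [hn, Int.floor_intCast]

theorem polar_discQuadFun_mk {v w : EuclideanSpace ℝ (Fin 8)}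
    (hv : v ∈ dualLattice sqrtTwoE8) (hw : w ∈ dualLattice sqrtTwoE8)
    {n : ℤ} (hn : 2 * inner ℝ v w = (n : ℝ)) :
    QuadraticMap.polar discQuadFun (discMap sqrtTwoE8 ⟨v, hv⟩) (discMap sqrtTwoE8 ⟨w, hw⟩)
      = (n : ZMod 2) := by
  obtain ⟨a, ha⟩ := inner_dual_sqrtTwoE8 hv
  obtain ⟨b, hb⟩ := inner_dual_sqrtTwoE8 hw
  have hs : inner ℝ (v + w) (v + w) = ((a + b + n : ℤ) : ℝ) := by
    rw [inner_add_left, inner_add_right, inner_add_right, real_inner_comm v w, ha, hb]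
    push_cast
    linarith
  have e := discQuadFun_mk (add_mem hv hw) hs
  rw [QuadraticMap.polar, ← map_add, discQuadFun_mk hv ha, discQuadFun_mk hw hb,
    show (⟨v, hv⟩ + ⟨w, hw⟩ : dualLattice sqrtTwoE8) = ⟨v + w, add_mem hv hw⟩ from rfl, e]
  push_cast
  ring

theorem polar_discQuadFun_add (x y z : DiscGroup sqrtTwoE8) :
    QuadraticMap.polar discQuadFun (x + y) z =
      QuadraticMap.polar discQuadFun x z + QuadraticMap.polar discQuadFun y z := by
  obtain ⟨⟨u, hu⟩, rfl⟩ := Submodule.mkQ_surjective _ x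
  obtain ⟨⟨v, hv⟩, rfl⟩ := Submodule.mkQ_surjective _ y
  obtain ⟨⟨w, hw⟩, rfl⟩ := Submodule.mkQ_surjective _ z
  obtain ⟨a, ha⟩ := inner_dual_sqrtTwoE8' hu hw
  obtain ⟨b, hb⟩ := inner_dual_sqrtTwoE8' hv hw
  have hs : 2 * inner ℝ (u + v) w = ((a + b : ℤ) : ℝ) := by
    rw [inner_add_left]
    push_cast
    linarith
  have e := polar_discQuadFun_mk (add_mem hu hv) hw hs
  rw [← map_add, polar_discQuadFun_mk hu hw ha, polar_discQuadFun_mk hv hw hb,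
    show (⟨u, hu⟩ + ⟨v, hv⟩ : dualLattice sqrtTwoE8) = ⟨u + v, add_mem hu hv⟩ from rfl, e]
  push_cast
  ring

theorem discQuadFun_zero : discQuadFun 0 = 0 := by
  have e := discQuadFun_mk (dualLattice sqrtTwoE8).zero_mem (n := 0) (by simp)
  rw [show (⟨0, (dualLattice sqrtTwoE8).zero_mem⟩ : dualLattice sqrtTwoE8) = 0 from rfl,
    map_zero] at e
  simpa using e

theorem zmod_two_eq (a : ZMod 2) : a = 0 ∨ a = 1 := by
  revert a
  decide

/-- The quadratic form `q_L` on `R(L)`, `q_L(v + L) = (v, v) mod 2`, for `L = √2 E₈`. -/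
def discQuad : QuadraticForm (ZMod 2) (DiscGroup sqrtTwoE8) :=
  QuadraticMap.ofPolar discQuadFun
    (fun a x => by
      rcases zmod_two_eq a with rfl | rfl
      · simp [discQuadFun_zero]
      · simp)
    polar_discQuadFun_add
    (fun a x y => by
      rcases zmod_two_eq a with rfl | rfl
      · simp [QuadraticMap.polar, discQuadFun_zero]
      · simp)

end

/-!
Every extremal code `S ⊆ R(L)³` is glued from polarizations: each factor is `V ⊕ V*` with its
hyperbolic form, in such a way that `S` becomes the set of triples `((x₁, f), (x₂, f), (x₃, f))`
with `∑ xᵢ = 0`. Indeed the vectors of `S` vanishing in one coordinate form a copy of a maximal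
totally singular subspace `V`, and the weight bound leaves no vectors of `S` in a single factor.
Hence any two extremal codes differ by isometries of the three factors.

A map preserving `w³` preserves the vectors of weight one, which are the nonsingular vectors of the
factors; as these are connected by non-orthogonality, it permutes the factors, so
`Aut(R(L)³, w³)` is `O(q_L) ≀ Sym₃`. An element of `O(q_L)³` stabilizing the glue code is a triple
of elements of the Siegel parabolic with a common Levi part `A ∈ SL₄(2)` and alternating
matrices `P₁, P₂, P₃` with `∑ Pᵢ = 0`; these matrices form the group `2¹²`.

Every isometry of `q_L` lifts to an isometry of `E₈`: lift the images of the simple roots to norm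
two vectors and adjust their signs along the Dynkin diagram. Isometries of `L³` acting trivially on
`R(L)³` are sign changes of the three summands. Finally, `𝔏(S)` has minimal norm four, so reading
it from another sublattice isomorphic to `L³` yields again an extremal code; this is how the
transitivity follows from the uniqueness of the code.
-/

noncomputable section

/-! ### Extremal codes -/

section TotallySingular

open QuadraticMap Module

variable {R : Type*} [AddCommGroup R] [Module (ZMod 2) R] {q : QuadraticForm (ZMod 2) R}
  {S U : Submodule (ZMod 2) R}

theorem IsTotallySingular.polar_eq_zero (hU : IsTotallySingular q U) {x y : R} (hx : x ∈ U)
    (hy : y ∈ U) : polar q x y = 0 := by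
  simp [polar, hU _ hx, hU _ hy, hU _ (U.add_mem hx hy)]

theorem IsTotallySingular.le_orthogonal (hU : IsTotallySingular q U) :
    U ≤ LinearMap.BilinForm.orthogonal (polarBilin q) U :=
  fun _ hx _ hu => hU.polar_eq_zero hu hx

theorem polarBilin_nondegenerate (hq : ∀ x, (∀ y, polar q x y = 0) → x = 0) :
    (polarBilin q).Nondegenerate :=
  ⟨hq, fun x h => hq x fun y => by rw [polar_comm]; exact h y⟩

theorem polar_quadPow (q : QuadraticForm (ZMod 2) R) {k : ℕ} (x y : Fin k → R) :
    polar (quadPow q k) x y = ∑ i, polar q (x i) (y i) := by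
  simp [polar, QuadraticMap.pi_apply, Finset.sum_sub_distrib]

theorem polar_quadPow_single (q : QuadraticForm (ZMod 2) R) {k : ℕ} (i : Fin k) (x : R)
    (y : Fin k → R) : polar (quadPow q k) (Pi.single i x) y = polar q x (y i) := by
  rw [polar_quadPow, Finset.sum_eq_single i (fun j _ hj => by simp [hj]) (by simp),
    Pi.single_eq_same]

theorem quadPow_single (q : QuadraticForm (ZMod 2) R) {k : ℕ} (i : Fin k) (x : R) :
    quadPow q k (Pi.single i x) = q x := by
  rw [QuadraticMap.pi_apply, Finset.sum_eq_single i (fun j _ hj => by simp [hj]) (by simp),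
    Pi.single_eq_same]

theorem quadPow_polarBilin_nondegenerate (hq : (polarBilin q).Nondegenerate) (k : ℕ) :
    (polarBilin (quadPow q k)).Nondegenerate :=
  polarBilin_nondegenerate fun x hx => funext fun i => hq.2 _ fun y => by
    rw [polarBilin_apply_apply, ← polar_quadPow_single, polar_comm, ← polarBilin_apply_apply]
    simpa [polarBilin_apply_apply, polar_comm] using hx (Pi.single i y)

variable [FiniteDimensional (ZMod 2) R]

theorem finrank_pi_const (k : ℕ) : finrank (ZMod 2) (Fin k → R) = k * finrank (ZMod 2) R := by
  rw [finrank_pi_fintype, Finset.sum_const, Finset.card_univ, Fintype.card_fin, smul_eq_mul]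

theorem finrank_add_finrank_orthogonal (hq : (polarBilin q).Nondegenerate)
    (U : Submodule (ZMod 2) R) :
    finrank (ZMod 2) U + finrank (ZMod 2) (LinearMap.BilinForm.orthogonal (polarBilin q) U)
      = finrank (ZMod 2) R := by
  rw [LinearMap.BilinForm.finrank_orthogonal hq, Nat.add_sub_cancel' (Submodule.finrank_le U)]

theorem IsTotallySingular.two_mul_finrank_le (hq : (polarBilin q).Nondegenerate)
    (hU : IsTotallySingular q U) : 2 * finrank (ZMod 2) U ≤ finrank (ZMod 2) R := by
  have := finrank_add_finrank_orthogonal hq U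
  have := Submodule.finrank_mono hU.le_orthogonal
  omega

theorem IsTotallySingular.orthogonal_eq (hq : (polarBilin q).Nondegenerate)
    (hU : IsTotallySingular q U) (hdim : 2 * finrank (ZMod 2) U = finrank (ZMod 2) R) :
    LinearMap.BilinForm.orthogonal (polarBilin q) U = U := by
  have := finrank_add_finrank_orthogonal hq U
  exact (Submodule.eq_of_le_of_finrank_eq hU.le_orthogonal (by omega)).symm

omit [FiniteDimensional (ZMod 2) R] in
theorem IsMaxTotallySingular.inf_orthogonal_le (hS : IsMaxTotallySingular q S)
    (hU : IsTotallySingular q U) : U ⊓ LinearMap.BilinForm.orthogonal (polarBilin q) S ≤ S := by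
  have hsup : IsTotallySingular q (S ⊔ U ⊓ LinearMap.BilinForm.orthogonal (polarBilin q) S) := by
    intro v hv
    obtain ⟨s, hs, u, ⟨huU, huS⟩, rfl⟩ := Submodule.mem_sup.1 hv
    rw [QuadraticMap.map_add q, hS.prop s hs, hU u huU, show polar q s u = 0 from huS s hs,
      add_zero, add_zero]
  exact le_sup_right.trans (hS.le_of_ge hsup le_sup_left)

theorem IsMaxTotallySingular.two_mul_finrank_eq (hq : (polarBilin q).Nondegenerate)
    (hS : IsMaxTotallySingular q S) (hU : IsTotallySingular q U)
    (hdim : 2 * finrank (ZMod 2) U = finrank (ZMod 2) R) :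
    2 * finrank (ZMod 2) S = finrank (ZMod 2) R := by
  have horth : LinearMap.BilinForm.orthogonal (polarBilin q) (U ⊔ S) ≤ U ⊓ S := by
    intro x hx
    have hxU : x ∈ U := by
      rw [← hU.orthogonal_eq hq hdim]
      exact fun u hu => hx u (Submodule.mem_sup_left hu)
    exact ⟨hxU, hS.inf_orthogonal_le hU ⟨hxU, fun s hs => hx s (Submodule.mem_sup_right hs)⟩⟩
  have := finrank_add_finrank_orthogonal hq (U ⊔ S)
  have := Submodule.finrank_sup_add_finrank_inf_eq U S
  have := Submodule.finrank_mono horth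
  have := hS.prop.two_mul_finrank_le hq
  omega

end TotallySingular

section Weights

variable {R : Type*} [AddCommGroup R] [Module (ZMod 2) R]

theorem wt_le_two (q : QuadraticForm (ZMod 2) R) (a : R) : wt q a ≤ 2 := by
  unfold wt; split_ifs <;> simp

theorem wt_zero (q : QuadraticForm (ZMod 2) R) : wt q 0 = 0 := by simp [wt]

theorem wt_of_eq_one {q : QuadraticForm (ZMod 2) R} {a : R} (h : q a = 1) : wt q a = 1 := by
  have : a ≠ 0 := by rintro rfl; simp at h
  simp [wt, h, this]

theorem natCast_wt (q : QuadraticForm (ZMod 2) R) (a : R) : (wt q a : ZMod 2) = q a := by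
  unfold wt
  split_ifs with h1 h2
  · simp [h1]
  · simp [h2]
  · rw [(zmod_two_eq (q a)).resolve_right h2]; rfl

theorem natCast_wtPow (q : QuadraticForm (ZMod 2) R) {k : ℕ} (v : Fin k → R) :
    (wtPow q k v : ZMod 2) = quadPow q k v := by
  simp [wtPow, natCast_wt]

end Weights

section HyperbolicForm

open QuadraticMap

/-- The hyperbolic quadratic form `(v, f) ↦ v ⬝ f` on the sum of `𝔽₂^ι` and its dual, the latter
being identified with `𝔽₂^ι` by the dot product. -/
def hypForm (ι : Type*) [Fintype ι] : QuadraticForm (ZMod 2) ((ι → ZMod 2) × (ι → ZMod 2)) :=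
  LinearMap.BilinMap.toQuadraticMap
    ((dotProductBilin (ZMod 2) (ZMod 2)).compl₁₂ (LinearMap.fst _ _ _) (LinearMap.snd _ _ _))

/-- The subspace of all `((a_i, f))_i` with common second component `f` and `∑ a_i = 0`. -/
def glueCode (ι : Type*) (k : ℕ) :
    Submodule (ZMod 2) (Fin k → (ι → ZMod 2) × (ι → ZMod 2)) where
  carrier := {m | (∀ i j, (m i).2 = (m j).2) ∧ ∑ i, (m i).1 = 0}
  zero_mem' := by simp
  add_mem' := fun ⟨h1, h2⟩ ⟨h3, h4⟩ =>
    ⟨fun i j => by simp [h1 i j, h3 i j], by simp [Finset.sum_add_distrib, h2, h4]⟩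
  smul_mem' := fun c _ ⟨h1, h2⟩ =>
    ⟨fun i j => by simp [h1 i j], by simp [← Finset.smul_sum, h2]⟩

variable {ι : Type*} [Fintype ι] {k : ℕ}

theorem hypForm_apply (m : (ι → ZMod 2) × (ι → ZMod 2)) : hypForm ι m = m.1 ⬝ᵥ m.2 := rfl

theorem polar_hypForm (m n : (ι → ZMod 2) × (ι → ZMod 2)) :
    polar (hypForm ι) m n = m.1 ⬝ᵥ n.2 + n.1 ⬝ᵥ m.2 := by
  simp only [polar, hypForm_apply, Prod.fst_add, Prod.snd_add, add_dotProduct, dotProduct_add]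
  ring

theorem mem_glueCode_of_polar_eq_zero {m : Fin k → (ι → ZMod 2) × (ι → ZMod 2)}
    (hm : ∀ n ∈ glueCode ι k, polar (quadPow (hypForm ι) k) n m = 0) : m ∈ glueCode ι k := by
  refine ⟨fun i j => ?_, (dotProduct_eq_zero_iff).1 fun f => ?_⟩
  · rw [← sub_eq_zero, ZModModule.sub_eq_add, ← dotProduct_eq_zero_iff]
    intro a
    have hn : Pi.single i (a, 0) + Pi.single j (a, 0) ∈ glueCode ι k := by
      refine ⟨fun l l' => ?_, ?_⟩
      · simp [Pi.single_apply, apply_ite Prod.snd]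
      · simp [Pi.single_apply, apply_ite Prod.fst, Finset.sum_add_distrib,
          ZModModule.add_self]
    have h := hm _ hn
    rw [polar_add_left, polar_quadPow_single, polar_quadPow_single] at h
    simpa [polar_hypForm, add_dotProduct, dotProduct_comm a] using h
  · have h := hm (fun _ => (0, f)) ⟨fun _ _ => rfl, by simp⟩
    simpa [polar_quadPow, polar_hypForm, sum_dotProduct] using h

end HyperbolicForm

section HyperbolicFrames

open QuadraticMap Module

theorem exists_comp_eq_of_range_le {A V M N : Type*} [Ring A] [AddCommGroup V] [Module A V]
    [Projective A V] [AddCommGroup M] [Module A M] [AddCommGroup N] [Module A N]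
    (p : M →ₗ[A] N) (f : V →ₗ[A] N) (h : LinearMap.range f ≤ LinearMap.range p) :
    ∃ g : V →ₗ[A] M, p ∘ₗ g = f := by
  obtain ⟨g, hg⟩ := projective_lifting_property p.rangeRestrict
    (f.codRestrict (LinearMap.range p) fun v => h ⟨v, rfl⟩) p.surjective_rangeRestrict
  exact ⟨g, LinearMap.ext fun v => congrArg Subtype.val (DFunLike.congr_fun hg v)⟩

variable {ι : Type*} [Fintype ι]

theorem exists_eq_dotProduct_self (Q : QuadraticForm (ZMod 2) (ι → ZMod 2)) :
    ∃ c : (ι → ZMod 2) →ₗ[ZMod 2] (ι → ZMod 2), ∀ f, Q f = c f ⬝ᵥ f := by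
  classical
  obtain ⟨B, rfl⟩ := LinearMap.BilinMap.toQuadraticMap_surjective Q
  refine ⟨LinearMap.pi fun i => B.flip fun j => if i = j then 1 else 0, fun f => ?_⟩
  rw [LinearMap.BilinMap.toQuadraticMap_apply, dotProduct_comm]
  exact (B f).pi_apply_eq_sum_univ f

variable {R : Type*} [AddCommGroup R] [Module (ZMod 2) R] {q : QuadraticForm (ZMod 2) R}

theorem polar_eq_zero_of_forall_map_eq_zero {V : Type*} [AddCommGroup V] [Module (ZMod 2) V]
    {φ : V →ₗ[ZMod 2] R} (hφ : ∀ v, q (φ v) = 0) (u v : V) : polar q (φ u) (φ v) = 0 := by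
  rw [polar, ← map_add, hφ, hφ, hφ, sub_zero, sub_zero]

theorem surjective_dualMap_comp_polarBilin [FiniteDimensional (ZMod 2) R] {V : Type*}
    [AddCommGroup V] [Module (ZMod 2) V] (hq : (polarBilin q).Nondegenerate)
    {φ : V →ₗ[ZMod 2] R} (hφ : Function.Injective φ) :
    Function.Surjective (φ.dualMap ∘ₗ polarBilin q) :=
  (LinearMap.dualMap_surjective_of_injective hφ).comp
    (LinearMap.BilinForm.toDual (polarBilin q) hq).surjective

theorem exists_map_add_eq_zero {φ ψ : (ι → ZMod 2) →ₗ[ZMod 2] R}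
    (hφ : ∀ v, q (φ v) = 0) (hφψ : ∀ v f, polar q (φ v) (ψ f) = v ⬝ᵥ f) :
    ∃ c : (ι → ZMod 2) →ₗ[ZMod 2] (ι → ZMod 2), ∀ f, q (ψ f + φ (c f)) = 0 := by
  obtain ⟨c, hc⟩ := exists_eq_dotProduct_self (q.comp ψ)
  refine ⟨c, fun f => ?_⟩
  rw [QuadraticMap.map_add q, hφ, polar_comm, hφψ, ← hc, add_zero]
  exact ZModModule.add_self _

theorem coprod_injective_of_polar_eq_dotProduct {φ ψ : (ι → ZMod 2) →ₗ[ZMod 2] R}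
    (hφ : ∀ v, q (φ v) = 0) (hψ : ∀ f, q (ψ f) = 0)
    (hφψ : ∀ v f, polar q (φ v) (ψ f) = v ⬝ᵥ f) : Function.Injective (φ.coprod ψ) := by
  rw [← LinearMap.ker_eq_bot, LinearMap.ker_eq_bot']
  rintro ⟨v, f⟩ hvf
  have hvf : φ v + ψ f = 0 := by simpa using hvf
  have hv : v = 0 := dotProduct_eq_zero_iff.1 fun g => by
    have h := polar_add_left q (φ v) (ψ f) (ψ g)
    rwa [hvf, hφψ, polar_eq_zero_of_forall_map_eq_zero hψ, add_zero, polar_zero_left,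
      eq_comm] at h
  have hf : f = 0 := dotProduct_eq_zero_iff.1 fun g => by
    have h := polar_add_right q (φ g) (φ v) (ψ f)
    rwa [hvf, hφψ, polar_eq_zero_of_forall_map_eq_zero hφ, zero_add, polar_zero_right,
      dotProduct_comm, eq_comm] at h
  rw [hv, hf, Prod.mk_zero_zero]

/-- The isometry of the hyperbolic space given by a hyperbolic frame, that is, by two totally
singular embeddings of `𝔽₂^ι` that `q` puts in duality. -/
def frameIsometry {φ ψ : (ι → ZMod 2) →ₗ[ZMod 2] R} [FiniteDimensional (ZMod 2) R]
    (hR : 2 * Fintype.card ι = finrank (ZMod 2) R) (hφ : ∀ v, q (φ v) = 0)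
    (hψ : ∀ f, q (ψ f) = 0) (hφψ : ∀ v f, polar q (φ v) (ψ f) = v ⬝ᵥ f) :
    (hypForm ι).IsometryEquiv q where
  toLinearEquiv := LinearEquiv.ofInjectiveOfFinrankEq (φ.coprod ψ)
    (coprod_injective_of_polar_eq_dotProduct hφ hψ hφψ)
    (by rw [finrank_prod, finrank_fintype_fun_eq_card, ← hR, two_mul])
  map_app' m := by
    change q (φ m.1 + ψ m.2) = m.1 ⬝ᵥ m.2
    rw [QuadraticMap.map_add q, hφ, hψ, hφψ, zero_add, zero_add]

end HyperbolicFrames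

section ExtremalCodes

open QuadraticMap Module

/-- A totally singular subspace of half the dimension in the cube of a nondegenerate quadratic
space, all of whose nonzero elements have weight at least four. -/
structure IsExtremalCode {R : Type*} [AddCommGroup R] [Module (ZMod 2) R]
    (q : QuadraticForm (ZMod 2) R) (S : Submodule (ZMod 2) (Fin 3 → R)) : Prop where
  nondegenerate : (polarBilin q).Nondegenerate
  isTotallySingular : IsTotallySingular (quadPow q 3) S
  two_mul_finrank : 2 * finrank (ZMod 2) S = 3 * finrank (ZMod 2) R
  four_le_wtPow : ∀ v ∈ S, v ≠ 0 → 4 ≤ wtPow q 3 v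

theorem exists_sum_fin_three {i j : Fin 3} (hij : i ≠ j) {M : Type*} [AddCommMonoid M] :
    ∃ k, ∀ f : Fin 3 → M, ∑ l, f l = f i + f j + f k := by
  have hperm : ∀ i j : Fin 3, i ≠ j → ∃ k,
      (Finset.univ : Finset (Fin 3)) = {i, j, k} ∧ i ≠ k ∧ j ≠ k := by decide
  obtain ⟨k, hk, hik, hjk⟩ := hperm i j hij
  refine ⟨k, fun f => ?_⟩
  rw [hk, Finset.sum_insert (by simp [hij, hik]), Finset.sum_pair hjk, add_assoc]

namespace IsExtremalCode

variable {R : Type*} [AddCommGroup R] [Module (ZMod 2) R] {q : QuadraticForm (ZMod 2) R}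
  {S : Submodule (ZMod 2) (Fin 3 → R)} (hS : IsExtremalCode q S)

include hS

theorem eq_zero_of_apply_eq_zero {s : Fin 3 → R} (hs : s ∈ S) {i j : Fin 3} (hij : i ≠ j)
    (hi : s i = 0) (hj : s j = 0) : s = 0 := by
  by_contra hne
  obtain ⟨k, hk⟩ := exists_sum_fin_three hij (M := ℕ)
  have hw : wtPow q 3 s = wt q (s k) := by
    rw [wtPow, hk, hi, hj, wt_zero, zero_add, zero_add]
  exact absurd (hS.four_le_wtPow s hs hne) (by have := wt_le_two q (s k); omega)

theorem map_eq_zero_of_apply_eq_zero {s : Fin 3 → R} (hs : s ∈ S) {i : Fin 3} (hi : s i = 0)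
    (j : Fin 3) : q (s j) = 0 := by
  refine (zmod_two_eq _).resolve_right fun hj => ?_
  have hij : i ≠ j := by rintro rfl; simp [hi] at hj
  obtain ⟨k, hk⟩ := exists_sum_fin_three hij (M := ℕ)
  have hw : wtPow q 3 s = 1 + wt q (s k) := by
    rw [wtPow, hk, hi, wt_zero, wt_of_eq_one hj, zero_add]
  have hne : s ≠ 0 := by rintro rfl; simp at hj
  exact absurd (hS.four_le_wtPow s hs hne) (by have := wt_le_two q (s k); omega)

end IsExtremalCode

/-- The restriction to a subspace of `R^k` of the `i`-th coordinate map. -/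
abbrev codeProj {R : Type*} [AddCommGroup R] [Module (ZMod 2) R] {k : ℕ}
    (S : Submodule (ZMod 2) (Fin k → R)) (i : Fin k) : S →ₗ[ZMod 2] R :=
  LinearMap.proj i ∘ₗ S.subtype

namespace IsExtremalCode

variable {R : Type*} [AddCommGroup R] [Module (ZMod 2) R] {q : QuadraticForm (ZMod 2) R}
  {S : Submodule (ZMod 2) (Fin 3 → R)} (hS : IsExtremalCode q S)

include hS

theorem isTotallySingular_map_ker (i j : Fin 3) :
    IsTotallySingular q ((LinearMap.ker (codeProj S i)).map (codeProj S j)) := by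
  rintro _ ⟨s, hs, rfl⟩
  exact hS.map_eq_zero_of_apply_eq_zero s.2 hs j

theorem injOn_codeProj_ker {i j : Fin 3} (hij : i ≠ j) :
    Set.InjOn (codeProj S j) (LinearMap.ker (codeProj S i)) := by
  intro s hs t ht hst
  refine sub_eq_zero.1 (Subtype.ext (hS.eq_zero_of_apply_eq_zero (s - t).2 hij ?_ ?_))
  · exact (Submodule.sub_mem _ hs ht : s - t ∈ LinearMap.ker (codeProj S i))
  · exact sub_eq_zero.2 hst

theorem finrank_map_ker {i j : Fin 3} (hij : i ≠ j) :
    finrank (ZMod 2) ((LinearMap.ker (codeProj S i)).map (codeProj S j))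
      = finrank (ZMod 2) (LinearMap.ker (codeProj S i)) := by
  rw [← LinearMap.range_domRestrict]
  exact LinearMap.finrank_range_of_inj fun s t hst =>
    Subtype.ext (hS.injOn_codeProj_ker hij s.2 t.2 hst)

variable [FiniteDimensional (ZMod 2) R]

theorem two_mul_finrank_ker (i : Fin 3) :
    2 * finrank (ZMod 2) (LinearMap.ker (codeProj S i)) = finrank (ZMod 2) R := by
  have hij : i ≠ i + 1 := by fin_cases i <;> decide
  have := (hS.isTotallySingular_map_ker i (i + 1)).two_mul_finrank_le hS.nondegenerate
  have := hS.finrank_map_ker hij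
  have := LinearMap.finrank_range_add_finrank_ker (codeProj S i)
  have := Submodule.finrank_le (LinearMap.range (codeProj S i))
  have := hS.two_mul_finrank
  omega

theorem codeProj_surjective (i : Fin 3) : Function.Surjective (codeProj S i) := by
  rw [← LinearMap.range_eq_top]
  apply Submodule.eq_top_of_finrank_eq
  have := LinearMap.finrank_range_add_finrank_ker (codeProj S i)
  have := hS.two_mul_finrank_ker i
  have := hS.two_mul_finrank
  omega

theorem map_ker_eq_map_ker {i j k : Fin 3} (hij : i ≠ j) (hik : i ≠ k) (hjk : j ≠ k) :
    (LinearMap.ker (codeProj S i)).map (codeProj S k)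
      = (LinearMap.ker (codeProj S j)).map (codeProj S k) := by
  have hi : 2 * finrank (ZMod 2) ((LinearMap.ker (codeProj S i)).map (codeProj S k))
      = finrank (ZMod 2) R := by rw [hS.finrank_map_ker hik, hS.two_mul_finrank_ker]
  have hj : 2 * finrank (ZMod 2) ((LinearMap.ker (codeProj S j)).map (codeProj S k))
      = finrank (ZMod 2) R := by rw [hS.finrank_map_ker hjk, hS.two_mul_finrank_ker]
  refine (Submodule.eq_of_le_of_finrank_eq ?_ (by omega)).symm
  rw [← (hS.isTotallySingular_map_ker i k).orthogonal_eq hS.nondegenerate hi]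
  rintro _ ⟨t, ht, rfl⟩ _ ⟨s, hs, rfl⟩
  have hst := hS.isTotallySingular.polar_eq_zero s.2 t.2
  have hs : s.1 i = 0 := hs
  have ht : t.1 j = 0 := ht
  rw [polar_quadPow, Finset.sum_eq_single k] at hst
  · exact hst
  · intro l _ hl
    have : l = i ∨ l = j := by clear * - hij hik hjk hl; decide +revert
    rcases this with rfl | rfl
    · rw [hs, polar_zero_left]
    · rw [ht, polar_zero_right]
  · simp

end IsExtremalCode

end ExtremalCodes

section GlueFrames

open QuadraticMap Module

variable {R : Type*} [AddCommGroup R] [Module (ZMod 2) R]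
  {q : QuadraticForm (ZMod 2) R} {S : Submodule (ZMod 2) (Fin 3 → R)}
  {ι : Type*} [Fintype ι]

namespace IsExtremalCode

theorem polar_add_polar_eq_zero (hS : IsExtremalCode q S) {s t : Fin 3 → R} (hs : s ∈ S)
    (ht : t ∈ S) : polar q (s 0) (t 0) + polar q (s 1) (t 1) + polar q (s 2) (t 2) = 0 := by
  rw [← Fin.sum_univ_three fun i => polar q (s i) (t i), ← polar_quadPow]
  exact hS.isTotallySingular.polar_eq_zero hs ht

/-- Three linear families of codewords giving half-frames in the three coordinates: `A` and `B`
run through the codewords whose last and first coordinate vanish, and `D` is dual to `A` in the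
first coordinate. -/
structure GlueData (q : QuadraticForm (ZMod 2) R) (S : Submodule (ZMod 2) (Fin 3 → R))
    (ι : Type*) [Fintype ι] where
  (A B D : (ι → ZMod 2) →ₗ[ZMod 2] S)
  A_apply_two : ∀ v, (A v).1 2 = 0
  B_apply_zero : ∀ v, (B v).1 0 = 0
  A_apply_one : ∀ v, (A v).1 1 = (B v).1 1
  polar_A_D : ∀ v f, polar q ((A v).1 0) ((D f).1 0) = v ⬝ᵥ f

namespace GlueData

/-- The half-frame in coordinate `i` that is dual to `G.D`. -/
def half (G : GlueData q S ι) (i : Fin 3) : (ι → ZMod 2) →ₗ[ZMod 2] S :=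
  if i = 2 then G.B else G.A

theorem map_half (hS : IsExtremalCode q S) (G : GlueData q S ι) (i : Fin 3) (v : ι → ZMod 2) :
    q ((codeProj S i ∘ₗ G.half i) v) = 0 := by
  change q ((G.half i v).1 i) = 0
  unfold half
  split_ifs
  · exact hS.map_eq_zero_of_apply_eq_zero (G.B v).2 (G.B_apply_zero v) i
  · exact hS.map_eq_zero_of_apply_eq_zero (G.A v).2 (G.A_apply_two v) i

theorem polar_half_D (hS : IsExtremalCode q S) (G : GlueData q S ι) (i : Fin 3)
    (v f : ι → ZMod 2) :
    polar q ((codeProj S i ∘ₗ G.half i) v) ((codeProj S i ∘ₗ G.D) f) = v ⬝ᵥ f := by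
  have h1 : polar q ((G.A v).1 1) ((G.D f).1 1) = v ⬝ᵥ f := by
    have h := hS.polar_add_polar_eq_zero (G.A v).2 (G.D f).2
    rw [G.A_apply_two, polar_zero_left, add_zero, G.polar_A_D] at h
    exact (CharTwo.add_eq_zero.1 h).symm
  have h2 : polar q ((G.B v).1 2) ((G.D f).1 2) = v ⬝ᵥ f := by
    have h := hS.polar_add_polar_eq_zero (G.B v).2 (G.D f).2
    rw [G.B_apply_zero, polar_zero_left, zero_add, ← G.A_apply_one, h1] at h
    exact (CharTwo.add_eq_zero.1 h).symm
  fin_cases i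
  exacts [G.polar_A_D v f, h1, h2]

end GlueData

theorem exists_glueData_map_D_eq_zero (hS : IsExtremalCode q S) (G : GlueData q S ι) :
    ∃ G' : GlueData q S ι, ∀ i f, q ((codeProj S i ∘ₗ G'.D) f) = 0 := by
  obtain ⟨a, ha⟩ := exists_map_add_eq_zero (G.map_half hS 0) (G.polar_half_D hS 0)
  obtain ⟨b, hb⟩ := exists_map_add_eq_zero (G.map_half hS 2) (G.polar_half_D hS 2)
  let D := G.D + G.A ∘ₗ a + G.B ∘ₗ b
  have hD0 (f) : (D f).1 0 = (G.D f).1 0 + (G.A (a f)).1 0 := by simp [D, G.B_apply_zero]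
  have hD2 (f) : (D f).1 2 = (G.D f).1 2 + (G.B (b f)).1 2 := by simp [D, G.A_apply_two]
  have hq0 (f) : q ((D f).1 0) = 0 := by rw [hD0]; exact ha f
  have hq2 (f) : q ((D f).1 2) = 0 := by rw [hD2]; exact hb f
  refine ⟨{ G with D, polar_A_D := fun v f => ?_ }, fun i f => ?_⟩
  · rw [hD0, polar_add_right q, G.polar_A_D,
      show polar q ((G.A v).1 0) ((G.A (a f)).1 0) = 0 from
        polar_eq_zero_of_forall_map_eq_zero (G.map_half hS 0) v (a f), add_zero]
  · have h := hS.isTotallySingular _ (D f).2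
    rw [QuadraticMap.pi_apply, Fin.sum_univ_three, hq0, hq2, zero_add, add_zero] at h
    fin_cases i
    exacts [hq0 f, h, hq2 f]

theorem half_add_D_mem_of_mem_glueCode (G : GlueData q S ι)
    {m : Fin 3 → (ι → ZMod 2) × (ι → ZMod 2)} (hm : m ∈ glueCode ι 3) :
    (fun i => (G.half i (m i).1).1 i + (G.D (m i).2).1 i) ∈ S := by
  obtain ⟨hsnd, hfst⟩ := hm
  have hsum : (m 1).1 = (m 0).1 + (m 2).1 := by
    rw [Fin.sum_univ_three, add_right_comm] at hfst
    rw [eq_neg_of_add_eq_zero_right hfst, ZModModule.neg_eq_self]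
  convert (G.A (m 0).1 + G.B (m 2).1 + G.D (m 0).2).2 using 1
  funext i
  rw [hsnd i 0]
  fin_cases i
  · simp [GlueData.half, G.B_apply_zero]
  · simp [GlueData.half, G.A_apply_one, hsum]
  · simp [GlueData.half, G.A_apply_two]

variable [FiniteDimensional (ZMod 2) R]

theorem exists_lifts_to_ker (hS : IsExtremalCode q S)
    (hR : 2 * Fintype.card ι = finrank (ZMod 2) R) :
    ∃ A B : (ι → ZMod 2) →ₗ[ZMod 2] S, Function.Injective (codeProj S 1 ∘ₗ A) ∧
      codeProj S 1 ∘ₗ A = codeProj S 1 ∘ₗ B ∧ (∀ v, (A v).1 2 = 0) ∧ ∀ v, (B v).1 0 = 0 := by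
  let K (i : Fin 3) := LinearMap.ker (codeProj S i)
  have hcard : finrank (ZMod 2) (ι → ZMod 2) = finrank (ZMod 2) (K 2) := by
    have h : 2 * finrank (ZMod 2) (K 2) = _ := hS.two_mul_finrank_ker 2
    rw [finrank_fintype_fun_eq_card]
    omega
  let e : (ι → ZMod 2) ≃ₗ[ZMod 2] K 2 := LinearEquiv.ofFinrankEq _ _ hcard
  have hrange : LinearMap.range (codeProj S 1 ∘ₗ (K 2).subtype ∘ₗ e.toLinearMap) ≤
      LinearMap.range (codeProj S 1 ∘ₗ (K 0).subtype) := by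
    rintro _ ⟨v, rfl⟩
    rw [LinearMap.range_comp, Submodule.range_subtype,
      hS.map_ker_eq_map_ker (j := 2) (by decide) (by decide) (by decide)]
    exact Submodule.mem_map_of_mem (e v).2
  obtain ⟨b, hb⟩ := exists_comp_eq_of_range_le _ _ hrange
  exact ⟨(K 2).subtype ∘ₗ e.toLinearMap, (K 0).subtype ∘ₗ b,
    fun u v h => e.injective (Subtype.ext (hS.injOn_codeProj_ker (by decide) (e u).2 (e v).2 h)),
    hb.symm, fun v => (e v).2, fun v => (b v).2⟩

theorem exists_dual_lift (hS : IsExtremalCode q S) (i : Fin 3)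
    {φ : (ι → ZMod 2) →ₗ[ZMod 2] R} (hφ : Function.Injective φ) :
    ∃ D : (ι → ZMod 2) →ₗ[ZMod 2] S, ∀ v f, polar q (φ v) ((D f).1 i) = v ⬝ᵥ f := by
  obtain ⟨D, hD⟩ := exists_comp_eq_of_range_le ((φ.dualMap ∘ₗ polarBilin q) ∘ₗ codeProj S i)
    (dotProductBilin (ZMod 2) (ZMod 2)) fun _ _ =>
      ((surjective_dualMap_comp_polarBilin hS.nondegenerate hφ).comp (hS.codeProj_surjective i)) _
  refine ⟨D, fun v f => ?_⟩
  rw [polar_comm, dotProduct_comm]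
  exact DFunLike.congr_fun (DFunLike.congr_fun hD f) v

theorem nonempty_glueData (hS : IsExtremalCode q S)
    (hR : 2 * Fintype.card ι = finrank (ZMod 2) R) : Nonempty (GlueData q S ι) := by
  obtain ⟨A, B, hinj, hAB, hA, hB⟩ := hS.exists_lifts_to_ker hR
  obtain ⟨D, hD⟩ := hS.exists_dual_lift 1 hinj
  refine ⟨⟨A, B, D, hA, hB, DFunLike.congr_fun hAB, fun v f => ?_⟩⟩
  have h := hS.polar_add_polar_eq_zero (A v).2 (D f).2
  rw [hA, polar_zero_left, add_zero] at h
  exact (CharTwo.add_eq_zero.1 h).trans (hD v f)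

theorem exists_frames (hS : IsExtremalCode q S) (hR : 2 * Fintype.card ι = finrank (ZMod 2) R) :
    ∃ e : Fin 3 → (hypForm ι).IsometryEquiv q,
      ∀ m, (fun i => e i (m i)) ∈ S ↔ m ∈ glueCode ι 3 := by
  obtain ⟨G₀⟩ := hS.nonempty_glueData hR
  obtain ⟨G, hD⟩ := hS.exists_glueData_map_D_eq_zero G₀
  let e (i : Fin 3) := frameIsometry hR (G.map_half hS i) (hD i) (G.polar_half_D hS i)
  have he {m} (hm : m ∈ glueCode ι 3) : (fun i => e i (m i)) ∈ S :=
    half_add_D_mem_of_mem_glueCode G hm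
  refine ⟨e, fun m => ⟨fun hm => mem_glueCode_of_polar_eq_zero fun n hn => ?_, he⟩⟩
  have h := hS.isTotallySingular.polar_eq_zero (he hn) hm
  rw [polar_quadPow] at h ⊢
  simpa only [polar, ← map_add, IsometryEquiv.map_app] using h

end IsExtremalCode

end GlueFrames

/-! ### The stabilizer of the glue code -/

section SplitExtensions

variable {N N' Q E E' : Type*} [Group N] [Group N'] [Group Q] [Group E] [Group E']

theorem exists_splitting_of_factorization (i : N →* E) (s : Q →* E) (hi : Function.Injective i)
    (hconj : ∀ q n, ∃ n', s q * i n = i n' * s q) (hfac : ∀ g, ∃ n q, g = i n * s q)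
    (htriv : ∀ n q, i n = s q → q = 1) :
    ∃ X : GroupExtension N E Q, Nonempty X.Splitting := by
  have huniq {n q n' q'} (h : i n * s q = i n' * s q') : q = q' := by
    refine (mul_inv_eq_one.1 (htriv (n'⁻¹ * n) _ ?_)).symm
    rw [map_mul, map_inv, map_mul, map_inv, inv_mul_eq_iff_eq_mul, ← mul_assoc, ← h,
      mul_inv_cancel_right]
  choose f r hfr using hfac
  let rightHom : E →* Q := MonoidHom.mk' r fun a b => by
    obtain ⟨n, hn⟩ := hconj (r a) (f b)
    refine huniq (n := f (a * b)) (n' := f a * n) ?_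
    rw [← hfr, map_mul, map_mul, mul_assoc (i (f a)), ← mul_assoc (i n), ← hn, mul_assoc (s _),
      ← hfr b, ← mul_assoc, ← hfr]
  have hs (q : Q) : rightHom (s q) = q :=
    huniq (n := f (s q)) (n' := 1) (by rw [map_one, one_mul]; exact (hfr (s q)).symm)
  refine ⟨⟨i, rightHom, hi, ?_, fun q => ⟨s q, hs q⟩⟩, ⟨⟨s, hs⟩⟩⟩
  ext g
  rw [MonoidHom.mem_range, MonoidHom.mem_ker]
  constructor
  · rintro ⟨n, rfl⟩
    exact huniq (n := f (i n)) (n' := n) (by rw [map_one, mul_one]; exact (hfr (i n)).symm)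
  · intro hg
    refine ⟨f g, ?_⟩
    have h := hfr g
    rwa [show r g = 1 from hg, map_one, mul_one, eq_comm] at h

theorem exists_splitting_congr (eN : N' ≃* N) (eE : E ≃* E')
    (h : ∃ X : GroupExtension N E Q, Nonempty X.Splitting) :
    ∃ X : GroupExtension N' E' Q, Nonempty X.Splitting := by
  obtain ⟨X, ⟨s⟩⟩ := h
  refine ⟨⟨eE.toMonoidHom.comp (X.inl.comp eN.toMonoidHom),
    X.rightHom.comp eE.symm.toMonoidHom, ?_, ?_, ?_⟩, ⟨⟨eE.toMonoidHom.comp s, ?_⟩⟩⟩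
  · exact eE.injective.comp (X.inl_injective.comp eN.injective)
  · ext g
    have h : eE.symm g ∈ X.inl.range ↔ eE.symm g ∈ X.rightHom.ker := by
      rw [X.range_inl_eq_ker_rightHom]
    rw [MonoidHom.mem_range, MonoidHom.mem_ker] at h ⊢
    simpa [eN.surjective.exists, eE.eq_symm_apply] using h
  · exact X.rightHom_surjective.comp eE.symm.surjective
  · intro q
    simp

/-- The isomorphism `K ∩ H ≃ K' ∩ H'` induced by an isomorphism of the ambient groups that
carries `K` to `K'` and `H` to `H'`. -/
def subgroupOfCongr (c : E ≃* E') {H K : Subgroup E} {H' K' : Subgroup E'}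
    (hK : ∀ g, g ∈ K ↔ c g ∈ K') (hH : ∀ g, g ∈ H ↔ c g ∈ H') :
    H.subgroupOf K ≃* H'.subgroupOf K' where
  toEquiv := (c.toEquiv.subtypeEquiv hK).subtypeEquiv fun g => hH g
  map_mul' g h := Subtype.ext (Subtype.ext (map_mul c g.1.1 h.1.1))

end SplitExtensions

section WeightAutomorphisms

open QuadraticMap

variable {R : Type*} [AddCommGroup R] [Module (ZMod 2) R] {q : QuadraticForm (ZMod 2) R} {k : ℕ}
  {g : (Fin k → R) ≃ₗ[ZMod 2] (Fin k → R)}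

theorem wtPow_single (q : QuadraticForm (ZMod 2) R) (i : Fin k) (x : R) :
    wtPow q k (Pi.single i x) = wt q x := by
  rw [wtPow, Fintype.sum_eq_single i fun j hj => by rw [Pi.single_eq_of_ne hj, wt_zero],
    Pi.single_eq_same]

theorem wt_eq_zero_iff {x : R} : wt q x = 0 ↔ x = 0 := by
  unfold wt
  split_ifs <;> simp [*]

theorem exists_eq_single_of_wtPow_eq_one {v : Fin k → R} (hv : wtPow q k v = 1) :
    ∃ i, v = Pi.single i (v i) := by
  rw [wtPow] at hv
  obtain ⟨i, -, hi⟩ := Finset.exists_ne_zero_of_sum_ne_zero (hv.symm ▸ one_ne_zero : _ ≠ 0)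
  rw [← Finset.add_sum_erase _ _ (Finset.mem_univ i)] at hv
  have h : ∑ j ∈ Finset.univ.erase i, wt q (v j) = 0 := by omega
  refine ⟨i, funext fun j => ?_⟩
  rcases eq_or_ne j i with rfl | hj
  · rw [Pi.single_eq_same]
  · rw [Pi.single_eq_of_ne hj]
    exact wt_eq_zero_iff.1 (Finset.sum_eq_zero_iff.1 h j (by simp [hj]))

theorem quadPow_of_mem_autWt (hg : g ∈ autWt q k) (v : Fin k → R) :
    quadPow q k (g v) = quadPow q k v := by
  rw [← natCast_wtPow, hg v, natCast_wtPow]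

theorem polar_of_mem_autWt (hg : g ∈ autWt q k) (v w : Fin k → R) :
    polar (quadPow q k) (g v) (g w) = polar (quadPow q k) v w := by
  simp only [polar, ← map_add, quadPow_of_mem_autWt hg]

theorem wt_eq_wt {R' : Type*} [AddCommGroup R'] [Module (ZMod 2) R']
    {q' : QuadraticForm (ZMod 2) R'} {x : R} {y : R'} (h0 : x = 0 ↔ y = 0) (h : q x = q' y) :
    wt q x = wt q' y := by
  classical
  simp only [wt, h0, h]

theorem polar_map_isometry {R' : Type*} [AddCommGroup R'] [Module (ZMod 2) R']
    {q' : QuadraticForm (ZMod 2) R'} (h : q →qᵢ q') (x y : R) :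
    polar q' (h x) (h y) = polar q x y := by
  simp only [polar, ← map_add, Isometry.map_app]

theorem injective_of_isometry (hq : ∀ x, (∀ y, polar q x y = 0) → x = 0) (h : q →qᵢ q) :
    Function.Injective h := by
  refine (injective_iff_map_eq_zero h).2 fun x hx => hq x fun y => ?_
  rw [← polar_map_isometry h, hx, polar_zero_left]

theorem mem_autWt_of_isometry (hq : ∀ x, (∀ y, polar q x y = 0) → x = 0) (σ : Equiv.Perm (Fin k))
    (h : Fin k → q →qᵢ q) (hg : ∀ m i, g m i = h i (m (σ⁻¹ i))) : g ∈ autWt q k := by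
  intro m
  rw [wtPow, wtPow, ← Equiv.sum_comp σ⁻¹ fun i => wt q (m i)]
  refine Finset.sum_congr rfl fun i _ => ?_
  rw [hg]
  exact wt_eq_wt (map_eq_zero_iff _ (injective_of_isometry hq (h i))) ((h i).map_app _)

theorem mem_subspaceStabilizer_of_hom {G W : Type*} [Group G] [AddCommGroup W]
    [Module (ZMod 2) W] {S : Submodule (ZMod 2) W} (ρ : G →* (W ≃ₗ[ZMod 2] W))
    (hρ : ∀ a, ∀ v ∈ S, ρ a v ∈ S) (a : G) : ρ a ∈ subspaceStabilizer S := by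
  refine fun v => ⟨fun hv => ?_, hρ a v⟩
  have h := hρ a⁻¹ _ hv
  rwa [← LinearEquiv.mul_apply, ← map_mul, inv_mul_cancel, map_one] at h

/-- A spanning family of nonsingular vectors whose graph of nonzero polar products is connected,
such as the classes of the simple roots of an irreducible simply laced root lattice. -/
structure IsRootFamily {α : Type*} (q : QuadraticForm (ZMod 2) R) (r : α → R) : Prop where
  map_eq_one : ∀ a, q (r a) = 1
  span_eq_top : Submodule.span (ZMod 2) (Set.range r) = ⊤
  connected : ∀ a b, Relation.ReflTransGen (fun a b => polar q (r a) (r b) = 1) a b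

namespace IsRootFamily

variable {α : Type*} {r : α → R}

theorem map_isometryEquiv {R' : Type*} [AddCommGroup R'] [Module (ZMod 2) R']
    {q' : QuadraticForm (ZMod 2) R'} (hr : IsRootFamily q r) (e : q.IsometryEquiv q') :
    IsRootFamily q' (e ∘ r) where
  map_eq_one a := (e.map_app _).trans (hr.map_eq_one a)
  span_eq_top := by
    have h := congrArg (Submodule.map e.toLinearEquiv.toLinearMap) hr.span_eq_top
    rwa [Submodule.map_span, ← Set.range_comp, Submodule.map_top, LinearEquiv.range] at h
  connected a b := by
    have h (x y) : polar q' (e x) (e y) = polar q x y := polar_map_isometry e.toIsometry x y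
    simpa only [Function.comp_apply, h] using hr.connected a b

variable [Nonempty α]

theorem exists_slot (hr : IsRootFamily q r) (hg : g ∈ autWt q k) (i : Fin k) :
    ∃ j, ∀ x, ∀ l ≠ j, g (Pi.single i x) l = 0 := by
  have hroot (a : α) : ∃ j x, g (Pi.single i (r a)) = Pi.single j x := by
    obtain ⟨j, hj⟩ := exists_eq_single_of_wtPow_eq_one (q := q) (v := g (Pi.single i (r a)))
      (by rw [hg, wtPow_single, wt_of_eq_one (hr.map_eq_one a)])
    exact ⟨j, _, hj⟩
  choose j x hx using hroot
  -- Images of non-orthogonal roots are non-orthogonal, hence lie in the same summand.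
  have hadj {a b} (hab : polar q (r a) (r b) = 1) : j a = j b := by
    by_contra hne
    have h := polar_of_mem_autWt hg (Pi.single i (r a)) (Pi.single i (r b))
    rw [hx, hx, polar_quadPow_single, polar_quadPow_single, Pi.single_eq_same, hab,
      Pi.single_eq_of_ne hne, polar_zero_right] at h
    exact zero_ne_one h
  obtain ⟨a₀⟩ := ‹Nonempty α›
  have hj (a : α) : j a = j a₀ := by
    induction hr.connected a₀ a with
    | refl => rfl
    | tail _ hbc ih => rw [← hadj hbc, ih]
  refine ⟨j a₀, fun y l hl => ?_⟩
  let f : R →ₗ[ZMod 2] R :=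
    LinearMap.proj l ∘ₗ g.toLinearMap ∘ₗ LinearMap.single (ZMod 2) (fun _ => R) i
  have hspan : Submodule.span (ZMod 2) (Set.range r) ≤ LinearMap.ker f := by
    rw [Submodule.span_le]
    rintro _ ⟨a, rfl⟩
    change g (Pi.single i (r a)) l = 0
    rw [hx, hj, Pi.single_eq_of_ne hl]
  exact hspan (hr.span_eq_top ▸ Submodule.mem_top (x := y))

theorem exists_perm (hr : IsRootFamily q r) (hg : g ∈ autWt q k) :
    ∃ (σ : Equiv.Perm (Fin k)) (h : Fin k → q →qᵢ q), ∀ m i, g m i = h i (m (σ⁻¹ i)) := by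
  choose τ hτ using hr.exists_slot hg
  have hsum (m : Fin k → R) : g m = ∑ l, g (Pi.single l (m l)) := by
    rw [← map_sum, Finset.univ_sum_single]
  have hsurj : Function.Surjective τ := by
    intro l
    by_contra! hl
    obtain ⟨a⟩ := ‹Nonempty α›
    obtain ⟨m, hm⟩ := g.surjective (Pi.single l (r a))
    have ha : r a = 0 := by
      rw [← Pi.single_eq_same (M := fun _ => R) l (r a), ← hm, hsum, Finset.sum_apply]
      exact Finset.sum_eq_zero fun i _ => hτ i _ l (hl i).symm
    simpa [ha] using hr.map_eq_one a
  let σ := Equiv.ofBijective τ (Finite.surjective_iff_bijective.1 hsurj)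
  have hσ {i l} (h : l ≠ σ⁻¹ i) : i ≠ τ l := fun hi => h ((Equiv.symm_apply_eq σ).2 hi).symm
  let h (i : Fin k) : R →ₗ[ZMod 2] R :=
    LinearMap.proj i ∘ₗ g.toLinearMap ∘ₗ LinearMap.single (ZMod 2) (fun _ => R) (σ⁻¹ i)
  refine ⟨σ, fun i => ⟨h i, fun y => ?_⟩, fun m i => ?_⟩
  · have hy : g (Pi.single (σ⁻¹ i) y) = Pi.single i (h i y) := by
      funext l
      rcases eq_or_ne l i with rfl | hl
      · rw [Pi.single_eq_same]; rfl
      · rw [Pi.single_eq_of_ne hl]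
        exact hτ _ y l fun h => hl (h.trans (σ.apply_symm_apply i))
    have hq := quadPow_of_mem_autWt hg (Pi.single (σ⁻¹ i) y)
    rwa [hy, quadPow_single, quadPow_single] at hq
  · rw [hsum, Finset.sum_apply]
    exact Fintype.sum_eq_single (σ⁻¹ i) fun l hl => hτ l _ i (hσ hl)

end IsRootFamily

end WeightAutomorphisms

section AlternatingMatrices

open Matrix Module

/-- The space of alternating matrices over `𝔽₂`. -/
def alternatingMatrix (ι : Type*) [Fintype ι] : Submodule (ZMod 2) (Matrix ι ι (ZMod 2)) where
  carrier := {P | ∀ f, f ⬝ᵥ P *ᵥ f = 0}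
  zero_mem' f := by simp
  add_mem' hP hQ f := by rw [add_mulVec, dotProduct_add, hP, hQ, add_zero]
  smul_mem' c P hP f := by rw [smul_mulVec, dotProduct_smul, hP, smul_zero]

variable {ι : Type*} [Fintype ι]

theorem conj_mem_alternatingMatrix {P : Matrix ι ι (ZMod 2)} (hP : P ∈ alternatingMatrix ι)
    (A : Matrix ι ι (ZMod 2)) : A * P * Aᵀ ∈ alternatingMatrix ι := fun f => by
  rw [← mulVec_mulVec, ← mulVec_mulVec, dotProduct_mulVec, ← mulVec_transpose, hP]

theorem apply_self_of_mem_alternatingMatrix {P : Matrix ι ι (ZMod 2)}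
    (hP : P ∈ alternatingMatrix ι) (a : ι) : P a a = 0 := by
  classical
  simpa using hP (Pi.single a 1)

theorem apply_comm_of_mem_alternatingMatrix {P : Matrix ι ι (ZMod 2)}
    (hP : P ∈ alternatingMatrix ι) (a b : ι) : P a b = P b a := by
  classical
  have h := hP (Pi.single a 1 + Pi.single b 1)
  rw [mulVec_add, add_dotProduct, dotProduct_add, dotProduct_add] at h
  simp only [mulVec_single_one, single_one_dotProduct, col_apply,
    apply_self_of_mem_alternatingMatrix hP] at h
  exact CharTwo.add_eq_zero.1 (by simpa using h)

theorem add_transpose_mem_alternatingMatrix (U : Matrix ι ι (ZMod 2)) :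
    U + Uᵀ ∈ alternatingMatrix ι := fun f => by
  rw [add_mulVec, dotProduct_add, dotProduct_mulVec f Uᵀ, vecMul_transpose, dotProduct_comm f,
    CharTwo.add_self_eq_zero]

variable [LinearOrder ι]

variable (ι) in
/-- An alternating matrix is determined by its strict upper triangle, which is arbitrary. -/
def alternatingMatrixEquiv :
    alternatingMatrix ι ≃ₗ[ZMod 2] ({p : ι × ι // p.1 < p.2} → ZMod 2) :=
  LinearEquiv.ofBijective
    { toFun := fun P p => P.1 p.1.1 p.1.2
      map_add' := fun _ _ => rfl
      map_smul' := fun _ _ => rfl } <| by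
    constructor
    · rintro ⟨P, hP⟩ ⟨P', hP'⟩ h
      ext a b
      rcases lt_trichotomy a b with hab | rfl | hab
      · exact congrFun h ⟨(a, b), hab⟩
      · exact (apply_self_of_mem_alternatingMatrix hP a).trans
          (apply_self_of_mem_alternatingMatrix hP' a).symm
      · exact (apply_comm_of_mem_alternatingMatrix hP a b).trans
          ((congrFun h ⟨(b, a), hab⟩).trans (apply_comm_of_mem_alternatingMatrix hP' b a))
    · intro y
      let U : Matrix ι ι (ZMod 2) := of fun a b => if h : a < b then y ⟨(a, b), h⟩ else 0
      refine ⟨⟨U + Uᵀ, add_transpose_mem_alternatingMatrix U⟩, funext fun p => ?_⟩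
      change U p.1.1 p.1.2 + U p.1.2 p.1.1 = y p
      simp [U, p.2, p.2.not_gt]

theorem finrank_alternatingMatrix :
    finrank (ZMod 2) (alternatingMatrix ι) = Fintype.card {p : ι × ι // p.1 < p.2} := by
  rw [(alternatingMatrixEquiv ι).finrank_eq, finrank_fintype_fun_eq_card]

end AlternatingMatrices

section SiegelParabolic

open Matrix Module

/-- The families `(P_i)` of `k` alternating matrices with `∑ P_i = 0`: the unipotent radical of
the stabilizer of the glue code. -/
abbrev glueRadical (ι : Type*) [Fintype ι] (k : ℕ) :
    Submodule (ZMod 2) (Fin k → alternatingMatrix ι) :=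
  LinearMap.ker (∑ i, LinearMap.proj i)

theorem finrank_glueRadical (ι : Type*) [Fintype ι] [LinearOrder ι] (k : ℕ) :
    finrank (ZMod 2) (glueRadical ι (k + 1)) = k * Fintype.card {p : ι × ι // p.1 < p.2} := by
  let f : (Fin (k + 1) → alternatingMatrix ι) →ₗ[ZMod 2] alternatingMatrix ι :=
    ∑ i, LinearMap.proj i
  have hf : LinearMap.range f = ⊤ :=
    LinearMap.range_eq_top.2 fun P => ⟨Pi.single 0 P, by simp [f, LinearMap.sum_apply]⟩
  have h := LinearMap.finrank_range_add_finrank_ker f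
  rw [hf, finrank_top, finrank_pi_const, finrank_alternatingMatrix, add_mul, one_mul,
    add_comm] at h
  exact Nat.add_right_cancel h

variable {ι : Type*} [Fintype ι] {k : ℕ}

theorem sum_glueRadical (P : glueRadical ι k) : ∑ i, (P.1 i).1 = 0 := by
  have h : (∑ i, LinearMap.proj i : (Fin k → alternatingMatrix ι) →ₗ[ZMod 2] _) P.1 = 0 := P.2
  simpa only [LinearMap.sum_apply, LinearMap.proj_apply, AddSubmonoidClass.coe_finsetSum,
    ZeroMemClass.coe_zero] using congrArg Subtype.val h

theorem exists_glueRadical {P : Fin k → Matrix ι ι (ZMod 2)}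
    (hP : ∀ i, P i ∈ alternatingMatrix ι) (hsum : ∑ i, P i = 0) :
    ∃ P' : glueRadical ι k, ∀ i, (P'.1 i).1 = P i :=
  ⟨⟨fun i => ⟨P i, hP i⟩, LinearMap.mem_ker.2 (Subtype.ext (by simpa [LinearMap.sum_apply]))⟩,
    fun _ => rfl⟩

/-- The map `(a, f) ↦ (a + P f, f)`. -/
def shear (P : Matrix ι ι (ZMod 2)) : Module.End (ZMod 2) ((ι → ZMod 2) × (ι → ZMod 2)) :=
  (LinearMap.fst _ _ _ + P.mulVecLin ∘ₗ LinearMap.snd _ _ _).prod (LinearMap.snd _ _ _)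

theorem shear_add (P P' : Matrix ι ι (ZMod 2)) : shear (P + P') = shear P * shear P' := by
  refine LinearMap.ext fun m => Prod.ext ?_ rfl
  change m.1 + (P + P') *ᵥ m.2 = m.1 + P' *ᵥ m.2 + P *ᵥ m.2
  rw [add_mulVec, add_comm (P *ᵥ m.2), add_assoc]

/-- For alternating `P` the shear `(a, f) ↦ (a + P f, f)` preserves the hyperbolic form. -/
def shearIsometry {P : Matrix ι ι (ZMod 2)} (hP : P ∈ alternatingMatrix ι) :
    hypForm ι →qᵢ hypForm ι where
  toLinearMap := shear P
  map_app' m := by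
    change (m.1 + P *ᵥ m.2) ⬝ᵥ m.2 = m.1 ⬝ᵥ m.2
    rw [add_dotProduct, dotProduct_comm (P *ᵥ m.2), hP, add_zero]

/-- The linear automorphisms given by an action of a group by linear endomorphisms. -/
def toLinearAut {G W : Type*} [Group G] [AddCommGroup W] [Module (ZMod 2) W]
    (ρ : G →* Module.End (ZMod 2) W) : G →* (W ≃ₗ[ZMod 2] W) :=
  (LinearMap.GeneralLinearGroup.generalLinearEquiv _ _).toMonoidHom.comp ρ.toHomUnits

/-- The unipotent maps `(a_i, f_i) ↦ (a_i + P_i f_i, f_i)`. -/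
def glueUnipotent (ι : Type*) [Fintype ι] (k : ℕ) : Multiplicative (glueRadical ι k) →*
    ((Fin k → (ι → ZMod 2) × (ι → ZMod 2)) ≃ₗ[ZMod 2] (Fin k → (ι → ZMod 2) × (ι → ZMod 2))) :=
  toLinearAut
    { toFun := fun P : Multiplicative (glueRadical ι k) =>
        LinearMap.piMap fun i => shear (P.toAdd.1 i).1
      map_one' := LinearMap.ext fun m => funext fun i => Prod.ext (by simp [shear]) rfl
      map_mul' := fun P P' => by
        refine LinearMap.ext fun m => funext fun i => ?_
        change shear ((P.toAdd.1 i).1 + (P'.toAdd.1 i).1) (m i) = _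
        rw [shear_add]
        rfl }

theorem glueUnipotent_apply (P : Multiplicative (glueRadical ι k))
    (m : Fin k → (ι → ZMod 2) × (ι → ZMod 2)) (i : Fin k) :
    glueUnipotent ι k P m i = ((m i).1 + (P.toAdd.1 i).1 *ᵥ (m i).2, (m i).2) := rfl

variable [DecidableEq ι]

/-- The inverse transpose of a matrix of determinant `1`. -/
def contragredient : SpecialLinearGroup ι (ZMod 2) →* Matrix ι ι (ZMod 2) where
  toFun A := (A⁻¹).valᵀ
  map_one' := by simp
  map_mul' A B := by
    rw [← transpose_mul, _root_.mul_inv_rev]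
    rfl

theorem transpose_mul_contragredient (A : SpecialLinearGroup ι (ZMod 2)) :
    A.valᵀ * contragredient A = 1 := by
  have h : (A⁻¹).val * A.val = 1 := congrArg Subtype.val (inv_mul_cancel A)
  change A.valᵀ * (A⁻¹).valᵀ = 1
  rw [← transpose_mul, h, transpose_one]

theorem mulVec_dotProduct_contragredient (A : SpecialLinearGroup ι (ZMod 2)) (v f : ι → ZMod 2) :
    (A.val *ᵥ v) ⬝ᵥ (contragredient A *ᵥ f) = v ⬝ᵥ f := by
  rw [← vecMul_transpose, ← dotProduct_mulVec, mulVec_mulVec, transpose_mul_contragredient,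
    one_mulVec]

/-- The diagonal action of `SL` on the sum of a space and its dual. -/
def leviIsometry (A : SpecialLinearGroup ι (ZMod 2)) : hypForm ι →qᵢ hypForm ι where
  toLinearMap := A.val.mulVecLin.prodMap (contragredient A).mulVecLin
  map_app' m := mulVec_dotProduct_contragredient A m.1 m.2

/-- The maps `(a_i, f_i) ↦ (A a_{σ⁻¹ i}, A⁻ᵀ f_{σ⁻¹ i})`. -/
def glueLevi (ι : Type*) [Fintype ι] [DecidableEq ι] (k : ℕ) :
    SpecialLinearGroup ι (ZMod 2) × Equiv.Perm (Fin k) →*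
    ((Fin k → (ι → ZMod 2) × (ι → ZMod 2)) ≃ₗ[ZMod 2] (Fin k → (ι → ZMod 2) × (ι → ZMod 2))) :=
  toLinearAut
    { toFun := fun A => LinearMap.pi fun i =>
        (leviIsometry A.1).toLinearMap ∘ₗ LinearMap.proj (A.2⁻¹ i)
      map_one' := LinearMap.ext fun m => funext fun i => by
        simp [leviIsometry]
      map_mul' := fun A B => LinearMap.ext fun m => funext fun i => by
        simp [leviIsometry] }

theorem glueLevi_apply (A : SpecialLinearGroup ι (ZMod 2) × Equiv.Perm (Fin k))
    (m : Fin k → (ι → ZMod 2) × (ι → ZMod 2)) (i : Fin k) :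
    glueLevi ι k A m i =
      (A.1.val *ᵥ (m (A.2⁻¹ i)).1, contragredient A.1 *ᵥ (m (A.2⁻¹ i)).2) := rfl

end SiegelParabolic

section GlueStabilizerElements

open Matrix Module QuadraticMap

variable {ι : Type*} [Fintype ι] {k : ℕ}

theorem hypForm_nondegenerate (m : (ι → ZMod 2) × (ι → ZMod 2))
    (hm : ∀ n, polar (hypForm ι) m n = 0) : m = 0 := by
  refine Prod.ext (dotProduct_eq_zero _ fun f => ?_) (dotProduct_eq_zero _ fun v => ?_)
  · simpa [polar_hypForm] using hm (0, f)
  · simpa [polar_hypForm, dotProduct_comm v] using hm (v, 0)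

theorem glueUnipotent_mem_autWt (P : Multiplicative (glueRadical ι k)) :
    glueUnipotent ι k P ∈ autWt (hypForm ι) k :=
  mem_autWt_of_isometry hypForm_nondegenerate 1 (fun i => shearIsometry (P.toAdd.1 i).2)
    fun _ _ => rfl

theorem glueUnipotent_mem_stabilizer (P : Multiplicative (glueRadical ι k)) :
    glueUnipotent ι k P ∈ subspaceStabilizer (glueCode ι k) := by
  refine mem_subspaceStabilizer_of_hom (S := glueCode ι k) _ (fun P m hm => ⟨hm.1, ?_⟩) P
  rcases isEmpty_or_nonempty (Fin k) with h | ⟨⟨j⟩⟩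
  · exact Fintype.sum_empty _
  have h : ∑ i, (P.toAdd.1 i).1 *ᵥ (m i).2 = 0 := by
    simp only [hm.1 _ j, ← sum_mulVec, sum_glueRadical, zero_mulVec]
  simp only [glueUnipotent_apply, Finset.sum_add_distrib, hm.2, h, add_zero]

theorem glueUnipotent_injective : Function.Injective (glueUnipotent ι k) := by
  classical
  intro P P' h
  refine Multiplicative.toAdd.injective (Subtype.ext (funext fun i => Subtype.ext ?_))
  refine ext_of_mulVec_single fun a => ?_
  have h := congrArg Prod.fst (congrFun (DFunLike.congr_fun h (Pi.single i (0, Pi.single a 1))) i)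
  simpa only [glueUnipotent_apply, Pi.single_eq_same, zero_add] using h

variable [DecidableEq ι]

theorem glueLevi_mem_autWt (A : SpecialLinearGroup ι (ZMod 2) × Equiv.Perm (Fin k)) :
    glueLevi ι k A ∈ autWt (hypForm ι) k :=
  mem_autWt_of_isometry hypForm_nondegenerate A.2 (fun _ => leviIsometry A.1) fun _ _ => rfl

theorem glueLevi_mem_stabilizer (A : SpecialLinearGroup ι (ZMod 2) × Equiv.Perm (Fin k)) :
    glueLevi ι k A ∈ subspaceStabilizer (glueCode ι k) := by
  refine mem_subspaceStabilizer_of_hom (S := glueCode ι k) _ (fun A m hm => ⟨fun i j => ?_, ?_⟩) A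
  · simp only [glueLevi_apply, hm.1 (A.2⁻¹ i) (A.2⁻¹ j)]
  · simp only [glueLevi_apply, ← mulVec_sum, Equiv.sum_comp A.2⁻¹ fun i => (m i).1, hm.2,
      mulVec_zero]

theorem exists_glueLevi_mul_glueUnipotent
    (A : SpecialLinearGroup ι (ZMod 2) × Equiv.Perm (Fin k))
    (P : Multiplicative (glueRadical ι k)) :
    ∃ P', glueLevi ι k A * glueUnipotent ι k P = glueUnipotent ι k P' * glueLevi ι k A := by
  obtain ⟨P', hP'⟩ := exists_glueRadical
    (P := fun i => A.1.val * (P.toAdd.1 (A.2⁻¹ i)).1 * A.1.valᵀ)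
    (fun i => conj_mem_alternatingMatrix (P.toAdd.1 _).2 _) (by
      rw [← Finset.sum_mul, ← Finset.mul_sum,
        Equiv.sum_comp A.2⁻¹ fun i => (P.toAdd.1 i).1, sum_glueRadical, mul_zero, zero_mul])
  refine ⟨.ofAdd P', LinearEquiv.ext fun m => funext fun i => ?_⟩
  rw [LinearEquiv.mul_apply, LinearEquiv.mul_apply, glueLevi_apply, glueUnipotent_apply,
    glueUnipotent_apply, glueLevi_apply, toAdd_ofAdd, hP']
  simp only [mulVec_add, mulVec_mulVec, mul_assoc, transpose_mul_contragredient, mul_one]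

theorem eq_one_of_glueUnipotent_eq_glueLevi [Nonempty ι] [NeZero k]
    {P : Multiplicative (glueRadical ι k)}
    {A : SpecialLinearGroup ι (ZMod 2) × Equiv.Perm (Fin k)}
    (h : glueUnipotent ι k P = glueLevi ι k A) : A = 1 := by
  have happ (m : Fin k → (ι → ZMod 2) × (ι → ZMod 2)) (i : Fin k) :
      (m i).1 + (P.toAdd.1 i).1 *ᵥ (m i).2 = A.1.val *ᵥ (m (A.2⁻¹ i)).1 :=
    congrArg Prod.fst (congrFun (DFunLike.congr_fun h m) i)
  have h1 : A.1 = 1 := Subtype.ext <| ext_of_mulVec_single fun a => by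
    have h := happ (fun _ => (Pi.single a 1, 0)) 0
    rw [mulVec_zero, add_zero] at h
    exact h.symm.trans (one_mulVec _).symm
  have h2 : A.2 = 1 := inv_eq_one.1 <| Equiv.ext fun i => by
    obtain ⟨a⟩ := ‹Nonempty ι›
    by_contra hi
    change A.2⁻¹ i ≠ i at hi
    have h := congrFun (happ (Pi.single i (Pi.single a 1, 0)) i) a
    rw [Pi.single_eq_of_ne (M := fun _ => (ι → ZMod 2) × (ι → ZMod 2)) hi, Pi.single_eq_same,
      mulVec_zero, Prod.fst_zero, mulVec_zero, add_zero] at h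
    exact one_ne_zero ((Pi.single_eq_same a 1).symm.trans h)
  exact Prod.ext h1 h2

end GlueStabilizerElements

section GlueStabilizerFactorization

open Matrix Module QuadraticMap

variable {ι : Type*} [Fintype ι] {k : ℕ}

theorem snd_eq_zero_of_forall_mem_glueCode {h : Fin k → hypForm ι →qᵢ hypForm ι} (hk : 2 < k)
    (hS : ∀ m ∈ glueCode ι k, (fun i => h i (m i)) ∈ glueCode ι k) (i : Fin k) (a : ι → ZMod 2) :
    (h i (a, 0)).2 = 0 ∧ ∀ j, h j (a, 0) = h i (a, 0) := by
  have key {i j : Fin k} (hij : i ≠ j) : (h i (a, 0)).2 = 0 ∧ (h j (a, 0)).1 = (h i (a, 0)).1 := by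
    let m : Fin k → (ι → ZMod 2) × (ι → ZMod 2) := Pi.single i (a, 0) + Pi.single j (a, 0)
    have hi : m i = (a, 0) := by simp [m, hij]
    have hj : m j = (a, 0) := by simp [m, hij.symm]
    have hl {l} (h : l ≠ i ∧ l ≠ j) : m l = 0 := by simp [m, h]
    have hm : m ∈ glueCode ι k := by
      refine ⟨fun l l' => ?_, ?_⟩
      · have hm2 (l) : (m l).2 = 0 := by
          by_cases h : l ≠ i ∧ l ≠ j
          · rw [hl h]; rfl
          · rcases not_and_or.1 h with h | h <;> rw [not_not.1 h] <;> simp only [hi, hj]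
        rw [hm2, hm2]
      · rw [Fintype.sum_eq_add i j hij fun l h => by rw [hl h]; rfl, hi, hj,
          ZModModule.add_self]
    obtain ⟨h2, h1⟩ := hS m hm
    obtain ⟨l, hli, hlj⟩ := Fin.exists_ne_and_ne_of_two_lt i j hk
    have hil := h2 i l
    rw [Fintype.sum_eq_add i j hij fun l h => by simp only [hl h, map_zero, Prod.fst_zero]] at h1
    simp only [hi, hj, hl ⟨hli, hlj⟩, map_zero, Prod.snd_zero] at h1 hil
    exact ⟨hil, (sub_eq_zero.1 ((ZModModule.sub_eq_add _ _).trans h1)).symm⟩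
  obtain ⟨l, hl, -⟩ := Fin.exists_ne_and_ne_of_two_lt i i hk
  refine ⟨(key hl.symm).1, fun j => ?_⟩
  rcases eq_or_ne i j with rfl | hij
  · rfl
  · exact Prod.ext (key hij).2 ((key hij.symm).1.trans (key hij).1.symm)

theorem exists_eq_shear_leviIsometry [DecidableEq ι] {h : hypForm ι →qᵢ hypForm ι}
    (h0 : ∀ a, (h (a, 0)).2 = 0) :
    ∃ A : SpecialLinearGroup ι (ZMod 2), ∃ P ∈ alternatingMatrix ι, ∀ m,
      h m = shear P (leviIsometry A m) := by
  have hmat (φ : (ι → ZMod 2) →ₗ[ZMod 2] (ι → ZMod 2)) :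
      ∃ M : Matrix ι ι (ZMod 2), ∀ a, φ a = M *ᵥ a :=
    ⟨LinearMap.toMatrix' φ, fun a => (LinearMap.toMatrix'_mulVec φ a).symm⟩
  obtain ⟨A, hA⟩ := hmat (LinearMap.fst _ _ _ ∘ₗ h.toLinearMap ∘ₗ LinearMap.inl _ _ _)
  obtain ⟨B, hB⟩ := hmat (LinearMap.fst _ _ _ ∘ₗ h.toLinearMap ∘ₗ LinearMap.inr _ _ _)
  obtain ⟨C, hC⟩ := hmat (LinearMap.snd _ _ _ ∘ₗ h.toLinearMap ∘ₗ LinearMap.inr _ _ _)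
  replace hA (a) : h (a, 0) = (A *ᵥ a, 0) := Prod.ext (hA a) (h0 a)
  have hBC (f) : h (0, f) = (B *ᵥ f, C *ᵥ f) := Prod.ext (hB f) (hC f)
  have hAC : Aᵀ * C = 1 := by
    refine ext_of_mulVec_single fun i => dotProduct_eq _ _ fun a => ?_
    have hp := polar_map_isometry h (a, 0) (0, Pi.single i 1)
    rw [hA, hBC, polar_hypForm, polar_hypForm] at hp
    rw [dotProduct_comm, ← mulVec_mulVec, dotProduct_mulVec, vecMul_transpose, one_mulVec,
      dotProduct_comm _ a]
    simpa only [dotProduct_zero, add_zero] using hp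
  have hdet : A.det = 1 := by
    refine (zmod_two_eq A.det).resolve_left fun h0 => ?_
    have := congrArg det hAC
    rw [det_mul, det_transpose, h0, zero_mul, det_one] at this
    exact zero_ne_one this
  have hCA : C * Aᵀ = 1 := mul_eq_one_comm.1 hAC
  have hC : contragredient ⟨A, hdet⟩ = C :=
    (right_inv_eq_right_inv hAC (transpose_mul_contragredient ⟨A, hdet⟩)).symm
  refine ⟨⟨A, hdet⟩, B * Aᵀ, fun g => ?_, fun m => ?_⟩
  · have hg := h.map_app (0, Aᵀ *ᵥ g)
    rw [hBC, mulVec_mulVec, mulVec_mulVec, hCA, one_mulVec, hypForm_apply, hypForm_apply,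
      zero_dotProduct] at hg
    rwa [dotProduct_comm]
  · have hm : h m = h (m.1, 0) + h (0, m.2) := by
      rw [← map_add, Prod.mk_add_mk, add_zero, zero_add]
    rw [hm, hA, hBC]
    refine Prod.ext ?_ ?_
    · change A *ᵥ m.1 + B *ᵥ m.2 = A *ᵥ m.1 + (B * Aᵀ) *ᵥ (contragredient ⟨A, hdet⟩ *ᵥ m.2)
      rw [hC, mulVec_mulVec, mul_assoc, hAC, mul_one]
    · change 0 + C *ᵥ m.2 = contragredient ⟨A, hdet⟩ *ᵥ m.2
      rw [hC, zero_add]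

theorem exists_eq_glueUnipotent_mul_glueLevi [DecidableEq ι] {α : Type*} [Nonempty α]
    {r : α → (ι → ZMod 2) × (ι → ZMod 2)} (hr : IsRootFamily (hypForm ι) r) (hk : 2 < k)
    {g : (Fin k → (ι → ZMod 2) × (ι → ZMod 2)) ≃ₗ[ZMod 2] (Fin k → (ι → ZMod 2) × (ι → ZMod 2))}
    (hg : g ∈ autWt (hypForm ι) k) (hS : g ∈ subspaceStabilizer (glueCode ι k)) :
    ∃ P A, g = glueUnipotent ι k P * glueLevi ι k A := by
  obtain ⟨σ, h, hσ⟩ := hr.exists_perm hg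
  have hcode : ∀ m ∈ glueCode ι k, (fun i => h i (m i)) ∈ glueCode ι k := fun m hm => by
    have h : g (m ∘ σ) = fun i => h i (m i) := funext fun i => by
      rw [hσ, Function.comp_apply, ← Equiv.Perm.mul_apply, mul_inv_cancel, Equiv.Perm.one_apply]
    exact h ▸ (hS (m ∘ σ)).2
      ⟨fun i j => hm.1 _ _, (Equiv.sum_comp σ fun i => (m i).1).trans hm.2⟩
  choose A P hP hAP using fun i =>
    exists_eq_shear_leviIsometry fun a => (snd_eq_zero_of_forall_mem_glueCode hk hcode i a).1
  have hfst (i m) : (h i m).1 = (A i).val *ᵥ m.1 + P i *ᵥ (contragredient (A i) *ᵥ m.2) :=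
    congrArg Prod.fst (hAP i m)
  let j : Fin k := ⟨0, by omega⟩
  have hA (i : Fin k) : A i = A j := Subtype.ext <| ext_of_mulVec_single fun a => by
    have h := (snd_eq_zero_of_forall_mem_glueCode hk hcode j (Pi.single a 1)).2 i
    simpa only [hfst, mulVec_zero, add_zero] using congrArg Prod.fst h
  have hsum : ∑ i, P i = 0 := ext_of_mulVec_single fun a => by
    have h := (hcode (fun _ => (0, (A j).valᵀ *ᵥ Pi.single a 1)) ⟨fun _ _ => rfl, by simp⟩).2
    have hinv : contragredient (A j) *ᵥ ((A j).valᵀ *ᵥ Pi.single a 1) = Pi.single a 1 := by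
      rw [mulVec_mulVec, mul_eq_one_comm.1 (transpose_mul_contragredient (A j)), one_mulVec]
    simp only [hfst, hA, mulVec_zero, zero_add, hinv] at h
    rw [sum_mulVec, zero_mulVec, h]
  obtain ⟨P', hP'⟩ := exists_glueRadical hP hsum
  refine ⟨.ofAdd P', (A j, σ), LinearEquiv.ext fun m => funext fun i => ?_⟩
  rw [hσ, hAP, hA, ← hP']
  rfl

end GlueStabilizerFactorization

section GlueStabilizer

open Matrix Module QuadraticMap

theorem exists_splitting_stabilizer_glueCode {ι α : Type*} [Fintype ι] [DecidableEq ι]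
    [Nonempty ι] [Nonempty α] {k : ℕ} {r : α → (ι → ZMod 2) × (ι → ZMod 2)}
    (hr : IsRootFamily (hypForm ι) r) (hk : 2 < k) :
    ∃ X : GroupExtension (Multiplicative (glueRadical ι k))
        ((subspaceStabilizer (glueCode ι k)).subgroupOf (autWt (hypForm ι) k))
        (SpecialLinearGroup ι (ZMod 2) × Equiv.Perm (Fin k)),
      Nonempty X.Splitting := by
  have : NeZero k := ⟨by omega⟩
  let i : Multiplicative (glueRadical ι k) →*
      (subspaceStabilizer (glueCode ι k)).subgroupOf (autWt (hypForm ι) k) :=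
    ((glueUnipotent ι k).codRestrict _ glueUnipotent_mem_autWt).codRestrict _
      glueUnipotent_mem_stabilizer
  let s : SpecialLinearGroup ι (ZMod 2) × Equiv.Perm (Fin k) →*
      (subspaceStabilizer (glueCode ι k)).subgroupOf (autWt (hypForm ι) k) :=
    ((glueLevi ι k).codRestrict _ glueLevi_mem_autWt).codRestrict _ glueLevi_mem_stabilizer
  have hext {g h : (subspaceStabilizer (glueCode ι k)).subgroupOf (autWt (hypForm ι) k)}
      (hgh : g.1.1 = h.1.1) : g = h := Subtype.ext (Subtype.ext hgh)
  refine exists_splitting_of_factorization i s (fun P P' h => ?_) (fun A P => ?_) (fun g => ?_)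
    (fun P A h => ?_)
  · exact glueUnipotent_injective (congrArg (fun g => g.1.1) h)
  · obtain ⟨P', h⟩ := exists_glueLevi_mul_glueUnipotent A P
    exact ⟨P', hext h⟩
  · obtain ⟨P, A, h⟩ := exists_eq_glueUnipotent_mul_glueLevi hr hk g.1.2 g.2
    exact ⟨P, A, hext h⟩
  · exact eq_one_of_glueUnipotent_eq_glueLevi (congrArg (fun g => g.1.1) h)

variable {R : Type*} [AddCommGroup R] [Module (ZMod 2) R] {q : QuadraticForm (ZMod 2) R}

theorem nonempty_stabilizer_glueCode_mulEquiv {ι : Type*} [Fintype ι] {k : ℕ}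
    {S : Submodule (ZMod 2) (Fin k → R)} {e : Fin k → (hypForm ι).IsometryEquiv q}
    (he : ∀ m, (fun i => e i (m i)) ∈ S ↔ m ∈ glueCode ι k) :
    Nonempty ((subspaceStabilizer (glueCode ι k)).subgroupOf (autWt (hypForm ι) k) ≃*
      (subspaceStabilizer S).subgroupOf (autWt q k)) := by
  let J : (Fin k → (ι → ZMod 2) × (ι → ZMod 2)) ≃ₗ[ZMod 2] (Fin k → R) :=
    LinearEquiv.piCongrRight fun i => (e i).toLinearEquiv
  let c : ((Fin k → (ι → ZMod 2) × (ι → ZMod 2)) ≃ₗ[ZMod 2] _) ≃* ((Fin k → R) ≃ₗ[ZMod 2] _) :=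
    { toFun := fun g => (J.symm.trans g).trans J
      invFun := fun g => (J.trans g).trans J.symm
      left_inv := fun g => by ext1; simp
      right_inv := fun g => by ext1; simp
      map_mul' := fun g h => by ext1; simp [LinearEquiv.mul_apply] }
  have hc (g m) : c g (J m) = J (g m) := congrArg (J ∘ g) (J.symm_apply_apply m)
  have hJS (m) : J m ∈ S ↔ m ∈ glueCode ι k := he m
  have hJw (m) : wtPow q k (J m) = wtPow (hypForm ι) k m :=
    Finset.sum_congr rfl fun i _ =>
      wt_eq_wt (map_eq_zero_iff _ (e i).toLinearEquiv.injective) ((e i).map_app _)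
  refine ⟨subgroupOfCongr c (fun g => ?_) (fun g => ?_)⟩
  · refine Iff.trans (forall_congr' fun m => ?_) J.surjective.forall.symm
    rw [hc, hJw, hJw]
  · refine Iff.trans (forall_congr' fun m => ?_) J.surjective.forall.symm
    rw [hc, hJS, hJS]

theorem exists_splitting_stabilizer {ι α : Type*} [Fintype ι] [LinearOrder ι] [Nonempty ι]
    [Nonempty α] {k d : ℕ} {S : Submodule (ZMod 2) (Fin (k + 1) → R)} {r : α → R}
    (hr : IsRootFamily q r) (hk : 1 < k) {e : Fin (k + 1) → (hypForm ι).IsometryEquiv q}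
    (he : ∀ m, (fun i => e i (m i)) ∈ S ↔ m ∈ glueCode ι (k + 1))
    (hd : k * Fintype.card {p : ι × ι // p.1 < p.2} = d) :
    ∃ X : GroupExtension (Multiplicative (Fin d → ZMod 2))
        ((subspaceStabilizer S).subgroupOf (autWt q (k + 1)))
        (SpecialLinearGroup ι (ZMod 2) × Equiv.Perm (Fin (k + 1))),
      Nonempty X.Splitting := by
  obtain ⟨c⟩ := nonempty_stabilizer_glueCode_mulEquiv he
  let f : (Fin d → ZMod 2) ≃ₗ[ZMod 2] glueRadical ι (k + 1) :=
    LinearEquiv.ofFinrankEq _ _ (by rw [finrank_glueRadical, hd, finrank_fin_fun])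
  exact exists_splitting_congr f.toAddEquiv.toMultiplicative c
    (exists_splitting_stabilizer_glueCode (hr.map_isometryEquiv (e 0).symm) (by omega))

end GlueStabilizer

/-! ### Short vectors in the classes of `E₈ / 2E₈` -/

section ShortVectors

theorem exists_even_sum_sq_sub_le {ι : Type*} [Fintype ι] {x : ι → ℝ} {n : ι → ℤ} {j : ι}
    (hj : |x j - n j| ≤ 1 / 2) :
    ∃ n' : ι → ℤ, Even (∑ i, n' i) ∧
      ∑ i, (x i - n' i) ^ 2 ≤ ∑ i, (x i - n i) ^ 2 + (1 - 2 * |x j - n j|) := by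
  classical
  rcases Int.even_or_odd (∑ i, n i) with hn | hn
  · exact ⟨n, hn, by linarith⟩
  obtain ⟨s, hs, hsq⟩ : ∃ s : ℤ, Odd s ∧
      (x j - (n j + s : ℤ)) ^ 2 = (x j - n j) ^ 2 + (1 - 2 * |x j - n j|) := by
    rcases abs_cases (x j - n j) with ⟨h, -⟩ | ⟨h, -⟩
    · exact ⟨1, by decide, by rw [h]; push_cast; ring⟩
    · exact ⟨-1, by decide, by rw [h]; push_cast; ring⟩
  refine ⟨Function.update n j (n j + s), ?_, le_of_eq ?_⟩
  · rw [Finset.sum_update_of_mem (Finset.mem_univ j), ← Finset.erase_eq, add_right_comm,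
      Finset.add_sum_erase _ _ (Finset.mem_univ j)]
    exact hn.add_odd hs
  · rw [← Finset.add_sum_erase _ _ (Finset.mem_univ j), ← Finset.add_sum_erase _ (fun i =>
      (x i - n i) ^ 2) (Finset.mem_univ j), Function.update_self, hsq, add_right_comm,
      Finset.sum_congr rfl fun i hi => by rw [Function.update_of_ne (Finset.ne_of_mem_erase hi)]]

theorem sum_sq_le_or_sum_sq_le {ι : Type*} [Fintype ι] (hι : Fintype.card ι = 8) {d : ι → ℝ}
    {a b : ι} (ha : ∀ i, d a ≤ d i) (hb : ∀ i, d i ≤ d b) (h0 : 0 ≤ d a) (h2 : d b ≤ 1 / 2) :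
    ∑ i, d i ^ 2 ≤ 2 * d b ∨ ∑ i, d i ^ 2 + 1 + 2 * d a ≤ ∑ i, d i := by
  have hsum : ∑ i, d i ^ 2 ≤ (d a + d b) * ∑ i, d i - 8 * (d a * d b) := by
    have h : 0 ≤ ∑ i, (d i - d a) * (d b - d i) :=
      Finset.sum_nonneg fun i _ => mul_nonneg (sub_nonneg.2 (ha i)) (sub_nonneg.2 (hb i))
    have e : ∑ i, (d i - d a) * (d b - d i) =
        (d a + d b) * ∑ i, d i - ∑ i, d i ^ 2 - 8 * (d a * d b) := by
      simp only [show ∀ i, (d i - d a) * (d b - d i) =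
        (d a + d b) * d i - d i ^ 2 - d a * d b from fun i => by ring, Finset.sum_sub_distrib,
        ← Finset.mul_sum, Finset.sum_const, Finset.card_univ, hι, nsmul_eq_mul]
      push_cast
      ring
    linarith
  by_contra! h
  obtain ⟨h3, h4⟩ := h
  have hpos : 0 < d b := by
    by_contra! hneg
    nlinarith [ha b, show d b = 0 by linarith [ha b], show d a = 0 by linarith [ha b]]
  have h5 := mul_lt_mul_of_pos_left h4 (show 0 < d a + d b by linarith)
  nlinarith [mul_nonneg (show 0 ≤ 1 - d a - d b by linarith [ha b])
    (show 0 ≤ ∑ i, d i ^ 2 - 2 * d b by linarith),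
    mul_nonneg (show 0 ≤ d b - d a by linarith [ha b])
      (show 0 ≤ 1 / 2 - (d b - d a) by linarith)]

theorem toLp_intCast_mem_latticeE8 {n : Fin 8 → ℤ} (hn : Even (∑ i, n i)) :
    WithLp.toLp 2 (fun i => (n i : ℝ)) ∈ latticeE8 := by
  obtain ⟨s, hs⟩ := hn
  refine ⟨Or.inl fun i => ⟨n i, rfl⟩, s, ?_⟩
  have hs' : ∑ i, (n i : ℝ) = s + s := by exact_mod_cast hs
  rw [two_mul]
  exact hs'

theorem toLp_intCast_add_half_mem_latticeE8 {n : Fin 8 → ℤ} (hn : Even (∑ i, n i)) :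
    WithLp.toLp 2 (fun i => (n i : ℝ) + 1 / 2) ∈ latticeE8 := by
  obtain ⟨s, hs⟩ := hn
  refine ⟨Or.inr fun i => ⟨n i, rfl⟩, s + 2, ?_⟩
  have hs' : ∑ i, (n i : ℝ) = s + s := by exact_mod_cast hs
  rw [Finset.sum_add_distrib, hs', Finset.sum_const, Finset.card_univ, Fintype.card_fin,
    nsmul_eq_mul]
  push_cast
  ring

theorem abs_sub_half_sub_eq {x : ℝ} (n : ℤ) (h : |x - n| ≤ 1 / 2) :
    ∃ n' : ℤ, |x - 1 / 2 - n'| = 1 / 2 - |x - n| := by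
  rcases abs_cases (x - n) with ⟨e, -⟩ | ⟨e, -⟩
  · refine ⟨n, ?_⟩
    rw [e, abs_of_nonpos (by linarith)]
    ring
  · refine ⟨n - 1, ?_⟩
    rw [e]
    push_cast
    rw [abs_of_nonneg (by linarith)]
    ring

/- The lattice `E₈` is the union of `D₈`, the integer points with even coordinate sum, and its
translate by `(1/2, …, 1/2)`; whichever of the two has the point nearer to `x` will do. -/
theorem exists_mem_latticeE8_norm_sub_sq_le (x : EuclideanSpace ℝ (Fin 8)) :
    ∃ e ∈ latticeE8, ‖x - e‖ ^ 2 ≤ 1 := by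
  set d : Fin 8 → ℝ := fun i => |x i - round (x i)| with hd
  have hd2 : ∀ i, d i ≤ 1 / 2 := fun i => abs_sub_round (x i)
  obtain ⟨a, ha⟩ := Finite.exists_min d
  obtain ⟨b, hb⟩ := Finite.exists_max d
  choose c hc using fun i => abs_sub_half_sub_eq (round (x i)) (hd2 i)
  rcases sum_sq_le_or_sum_sq_le (Fintype.card_fin 8) ha hb (abs_nonneg _) (hd2 b) with h | h
  · obtain ⟨n, hn, hle⟩ := exists_even_sum_sq_sub_le (x := x) (n := fun i => round (x i)) (hd2 b)
    refine ⟨_, toLp_intCast_mem_latticeE8 hn, ?_⟩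
    rw [EuclideanSpace.real_norm_sq_eq]
    refine hle.trans ?_
    simp only [hd, sq_abs] at h
    linarith
  · obtain ⟨n, hn, hle⟩ := exists_even_sum_sq_sub_le (x := fun i => x i - 1 / 2) (n := c) (j := a)
      (by rw [hc]; linarith [abs_nonneg (x a - round (x a))])
    refine ⟨_, toLp_intCast_add_half_mem_latticeE8 hn, ?_⟩
    have hsum : ∑ i, (x i - 1 / 2 - c i) ^ 2 = 2 - ∑ i, d i + ∑ i, d i ^ 2 := by
      simp only [← sq_abs (_ - _ - _), hc]
      simp only [hd, sub_sq, Finset.sum_add_distrib, Finset.sum_sub_distrib, ← Finset.mul_sum,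
        Finset.sum_const, Finset.card_univ, Fintype.card_fin, nsmul_eq_mul]
      norm_num
    rw [EuclideanSpace.real_norm_sq_eq]
    calc ∑ i, (x i - (n i + 1 / 2)) ^ 2 = ∑ i, (x i - 1 / 2 - n i) ^ 2 := by
          simp only [sub_sub, add_comm]
      _ ≤ 1 := by
          refine hle.trans ?_
          rw [hsum, hc]
          linarith

theorem exists_mem_latticeE8_inner_sub_two_smul_le (v : EuclideanSpace ℝ (Fin 8)) :
    ∃ e ∈ latticeE8, inner ℝ (v - (2 : ℝ) • e) (v - (2 : ℝ) • e) ≤ 4 := by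
  obtain ⟨e, he, h⟩ := exists_mem_latticeE8_norm_sub_sq_le ((1 / 2 : ℝ) • v)
  refine ⟨e, he, ?_⟩
  rw [show v - (2 : ℝ) • e = (2 : ℝ) • ((1 / 2 : ℝ) • v - e) by
      rw [smul_sub, smul_smul]; norm_num,
    real_inner_self_eq_norm_sq, norm_smul, mul_pow, Real.norm_two]
  linarith

end ShortVectors

/-! ### Lattices and isometries -/

section DualLattice

theorem single_mem_powLattice {E : Type*} [NormedAddCommGroup E] {L : Submodule ℤ E} {k : ℕ}
    {i : Fin k} {x : E} (hx : x ∈ L) :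
    PiLp.single 2 i x ∈ powLattice L k := by
  intro j
  rcases eq_or_ne j i with rfl | hj
  · rwa [PiLp.single_eq_same]
  · rw [PiLp.single_eq_of_ne 2 hj]
    exact zero_mem L

variable {E : Type*} [NormedAddCommGroup E] [InnerProductSpace ℝ E] {L : Submodule ℤ E}

theorem mem_dualLattice_iff {x : E} :
    x ∈ dualLattice L ↔ ∀ y ∈ L, ∃ n : ℤ, inner ℝ x y = n :=
  forall₂_congr fun _ _ => Submodule.mem_one.trans (exists_congr fun _ => eq_comm)

theorem inner_piLpSingle {k : ℕ} (i : Fin k) (x : E) (y : PiLp 2 fun _ : Fin k => E) :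
    inner ℝ (PiLp.single 2 i x) y = inner ℝ x (y i) := by
  rw [PiLp.inner_apply, Finset.sum_eq_single i (fun j _ hj => by simp [hj]) (by simp),
    PiLp.single_eq_same]

theorem dualLattice_powLattice (k : ℕ) :
    dualLattice (powLattice L k) = powLattice (dualLattice L) k := by
  ext x
  rw [mem_dualLattice_iff]
  constructor
  · intro h i
    refine mem_dualLattice_iff.2 fun y hy => ?_
    obtain ⟨n, hn⟩ := h _ (single_mem_powLattice (i := i) hy)
    rw [real_inner_comm, inner_piLpSingle] at hn
    exact ⟨n, by rw [real_inner_comm, hn]⟩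
  · intro h y hy
    choose n hn using fun i => mem_dualLattice_iff.1 (h i) _ (hy i)
    exact ⟨∑ i, n i, by rw [PiLp.inner_apply, Finset.sum_congr rfl fun i _ => hn i, Int.cast_sum]⟩

theorem symm_apply_mem_dualLattice {F : Type*} [NormedAddCommGroup F] [InnerProductSpace ℝ F]
    {M : Submodule ℤ F} (T : E ≃ₗᵢ[ℝ] F) (hT : ∀ x ∈ L, T x ∈ M) {y : F}
    (hy : y ∈ dualLattice M) : T.symm y ∈ dualLattice L := by
  refine mem_dualLattice_iff.2 fun x hx => ?_
  rw [← T.inner_map_map, T.apply_symm_apply]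
  exact mem_dualLattice_iff.1 hy _ (hT x hx)

theorem latticeAut_le_latticeAut_dualLattice : latticeAut L ≤ latticeAut (dualLattice L) :=
  fun g hg _ => ⟨fun h => by
    simpa only [g.symm_apply_apply] using symm_apply_mem_dualLattice g (fun x => (hg x).2) h,
    symm_apply_mem_dualLattice g.symm fun x => ((latticeAut L).inv_mem hg x).2⟩

end DualLattice

section GramMatrix

variable {E F : Type*} [NormedAddCommGroup E] [InnerProductSpace ℝ E]
  [NormedAddCommGroup F] [InnerProductSpace ℝ F] [FiniteDimensional ℝ E] [FiniteDimensional ℝ F]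

theorem exists_linearIsometryEquiv_of_inner_eq {ι : Type*} (b : Module.Basis ι ℝ E) (u : ι → F)
    (hF : Module.finrank ℝ E = Module.finrank ℝ F)
    (h : ∀ i j, inner ℝ (u i) (u j) = inner ℝ (b i) (b j)) :
    ∃ T : E ≃ₗᵢ[ℝ] F, ∀ i, T (b i) = u i := by
  let f : E →ₗ[ℝ] F := b.constr ℝ u
  have hf : (innerₗ F).compl₁₂ f f = innerₗ E :=
    b.ext fun i => b.ext fun j => by
      simp [f, h i j]
  refine ⟨(f.isometryOfInner fun x y => LinearMap.congr_fun₂ hf x y).toLinearIsometryEquiv hF,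
    fun i => b.constr_basis ℝ u i⟩

theorem exists_linearIsometryEquiv_of_latticeIsomorphic {M : Submodule ℤ E} {N : Submodule ℤ F}
    (h : LatticeIsomorphic N M) (hF : Module.finrank ℝ E = Module.finrank ℝ F)
    (hM : Submodule.span ℝ (M : Set E) = ⊤) : ∃ T : E ≃ₗᵢ[ℝ] F, ∀ x, T x ∈ N ↔ x ∈ M := by
  obtain ⟨f, hf⟩ := h
  let b := Module.Basis.ofSpan hM.ge
  have hb : ∀ i, b i ∈ M := fun i => Module.Basis.ofSpan_subset hM.ge ⟨i, rfl⟩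
  obtain ⟨T, hT⟩ := exists_linearIsometryEquiv_of_inner_eq b (fun i => (f.symm ⟨b i, hb i⟩ : F)) hF
    fun i j => by simp only [← hf, f.apply_symm_apply]
  have hTf : ∀ y : N, T (f y) = y := fun y =>
    InnerProductSpace.ext_inner_left_basis (b.map T.toLinearEquiv) fun i => by
      change inner ℝ (T (b i)) _ = inner ℝ (T (b i)) _
      rw [T.inner_map_map, hT, ← hf, f.apply_symm_apply]
  refine ⟨T, fun x => ⟨fun hx => ?_, fun hx => ?_⟩⟩
  · rw [← T.injective (hTf ⟨T x, hx⟩)]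
    exact (f _).2
  · have hfx := hTf (f.symm ⟨x, hx⟩)
    rw [f.apply_symm_apply] at hfx
    rw [hfx]
    exact (f.symm _).2

end GramMatrix

/-- An even unimodular lattice whose nonzero vectors have squared norm at least `4`. Unimodularity
is stated as integrality, which is a consequence of evenness, together with `N* ⊆ N`. -/
structure IsExtremalLattice {E : Type*} [NormedAddCommGroup E] [InnerProductSpace ℝ E]
    (N : Submodule ℤ E) : Prop where
  even : ∀ x ∈ N, ∃ n : ℤ, inner ℝ x x = 2 * (n : ℝ)
  dualLattice_le : dualLattice N ≤ N
  four_le : ∀ x ∈ N, x ≠ 0 → 4 ≤ inner ℝ x x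

namespace IsExtremalLattice

variable {E F : Type*} [NormedAddCommGroup E] [InnerProductSpace ℝ E]
  [NormedAddCommGroup F] [InnerProductSpace ℝ F] {N : Submodule ℤ F}

theorem le_dualLattice (hN : IsExtremalLattice N) : N ≤ dualLattice N := by
  refine fun x hx => mem_dualLattice_iff.2 fun y hy => ?_
  obtain ⟨a, ha⟩ := hN.even x hx
  obtain ⟨b, hb⟩ := hN.even y hy
  obtain ⟨c, hc⟩ := hN.even (x + y) (add_mem hx hy)
  refine ⟨c - a - b, ?_⟩
  rw [real_inner_add_add_self] at hc
  push_cast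
  linarith

theorem comap (hN : IsExtremalLattice N) (T : E ≃ₗᵢ[ℝ] F) :
    IsExtremalLattice (N.comap (T.toLinearEquiv.toLinearMap.restrictScalars ℤ)) where
  even x hx := by
    rw [← T.inner_map_map]
    exact hN.even _ hx
  dualLattice_le x hx :=
    hN.dualLattice_le (symm_apply_mem_dualLattice T.symm (fun y hy => by simpa using hy) hx)
  four_le x hx hx0 := by
    rw [← T.inner_map_map]
    exact hN.four_le _ hx ((map_ne_zero_iff T T.injective).2 hx0)

end IsExtremalLattice

/-! ### Glue lattices -/

section GlueLattices

variable {E : Type*} [NormedAddCommGroup E] [InnerProductSpace ℝ E] {L : Submodule ℤ E} {k : ℕ}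

theorem discMap_eq_zero_iff (v : dualLattice L) : discMap L v = 0 ↔ (v : E) ∈ L :=
  Submodule.Quotient.mk_eq_zero _

theorem discMapPow_eq_zero_iff (v : powLattice (dualLattice L) k) :
    discMapPow L k v = 0 ↔ (v : PiLp 2 fun _ : Fin k => E) ∈ powLattice L k :=
  funext_iff.trans (forall_congr' fun _ => discMap_eq_zero_iff _)

theorem discMapPow_surjective : Function.Surjective (discMapPow L k) := by
  intro a
  choose v hv using fun i => Submodule.mkQ_surjective _ (a i)
  exact ⟨⟨WithLp.toLp 2 fun i => v i, fun i => (v i).2⟩, funext hv⟩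

theorem mem_powLattice_dualLattice_iff {γ : (PiLp 2 fun _ : Fin k => E) ≃ₗᵢ[ℝ] _}
    (hγ : γ ∈ latticeAut (powLattice L k)) (v : PiLp 2 fun _ : Fin k => E) :
    γ v ∈ powLattice (dualLattice L) k ↔ v ∈ powLattice (dualLattice L) k := by
  rw [← dualLattice_powLattice]
  exact latticeAut_le_latticeAut_dualLattice hγ v

variable [Module (ZMod 2) (DiscGroup L)]

theorem mem_latticeOf_iff {S : Submodule (ZMod 2) (Fin k → DiscGroup L)}
    {v : PiLp 2 fun _ : Fin k => E} :
    v ∈ latticeOf L S ↔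
      ∃ hv : v ∈ powLattice (dualLattice L) k, discMapPow L k ⟨v, hv⟩ ∈ S := by
  constructor
  · rintro ⟨w, hw, rfl⟩
    exact ⟨w.2, hw⟩
  · rintro ⟨hv, h⟩
    exact ⟨⟨v, hv⟩, h, rfl⟩

theorem powLattice_le_latticeOf (hL : L ≤ dualLattice L)
    (S : Submodule (ZMod 2) (Fin k → DiscGroup L)) : powLattice L k ≤ latticeOf L S :=
  fun v hv => mem_latticeOf_iff.2 ⟨fun i => hL (hv i), by
    rw [(discMapPow_eq_zero_iff ⟨v, fun i => hL (hv i)⟩).2 hv]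
    exact zero_mem S⟩

/-- The image in `R(L)^k` of a lattice `N`; the inverse of `latticeOf` on the lattices between
`L^k` and `(L*)^k`. -/
def codeOf (L : Submodule ℤ E) [Module (ZMod 2) (DiscGroup L)]
    (N : Submodule ℤ (PiLp 2 fun _ : Fin k => E)) : Submodule (ZMod 2) (Fin k → DiscGroup L) :=
  AddSubgroup.toZModSubmodule 2
    ((N.submoduleOf (powLattice (dualLattice L) k)).map (discMapPow L k)).toAddSubgroup

theorem mem_codeOf_iff {N : Submodule ℤ (PiLp 2 fun _ : Fin k => E)} (hN : powLattice L k ≤ N)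
    {v : PiLp 2 fun _ : Fin k => E} (hv : v ∈ powLattice (dualLattice L) k) :
    discMapPow L k ⟨v, hv⟩ ∈ codeOf L N ↔ v ∈ N := by
  refine ⟨?_, fun h => ⟨⟨v, hv⟩, h, rfl⟩⟩
  rintro ⟨w, hw, h⟩
  rw [← sub_eq_zero, ← map_sub, discMapPow_eq_zero_iff] at h
  have hvw : v = w - (w - v) := (sub_sub_cancel _ _).symm
  rw [hvw]
  exact sub_mem hw (hN h)

theorem latticeOf_codeOf {N : Submodule ℤ (PiLp 2 fun _ : Fin k => E)} (hN : powLattice L k ≤ N)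
    (hN' : N ≤ powLattice (dualLattice L) k) : latticeOf L (codeOf L N) = N := by
  ext v
  rw [mem_latticeOf_iff]
  exact ⟨fun ⟨hv, h⟩ => (mem_codeOf_iff hN hv).1 h, fun h => ⟨hN' h, (mem_codeOf_iff hN _).2 h⟩⟩

/-- The endomorphism of `R(L)^k` induced by an isometry preserving `L^k`. -/
def inducedEnd (γ : latticeAut (powLattice L k)) :
    Module.End (ZMod 2) (Fin k → DiscGroup L) :=
  AddMonoidHom.toZModLinearMap 2 <|
    (discMapPow L k).toAddMonoidHom.liftOfSurjective discMapPow_surjective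
      ⟨(discMapPow L k ∘ₗ (γ.1.toLinearEquiv.toLinearMap.restrictScalars ℤ).restrict
          fun v => (mem_powLattice_dualLattice_iff γ.2 v).2).toAddMonoidHom,
        fun v hv => (discMapPow_eq_zero_iff _).2 <|
          (γ.2 v).2 ((discMapPow_eq_zero_iff v).1 hv)⟩

theorem inducedEnd_discMapPow (γ : latticeAut (powLattice L k)) {v : PiLp 2 fun _ : Fin k => E}
    (hv : v ∈ powLattice (dualLattice L) k) :
    inducedEnd γ (discMapPow L k ⟨v, hv⟩) =
      discMapPow L k ⟨γ.1 v, (mem_powLattice_dualLattice_iff γ.2 v).2 hv⟩ := by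
  rw [inducedEnd, AddMonoidHom.coe_toZModLinearMap]
  exact AddMonoidHom.liftOfRightInverse_comp_apply (discMapPow L k).toAddMonoidHom _ _ _ ⟨v, hv⟩

/-- The action on `R(L)^k` of the group of isometries preserving `L^k`. -/
def inducedAut (L : Submodule ℤ E) [Module (ZMod 2) (DiscGroup L)] (k : ℕ) :
    latticeAut (powLattice L k) →*
      ((Fin k → DiscGroup L) ≃ₗ[ZMod 2] (Fin k → DiscGroup L)) :=
  (LinearMap.GeneralLinearGroup.generalLinearEquiv (ZMod 2)
    (Fin k → DiscGroup L)).toMonoidHom.comp <| MonoidHom.toHomUnits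
    { toFun := inducedEnd
      map_one' := LinearMap.ext <| discMapPow_surjective.forall.2 fun v =>
        inducedEnd_discMapPow 1 v.2
      map_mul' := fun γ δ => LinearMap.ext <| discMapPow_surjective.forall.2 fun v => by
        rw [Module.End.mul_apply, inducedEnd_discMapPow, inducedEnd_discMapPow,
          inducedEnd_discMapPow]
        rfl }

theorem inducedAut_discMapPow (γ : latticeAut (powLattice L k)) {v : PiLp 2 fun _ : Fin k => E}
    (hv : v ∈ powLattice (dualLattice L) k) :
    inducedAut L k γ (discMapPow L k ⟨v, hv⟩) =
      discMapPow L k ⟨γ.1 v, (mem_powLattice_dualLattice_iff γ.2 v).2 hv⟩ :=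
  inducedEnd_discMapPow γ hv

theorem mem_latticeOf_map_iff (γ : latticeAut (powLattice L k))
    {S T : Submodule (ZMod 2) (Fin k → DiscGroup L)} (h : ∀ a, inducedAut L k γ a ∈ T ↔ a ∈ S)
    (v : PiLp 2 fun _ : Fin k => E) : γ.1 v ∈ latticeOf L T ↔ v ∈ latticeOf L S := by
  simp only [mem_latticeOf_iff, mem_powLattice_dualLattice_iff γ.2, ← h, inducedAut_discMapPow]

theorem mem_latticeAut_latticeOf_iff (γ : latticeAut (powLattice L k))
    {S : Submodule (ZMod 2) (Fin k → DiscGroup L)} :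
    γ.1 ∈ latticeAut (latticeOf L S) ↔ inducedAut L k γ ∈ subspaceStabilizer S := by
  refine ⟨fun hγ a => ?_, fun h => mem_latticeOf_map_iff γ h⟩
  obtain ⟨⟨v, hv⟩, rfl⟩ := discMapPow_surjective a
  rw [inducedAut_discMapPow]
  simpa only [mem_latticeOf_iff, mem_powLattice_dualLattice_iff γ.2, hv, exists_true_left]
    using hγ v

end GlueLattices

/-! ### The discriminant form of `√2 E₈` -/

section UnimodularGram

variable {ι : Type*} [Fintype ι] [DecidableEq ι]

theorem linearIndependent_of_isUnit_det {R M N : Type*} [CommRing R] [AddCommGroup M]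
    [AddCommGroup N] [Module R M] [Module R N] (B : M →ₗ[R] N →ₗ[R] R) {v : ι → M} {w : ι → N}
    (h : IsUnit (Matrix.of fun i j => B (v i) (w j)).det) : LinearIndependent R v := by
  rw [Fintype.linearIndependent_iff]
  intro g hg
  refine congrFun (Matrix.vecMul_injective_of_isUnit ((Matrix.isUnit_iff_isUnit_det _).2 h)
    (?_ : Matrix.vecMul g _ = Matrix.vecMul 0 _))
  funext j
  simpa [Matrix.vecMul, dotProduct] using LinearMap.congr_fun (congrArg B hg) (w j)

theorem mem_span_of_isUnit_det_gram {E : Type*} [NormedAddCommGroup E] [InnerProductSpace ℝ E]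
    (b : Module.Basis ι ℝ E) {G : Matrix ι ι ℤ} (hG : IsUnit G.det)
    (hb : ∀ i j, inner ℝ (b i) (b j) = G i j) {x : E}
    (hx : ∀ i, ∃ n : ℤ, inner ℝ x (b i) = n) : x ∈ Submodule.span ℤ (Set.range b) := by
  choose n hn using hx
  let y : E := ∑ i, (Matrix.vecMul n G⁻¹ i) • b i
  have hxy : x = y := InnerProductSpace.ext_inner_right_basis b fun j => by
    have h : Matrix.vecMul (Matrix.vecMul n G⁻¹) G j = n j := by
      rw [Matrix.vecMul_vecMul, Matrix.nonsing_inv_mul _ hG, Matrix.vecMul_one]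
    rw [hn, ← h]
    simp only [y, Matrix.vecMul, dotProduct, sum_inner, ← Int.cast_smul_eq_zsmul ℝ,
      real_inner_smul_left, hb, Int.cast_sum, Int.cast_mul]
  rw [hxy]
  exact sum_mem fun i _ => Submodule.smul_mem _ _ (Submodule.subset_span ⟨i, rfl⟩)

end UnimodularGram

section SqrtTwoE8

theorem inner_sqrt_two_smul {E : Type*} [NormedAddCommGroup E] [InnerProductSpace ℝ E] (x y : E) :
    inner ℝ (√2 • x) (√2 • y) = 2 * inner ℝ x y := by
  rw [real_inner_smul_left, real_inner_smul_right, ← mul_assoc, Real.mul_self_sqrt zero_le_two]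

theorem sqrt_two_smul_mem_sqrtTwoE8_iff {x : EuclideanSpace ℝ (Fin 8)} :
    √2 • x ∈ sqrtTwoE8 ↔ x ∈ latticeE8 := by
  rw [sqrtTwoE8, Submodule.mem_smul_pointwise_iff_exists]
  exact ⟨fun ⟨y, hy, h⟩ => smul_right_injective _ (by positivity : √2 ≠ 0) h ▸ hy,
    fun h => ⟨x, h, rfl⟩⟩

theorem mem_dualLattice_sqrtTwoE8_iff {x : EuclideanSpace ℝ (Fin 8)} :
    x ∈ dualLattice sqrtTwoE8 ↔ √2 • x ∈ latticeE8 := by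
  refine ⟨mem_dual_sqrtTwoE8, fun hx => mem_dualLattice_iff.2 fun y hy => ?_⟩
  obtain ⟨z, hz, rfl⟩ := (Submodule.mem_smul_pointwise_iff_exists _ _ _).1 hy
  rw [real_inner_smul_right, ← real_inner_smul_left]
  exact latticeE8_integral hx hz

theorem two_smul_mem_sqrtTwoE8_iff {x : EuclideanSpace ℝ (Fin 8)} :
    (2 : ℝ) • x ∈ sqrtTwoE8 ↔ x ∈ dualLattice sqrtTwoE8 := by
  rw [mem_dualLattice_sqrtTwoE8_iff, ← sqrt_two_smul_mem_sqrtTwoE8_iff, smul_smul,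
    Real.mul_self_sqrt zero_le_two]

theorem dualLattice_dualLattice_sqrtTwoE8_le : dualLattice (dualLattice sqrtTwoE8) ≤ sqrtTwoE8 := by
  intro x hx
  rw [← smul_inv_smul₀ (by positivity : √2 ≠ 0) x, sqrt_two_smul_mem_sqrtTwoE8_iff]
  refine mem_latticeE8_of_dual fun y hy => ?_
  rw [real_inner_smul_left, ← real_inner_smul_right]
  refine mem_dualLattice_iff.1 hx _ (mem_dualLattice_sqrtTwoE8_iff.2 ?_)
  rwa [smul_inv_smul₀ (by positivity)]

theorem inner_self_sqrtTwoE8 {x : EuclideanSpace ℝ (Fin 8)} (hx : x ∈ sqrtTwoE8) :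
    ∃ n : ℤ, inner ℝ x x = 4 * (n : ℝ) := by
  obtain ⟨y, hy, rfl⟩ := (Submodule.mem_smul_pointwise_iff_exists _ _ _).1 hx
  obtain ⟨n, hn⟩ := latticeE8_even hy
  exact ⟨n, by rw [inner_sqrt_two_smul, hn]; ring⟩

theorem sqrtTwoE8_le_dualLattice : sqrtTwoE8 ≤ dualLattice sqrtTwoE8 := by
  intro x hx
  obtain ⟨y, hy, rfl⟩ := (Submodule.mem_smul_pointwise_iff_exists _ _ _).1 hx
  rw [mem_dualLattice_sqrtTwoE8_iff, smul_smul, Real.mul_self_sqrt zero_le_two, two_smul]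
  exact add_mem hy hy

theorem discQuad_discMap {v : EuclideanSpace ℝ (Fin 8)} (hv : v ∈ dualLattice sqrtTwoE8) {n : ℤ}
    (hn : inner ℝ v v = n) : discQuad (discMap sqrtTwoE8 ⟨v, hv⟩) = n :=
  discQuadFun_mk hv hn

theorem polar_discQuad_discMap {v w : EuclideanSpace ℝ (Fin 8)}
    (hv : v ∈ dualLattice sqrtTwoE8) (hw : w ∈ dualLattice sqrtTwoE8) {n : ℤ}
    (hn : 2 * inner ℝ v w = (n : ℝ)) :
    QuadraticMap.polar discQuad (discMap sqrtTwoE8 ⟨v, hv⟩) (discMap sqrtTwoE8 ⟨w, hw⟩) = n :=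
  polar_discQuadFun_mk hv hw hn

theorem discQuad_polarBilin_nondegenerate : discQuad.polarBilin.Nondegenerate := by
  refine polarBilin_nondegenerate fun a ha => ?_
  obtain ⟨⟨v, hv⟩, rfl⟩ := Submodule.mkQ_surjective _ a
  refine (discMap_eq_zero_iff _).2 <|
    dualLattice_dualLattice_sqrtTwoE8_le <| mem_dualLattice_iff.2 fun w hw => ?_
  obtain ⟨n, hn⟩ := inner_dual_sqrtTwoE8' hv hw
  have h := ha (discMap sqrtTwoE8 ⟨w, hw⟩)
  rw [polar_discQuad_discMap hv hw hn, ZMod.intCast_eq_zero_iff_even] at h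
  obtain ⟨m, rfl⟩ := h
  exact ⟨m, by push_cast at hn; linarith⟩

end SqrtTwoE8

/-! ### The simple roots of `E₈` -/

section SimpleRoots

open CartanMatrix

/-- Twice the coordinates of the simple roots of `E₈`, in Bourbaki's labelling. -/
def rootCoord : Matrix (Fin 8) (Fin 8) ℤ :=
  !![ 1, -1, -1, -1, -1, -1, -1,  1;
      2,  2,  0,  0,  0,  0,  0,  0;
     -2,  2,  0,  0,  0,  0,  0,  0;
      0, -2,  2,  0,  0,  0,  0,  0;
      0,  0, -2,  2,  0,  0,  0,  0;
      0,  0,  0, -2,  2,  0,  0,  0;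
      0,  0,  0,  0, -2,  2,  0,  0;
      0,  0,  0,  0,  0, -2,  2,  0]

theorem sum_rootCoord_mul_rootCoord (k l : Fin 8) :
    ∑ j, rootCoord k j * rootCoord l j = 4 * E₈ k l := by
  revert k l
  decide

theorem rootCoord_even_or_odd (k : Fin 8) :
    (∀ j, Even (rootCoord k j)) ∨ ∀ j, Odd (rootCoord k j) := by
  simp only [Int.even_iff, Int.odd_iff]
  revert k
  decide

theorem four_dvd_sum_rootCoord (k : Fin 8) : 4 ∣ ∑ j, rootCoord k j := by
  revert k
  decide

/-- The simple roots of `E₈`, in Bourbaki's labelling. -/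
def simpleRoot (k : Fin 8) : EuclideanSpace ℝ (Fin 8) :=
  WithLp.toLp 2 fun j => (rootCoord k j : ℝ) / 2

theorem simpleRoot_mem_latticeE8 (k : Fin 8) : simpleRoot k ∈ latticeE8 := by
  refine ⟨(rootCoord_even_or_odd k).imp (fun h j => ?_) (fun h j => ?_), ?_⟩
  · obtain ⟨n, hn⟩ := h j
    exact ⟨n, by simp [simpleRoot, hn]⟩
  · obtain ⟨n, hn⟩ := h j
    refine ⟨n, ?_⟩
    simp only [simpleRoot, hn]
    push_cast
    ring
  · obtain ⟨s, hs⟩ := four_dvd_sum_rootCoord k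
    have hs' : ∑ j, (rootCoord k j : ℝ) = 4 * s := by exact_mod_cast hs
    refine ⟨s, ?_⟩
    simp only [simpleRoot]
    rw [← Finset.sum_div, hs']
    ring

theorem inner_simpleRoot (k l : Fin 8) : inner ℝ (simpleRoot k) (simpleRoot l) = E₈ k l := by
  have h : ∑ j, (rootCoord k j : ℝ) * rootCoord l j = 4 * E₈ k l := by
    exact_mod_cast sum_rootCoord_mul_rootCoord k l
  have h' : ∀ j, inner ℝ (simpleRoot k j) (simpleRoot l j) =
      (rootCoord k j : ℝ) * rootCoord l j / 4 := fun j => by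
    simp [simpleRoot]
    ring
  rw [PiLp.inner_apply, Finset.sum_congr rfl fun j _ => h' j, ← Finset.sum_div, h]
  ring

theorem isUnit_det_map_E₈ (R : Type*) [CommRing R] :
    IsUnit (Matrix.of fun k l => (E₈ k l : R)).det := by
  have h : (Matrix.of fun k l => (E₈ k l : R)).det = Int.castRingHom R E₈.det :=
    (RingHom.map_det (Int.castRingHom R) E₈).symm
  rw [h, E₈_det, map_one]
  exact isUnit_one

/-- The basis of `ℝ⁸` consisting of the simple roots of `E₈`. -/
def simpleRootBasis : Module.Basis (Fin 8) ℝ (EuclideanSpace ℝ (Fin 8)) :=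
  basisOfLinearIndependentOfCardEqFinrank
    (linearIndependent_of_isUnit_det (innerₗ (EuclideanSpace ℝ (Fin 8))) (v := simpleRoot)
      (w := simpleRoot) <| by
        simpa only [innerₗ_apply_apply, inner_simpleRoot] using isUnit_det_map_E₈ ℝ)
    finrank_euclideanSpace.symm

theorem simpleRootBasis_apply (k : Fin 8) : simpleRootBasis k = simpleRoot k :=
  congrFun (coe_basisOfLinearIndependentOfCardEqFinrank _ _) k

theorem latticeE8_le_span_simpleRoot : latticeE8 ≤ Submodule.span ℤ (Set.range simpleRoot) := by
  intro x hx
  have h := mem_span_of_isUnit_det_gram simpleRootBasis (G := E₈) (by rw [E₈_det]; exact isUnit_one)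
    (fun k l => by rw [simpleRootBasis_apply, simpleRootBasis_apply, inner_simpleRoot])
    (fun k => latticeE8_integral hx (simpleRootBasis_apply k ▸ simpleRoot_mem_latticeE8 k))
  rwa [funext simpleRootBasis_apply] at h

end SimpleRoots

section DualRoots

open CartanMatrix QuadraticMap Module

/-- The vectors `α / √2`, for `α` a simple root of `E₈`: they generate the dual lattice
`E₈ / √2` of `√2 E₈`. -/
def dualRoot (k : Fin 8) : EuclideanSpace ℝ (Fin 8) :=
  (√2)⁻¹ • simpleRoot k

theorem sqrt_two_smul_dualRoot (k : Fin 8) : √2 • dualRoot k = simpleRoot k :=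
  smul_inv_smul₀ (by positivity) _

theorem dualRoot_mem_dualLattice (k : Fin 8) : dualRoot k ∈ dualLattice sqrtTwoE8 := by
  rw [mem_dualLattice_sqrtTwoE8_iff, sqrt_two_smul_dualRoot]
  exact simpleRoot_mem_latticeE8 k

theorem two_mul_inner_dualRoot (k l : Fin 8) :
    2 * inner ℝ (dualRoot k) (dualRoot l) = (E₈ k l : ℝ) := by
  rw [← inner_sqrt_two_smul, sqrt_two_smul_dualRoot, sqrt_two_smul_dualRoot, inner_simpleRoot]

theorem inner_self_dualRoot (k : Fin 8) : inner ℝ (dualRoot k) (dualRoot k) = 1 := by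
  have h := two_mul_inner_dualRoot k k
  rw [E₈_diag] at h
  push_cast at h
  linarith

/-- The basis of `ℝ⁸` consisting of the vectors `dualRoot k`. -/
def dualRootBasis : Basis (Fin 8) ℝ (EuclideanSpace ℝ (Fin 8)) :=
  simpleRootBasis.map (LinearEquiv.smulOfNeZero ℝ _ (√2)⁻¹ (by positivity))

theorem dualRootBasis_apply (k : Fin 8) : dualRootBasis k = dualRoot k := by
  rw [dualRootBasis, Basis.map_apply, simpleRootBasis_apply]
  rfl

theorem dualLattice_sqrtTwoE8_le_span_dualRoot :
    dualLattice sqrtTwoE8 ≤ Submodule.span ℤ (Set.range dualRoot) := by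
  intro x hx
  have h := latticeE8_le_span_simpleRoot (mem_dualLattice_sqrtTwoE8_iff.1 hx)
  let f : EuclideanSpace ℝ (Fin 8) →ₗ[ℤ] EuclideanSpace ℝ (Fin 8) :=
    ((√2)⁻¹ • LinearMap.id (R := ℝ)).restrictScalars ℤ
  have h' := Submodule.mem_map_of_mem (f := f) h
  rw [Submodule.map_span, ← Set.range_comp] at h'
  rwa [← inv_smul_smul₀ (by positivity : √2 ≠ 0) x]

/-- The classes of the vectors `dualRoot k`. -/
def rootClass (k : Fin 8) : DiscGroup sqrtTwoE8 :=
  discMap sqrtTwoE8 ⟨dualRoot k, dualRoot_mem_dualLattice k⟩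

theorem polar_rootClass (k l : Fin 8) :
    polar discQuad (rootClass k) (rootClass l) = (E₈ k l : ZMod 2) :=
  polar_discQuad_discMap _ _ (two_mul_inner_dualRoot k l)

theorem discQuad_rootClass (k : Fin 8) : discQuad (rootClass k) = 1 := by
  have h := discQuad_discMap (dualRoot_mem_dualLattice k) (n := 1)
    (by rw [inner_self_dualRoot, Int.cast_one])
  rwa [Int.cast_one] at h

theorem linearIndependent_rootClass : LinearIndependent (ZMod 2) rootClass :=
  linearIndependent_of_isUnit_det (polarBilin discQuad) (w := rootClass) <| by
    simpa only [polarBilin_apply_apply, polar_rootClass] using isUnit_det_map_E₈ (ZMod 2)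

theorem span_rootClass : Submodule.span (ZMod 2) (Set.range rootClass) = ⊤ := by
  refine eq_top_iff.2 fun a _ => ?_
  obtain ⟨⟨v, hv⟩, rfl⟩ := Submodule.mkQ_surjective _ a
  let N : Submodule ℤ (dualLattice sqrtTwoE8) :=
    (Submodule.span (ZMod 2) (Set.range rootClass)).toAddSubgroup.toIntSubmodule.comap
      (discMap sqrtTwoE8)
  have h : Submodule.span ℤ (Set.range dualRoot) ≤ N.map (dualLattice sqrtTwoE8).subtype := by
    rw [Submodule.span_le]
    rintro _ ⟨k, rfl⟩
    exact ⟨⟨_, dualRoot_mem_dualLattice k⟩, Submodule.subset_span ⟨k, rfl⟩, rfl⟩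
  obtain ⟨w, hw, rfl⟩ := h (dualLattice_sqrtTwoE8_le_span_dualRoot hv)
  exact hw

/-- The basis of `R(√2 E₈)` consisting of the vectors `rootClass k`. -/
def rootClassBasis : Basis (Fin 8) (ZMod 2) (DiscGroup sqrtTwoE8) :=
  Basis.mk linearIndependent_rootClass span_rootClass.ge

instance : Module.Finite (ZMod 2) (DiscGroup sqrtTwoE8) :=
  Module.Finite.of_basis rootClassBasis

theorem finrank_discGroup : finrank (ZMod 2) (DiscGroup sqrtTwoE8) = 8 :=
  finrank_eq_card_basis rootClassBasis

/-- The Dynkin diagram of `E₈` is a tree, rooted at the last node; this sends every other node to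
its parent. -/
def dynkinParent : Fin 8 → Fin 8 := ![2, 3, 3, 4, 5, 6, 7, 7]

theorem lt_dynkinParent {k : Fin 8} (hk : k ≠ 7) : k < dynkinParent k := by
  revert k
  decide

theorem E₈_apply_of_lt {k l : Fin 8} (h : k < l) :
    E₈ k l = if l = dynkinParent k then -1 else 0 := by
  rw [← Int.sub_eq_zero]
  revert k l
  decide

theorem polar_rootClass_dynkinParent {k : Fin 8} (hk : k ≠ 7) :
    polar discQuad (rootClass k) (rootClass (dynkinParent k)) = 1 := by
  rw [polar_rootClass, E₈_apply_of_lt (lt_dynkinParent hk), if_pos rfl]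
  rfl

theorem isRootFamily_rootClass : IsRootFamily discQuad rootClass where
  map_eq_one := discQuad_rootClass
  span_eq_top := span_rootClass
  connected := by
    have : Std.Symm fun k l => polar discQuad (rootClass k) (rootClass l) = 1 :=
      ⟨fun k l h => by rwa [polar_comm]⟩
    have hroot : ∀ k, Relation.ReflTransGen
        (fun k l => polar discQuad (rootClass k) (rootClass l) = 1) k 7 := by
      refine (wellFounded_gt (α := Fin 8)).fix fun k ih => ?_
      rcases eq_or_ne k 7 with rfl | hk
      · exact .refl
      · exact .head (polar_rootClass_dynkinParent hk) (ih _ (lt_dynkinParent hk))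
    exact fun k l => (hroot k).trans (Relation.ReflTransGen.stdSymm.symm _ _ (hroot l))

end DualRoots

section Lagrangian

open CartanMatrix QuadraticMap Module

theorem isTotallySingular_span_range {R ι : Type*} [AddCommGroup R] [Module (ZMod 2) R]
    {q : QuadraticForm (ZMod 2) R} {u : ι → R} (hu : ∀ i, q (u i) = 0)
    (huu : ∀ i j, polar q (u i) (u j) = 0) :
    IsTotallySingular q (Submodule.span (ZMod 2) (Set.range u)) := by
  set U := Submodule.span (ZMod 2) (Set.range u)
  have horth : U ≤ LinearMap.BilinForm.orthogonal (polarBilin q) U := by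
    refine Submodule.span_le.2 (Set.range_subset_iff.2 fun j x hx => ?_)
    have h : U ≤ LinearMap.ker ((polarBilin q).flip (u j)) :=
      Submodule.span_le.2 (Set.range_subset_iff.2 fun i => huu i j)
    exact h hx
  intro x hx
  induction hx using Submodule.span_induction with
  | mem x hx => obtain ⟨i, rfl⟩ := hx; exact hu i
  | zero => exact map_zero q
  | add x y hx hy hqx hqy =>
    rw [QuadraticMap.map_add q, hqx, hqy, show polar q x y = 0 from horth hy x hx, add_zero,
      add_zero]
  | smul c x hx hqx => rw [QuadraticMap.map_smul, hqx, smul_zero]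

theorem exists_isTotallySingular_discQuad : ∃ U : Submodule (ZMod 2) (DiscGroup sqrtTwoE8),
    IsTotallySingular discQuad U ∧ finrank (ZMod 2) U = 4 := by
  let a : Fin 4 → Fin 8 := ![2, 3, 1, 5]
  let b : Fin 4 → Fin 8 := ![7, 6, 7, 7]
  let u : Fin 4 → DiscGroup sqrtTwoE8 := fun i => rootClass (a i) + rootClass (b i)
  have hu (i : Fin 4) : discQuad (u i) = 0 := by
    rw [QuadraticMap.map_add discQuad, discQuad_rootClass, discQuad_rootClass, polar_rootClass]
    revert i
    decide
  have huu (i j : Fin 4) : polar discQuad (u i) (u j) = 0 := by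
    simp only [u, polar_add_left, polar_add_right, polar_rootClass]
    revert i j
    decide
  have hli : LinearIndependent (ZMod 2) u :=
    linearIndependent_of_isUnit_det (polarBilin discQuad) (w := rootClass ∘ ![0, 1, 3, 4]) <| by
      simp only [u, polarBilin_apply_apply, polar_add_left, Function.comp_apply, polar_rootClass]
      decide
  exact ⟨_, isTotallySingular_span_range hu huu,
    (finrank_span_eq_card hli).trans (Fintype.card_fin 4)⟩

theorem isExtremalCode_of_isMaxTotallySingular
    {S : Submodule (ZMod 2) (Fin 3 → DiscGroup sqrtTwoE8)}
    (hS : IsMaxTotallySingular (quadPow discQuad 3) S)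
    (hw : ∀ v ∈ S, v ≠ 0 → 4 ≤ wtPow discQuad 3 v) : IsExtremalCode discQuad S where
  nondegenerate := discQuad_polarBilin_nondegenerate
  isTotallySingular := hS.1
  two_mul_finrank := by
    obtain ⟨U, hU, hU4⟩ := exists_isTotallySingular_discQuad
    have hU3 : IsTotallySingular (quadPow discQuad 3)
        (LinearMap.range (U.subtype.compLeft (Fin 3))) := by
      rintro _ ⟨v, rfl⟩
      rw [QuadraticMap.pi_apply]
      exact Finset.sum_eq_zero fun i _ => hU _ (v i).2
    have hfinrank := LinearMap.finrank_range_of_inj (f := U.subtype.compLeft (Fin 3))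
      (U.subtype_injective.comp_left)
    rw [finrank_pi_const, hU4] at hfinrank
    rw [hS.two_mul_finrank_eq
      (quadPow_polarBilin_nondegenerate discQuad_polarBilin_nondegenerate 3) hU3]
    · exact finrank_pi_const 3
    · rw [hfinrank, finrank_pi_const, finrank_discGroup]
  four_le_wtPow := hw

end Lagrangian

/-! ### Extremal lattices and extremal codes -/

section WeightsAndNorms

open QuadraticMap Module

theorem natCast_wt_discQuad_modEq {v : EuclideanSpace ℝ (Fin 8)} (hv : v ∈ dualLattice sqrtTwoE8)
    {n : ℤ} (hn : inner ℝ v v = (n : ℝ)) :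
    (wt discQuad (discMap sqrtTwoE8 ⟨v, hv⟩) : ℤ) ≡ n [ZMOD (2 : ℕ)] := by
  rw [← ZMod.intCast_eq_intCast_iff, Int.cast_natCast, natCast_wt, discQuad_discMap hv hn]

theorem wt_discQuad_discMap_le {v : EuclideanSpace ℝ (Fin 8)} (hv : v ∈ dualLattice sqrtTwoE8) :
    (wt discQuad (discMap sqrtTwoE8 ⟨v, hv⟩) : ℝ) ≤ inner ℝ v v := by
  rcases eq_or_ne (discMap sqrtTwoE8 ⟨v, hv⟩) 0 with h0 | h0
  · rw [h0, wt_zero, Nat.cast_zero]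
    exact real_inner_self_nonneg
  obtain ⟨n, hn⟩ := inner_dual_sqrtTwoE8 hv
  have hpos : 0 < n := by
    have h : v ≠ 0 := by
      rintro rfl
      exact h0 (map_zero _)
    exact_mod_cast hn ▸ real_inner_self_pos.2 h
  have hmod := (natCast_wt_discQuad_modEq hv hn).dvd
  have hle := wt_le_two discQuad (discMap sqrtTwoE8 ⟨v, hv⟩)
  rw [hn]
  exact_mod_cast (by omega : (wt discQuad (discMap sqrtTwoE8 ⟨v, hv⟩) : ℤ) ≤ n)

theorem exists_discMap_eq_inner_self_le_two (a : DiscGroup sqrtTwoE8) :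
    ∃ (v : EuclideanSpace ℝ (Fin 8)) (hv : v ∈ dualLattice sqrtTwoE8),
      discMap sqrtTwoE8 ⟨v, hv⟩ = a ∧ inner ℝ v v ≤ 2 := by
  obtain ⟨⟨v, hv⟩, rfl⟩ := Submodule.mkQ_surjective _ a
  obtain ⟨e, he, hle⟩ := exists_mem_latticeE8_inner_sub_two_smul_le (√2 • v)
  have he' : √2 • e ∈ sqrtTwoE8 := sqrt_two_smul_mem_sqrtTwoE8_iff.2 he
  refine ⟨v - √2 • e, sub_mem hv (sqrtTwoE8_le_dualLattice he'), ?_, ?_⟩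
  · refine sub_eq_zero.1 ((map_sub (discMap sqrtTwoE8) _ _).symm.trans
      ((discMap_eq_zero_iff _).2 ?_))
    simpa using he'
  · have h : √2 • v - (2 : ℝ) • e = √2 • (v - √2 • e) := by
      rw [smul_sub, smul_smul, Real.mul_self_sqrt zero_le_two]
    rw [h, inner_sqrt_two_smul] at hle
    linarith

theorem exists_discMap_eq_inner_self_eq_wt (a : DiscGroup sqrtTwoE8) :
    ∃ (v : EuclideanSpace ℝ (Fin 8)) (hv : v ∈ dualLattice sqrtTwoE8),
      discMap sqrtTwoE8 ⟨v, hv⟩ = a ∧ inner ℝ v v = (wt discQuad a : ℝ) := by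
  rcases eq_or_ne a 0 with rfl | ha
  · exact ⟨0, zero_mem _, map_zero _, by rw [inner_zero_left, wt_zero, Nat.cast_zero]⟩
  obtain ⟨v, hv, rfl, hle⟩ := exists_discMap_eq_inner_self_le_two a
  refine ⟨v, hv, rfl, ?_⟩
  refine (wt_discQuad_discMap_le hv).antisymm' ?_
  obtain ⟨n, hn⟩ := inner_dual_sqrtTwoE8 hv
  have hmod := (natCast_wt_discQuad_modEq hv hn).dvd
  have hpos : wt discQuad (discMap sqrtTwoE8 ⟨v, hv⟩) ≠ 0 := mt wt_eq_zero_iff.1 ha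
  have hn2 : n ≤ 2 := by exact_mod_cast hn ▸ hle
  rw [hn]
  exact_mod_cast (by omega : n ≤ (wt discQuad (discMap sqrtTwoE8 ⟨v, hv⟩) : ℤ))

variable {k : ℕ} {v w : PiLp 2 fun _ : Fin k => EuclideanSpace ℝ (Fin 8)}

theorem exists_inner_self_eq_intCast (hv : v ∈ powLattice (dualLattice sqrtTwoE8) k) :
    ∃ n : ℤ, inner ℝ v v = (n : ℝ) := by
  choose n hn using fun i => inner_dual_sqrtTwoE8 (hv i)
  exact ⟨∑ i, n i, by rw [PiLp.inner_apply, Int.cast_sum, Finset.sum_congr rfl fun i _ => hn i]⟩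

theorem quadPow_discQuad_discMapPow (hv : v ∈ powLattice (dualLattice sqrtTwoE8) k) {n : ℤ}
    (hn : inner ℝ v v = (n : ℝ)) :
    quadPow discQuad k (discMapPow sqrtTwoE8 k ⟨v, hv⟩) = n := by
  choose m hm using fun i => inner_dual_sqrtTwoE8 (hv i)
  have hnm : n = ∑ i, m i := by
    have h : (n : ℝ) = ∑ i, (m i : ℝ) := by
      rw [← hn, PiLp.inner_apply, Finset.sum_congr rfl fun i _ => hm i]
    exact_mod_cast h
  rw [QuadraticMap.pi_apply, hnm, Int.cast_sum]
  exact Finset.sum_congr rfl fun i _ => discQuad_discMap (hv i) (hm i)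

theorem polar_discMapPow_eq_zero_iff (hv : v ∈ powLattice (dualLattice sqrtTwoE8) k)
    (hw : w ∈ powLattice (dualLattice sqrtTwoE8) k) :
    polar (quadPow discQuad k) (discMapPow sqrtTwoE8 k ⟨v, hv⟩) (discMapPow sqrtTwoE8 k ⟨w, hw⟩) =
      0 ↔ ∃ n : ℤ, inner ℝ v w = (n : ℝ) := by
  choose m hm using fun i => inner_dual_sqrtTwoE8' (hv i) (hw i)
  have hpolar : polar (quadPow discQuad k) (discMapPow sqrtTwoE8 k ⟨v, hv⟩)
      (discMapPow sqrtTwoE8 k ⟨w, hw⟩) = ((∑ i, m i : ℤ) : ZMod 2) := by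
    rw [polar_quadPow, Int.cast_sum]
    exact Finset.sum_congr rfl fun i _ => polar_discQuad_discMap (hv i) (hw i) (hm i)
  have hinner : 2 * inner ℝ v w = ((∑ i, m i : ℤ) : ℝ) := by
    rw [PiLp.inner_apply, Finset.mul_sum, Int.cast_sum]
    exact Finset.sum_congr rfl fun i _ => hm i
  rw [hpolar, ZMod.intCast_eq_zero_iff_even, even_iff_exists_two_mul]
  refine exists_congr fun n => ⟨fun h => ?_, fun h => ?_⟩
  · rw [h] at hinner
    push_cast at hinner
    linarith
  · rw [h] at hinner
    exact_mod_cast hinner.symm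

theorem wtPow_discQuad_discMapPow_le (hv : v ∈ powLattice (dualLattice sqrtTwoE8) k) :
    (wtPow discQuad k (discMapPow sqrtTwoE8 k ⟨v, hv⟩) : ℝ) ≤ inner ℝ v v := by
  rw [wtPow, Nat.cast_sum, PiLp.inner_apply]
  exact Finset.sum_le_sum fun i _ => wt_discQuad_discMap_le (hv i)

theorem exists_discMapPow_eq_inner_self_eq_wtPow (a : Fin k → DiscGroup sqrtTwoE8) :
    ∃ (v : _) (hv : v ∈ powLattice (dualLattice sqrtTwoE8) k),
      discMapPow sqrtTwoE8 k ⟨v, hv⟩ = a ∧ inner ℝ v v = (wtPow discQuad k a : ℝ) := by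
  choose v hv hva hn using fun i => exists_discMap_eq_inner_self_eq_wt (a i)
  refine ⟨WithLp.toLp 2 v, hv, funext hva, ?_⟩
  rw [wtPow, Nat.cast_sum, PiLp.inner_apply]
  exact Finset.sum_congr rfl fun i _ => hn i

theorem inducedAut_mem_autWt (γ : latticeAut (powLattice sqrtTwoE8 k)) :
    inducedAut sqrtTwoE8 k γ ∈ autWt discQuad k := by
  have hle (γ : latticeAut (powLattice sqrtTwoE8 k)) (a : Fin k → DiscGroup sqrtTwoE8) :
      wtPow discQuad k (inducedAut sqrtTwoE8 k γ a) ≤ wtPow discQuad k a := by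
    obtain ⟨v, hv, rfl, hn⟩ := exists_discMapPow_eq_inner_self_eq_wtPow a
    rw [inducedAut_discMapPow, ← Nat.cast_le (α := ℝ), ← hn, ← γ.1.inner_map_map v v]
    exact wtPow_discQuad_discMapPow_le _
  refine fun a => (hle γ a).antisymm ?_
  have h := hle γ⁻¹ (inducedAut sqrtTwoE8 k γ a)
  rwa [← LinearEquiv.mul_apply, ← map_mul, inv_mul_cancel, map_one] at h

end WeightsAndNorms

section ExtremalLattices

open QuadraticMap Module

theorem IsExtremalCode.orthogonal_eq {R : Type*} [AddCommGroup R] [Module (ZMod 2) R]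
    [Module.Finite (ZMod 2) R] {q : QuadraticForm (ZMod 2) R}
    {S : Submodule (ZMod 2) (Fin 3 → R)} (hS : IsExtremalCode q S) :
    LinearMap.BilinForm.orthogonal (polarBilin (quadPow q 3)) S = S :=
  hS.isTotallySingular.orthogonal_eq (quadPow_polarBilin_nondegenerate hS.nondegenerate 3)
    (hS.two_mul_finrank.trans (finrank_pi_const 3).symm)

theorem four_le_inner_self_of_mem_powLattice {k : ℕ}
    {x : PiLp 2 fun _ : Fin k => EuclideanSpace ℝ (Fin 8)} (hx : x ∈ powLattice sqrtTwoE8 k)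
    (hx0 : x ≠ 0) : 4 ≤ inner ℝ x x := by
  choose n hn using fun i => inner_self_sqrtTwoE8 (hx i)
  have hsum : inner ℝ x x = 4 * ((∑ i, n i : ℤ) : ℝ) := by
    rw [PiLp.inner_apply, Finset.sum_congr rfl fun i _ => hn i, ← Finset.mul_sum, Int.cast_sum]
  have hpos : (0 : ℝ) < ((∑ i, n i : ℤ) : ℝ) := by
    linarith [real_inner_self_pos.2 hx0]
  have h1 : 1 ≤ ∑ i, n i := by exact_mod_cast hpos
  rw [hsum]
  exact_mod_cast (by omega : (4 : ℤ) ≤ 4 * ∑ i, n i)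

theorem isExtremalLattice_latticeOf {S : Submodule (ZMod 2) (Fin 3 → DiscGroup sqrtTwoE8)}
    (hS : IsExtremalCode discQuad S) : IsExtremalLattice (latticeOf sqrtTwoE8 S) where
  even x hx := by
    obtain ⟨hx, hxS⟩ := mem_latticeOf_iff.1 hx
    obtain ⟨n, hn⟩ := exists_inner_self_eq_intCast hx
    have h := hS.isTotallySingular _ hxS
    rw [quadPow_discQuad_discMapPow hx hn, ZMod.intCast_eq_zero_iff_even] at h
    obtain ⟨m, rfl⟩ := h
    exact ⟨m, by rw [hn]; push_cast; ring⟩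
  dualLattice_le x hx := by
    have hx' : x ∈ powLattice (dualLattice sqrtTwoE8) 3 := by
      rw [← dualLattice_powLattice]
      exact mem_dualLattice_iff.2 fun y hy =>
        mem_dualLattice_iff.1 hx y (powLattice_le_latticeOf sqrtTwoE8_le_dualLattice S hy)
    refine mem_latticeOf_iff.2 ⟨hx', ?_⟩
    rw [← hS.orthogonal_eq]
    intro s hs
    obtain ⟨⟨y, hy⟩, rfl⟩ := discMapPow_surjective s
    exact (polar_discMapPow_eq_zero_iff hy hx').2 <| real_inner_comm x y ▸
      mem_dualLattice_iff.1 hx y (mem_latticeOf_iff.2 ⟨hy, hs⟩)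
  four_le x hx hx0 := by
    obtain ⟨hx, hxS⟩ := mem_latticeOf_iff.1 hx
    rcases eq_or_ne (discMapPow sqrtTwoE8 3 ⟨x, hx⟩) 0 with h | h
    · exact four_le_inner_self_of_mem_powLattice ((discMapPow_eq_zero_iff _).1 h) hx0
    · exact le_trans (by exact_mod_cast hS.four_le_wtPow _ hxS h) (wtPow_discQuad_discMapPow_le hx)

namespace IsExtremalLattice

variable {N : Submodule ℤ (PiLp 2 fun _ : Fin 3 => EuclideanSpace ℝ (Fin 8))}
  (hN : IsExtremalLattice N) (hL : powLattice sqrtTwoE8 3 ≤ N)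

include hN hL

theorem le_powLattice_dualLattice : N ≤ powLattice (dualLattice sqrtTwoE8) 3 := by
  rw [← dualLattice_powLattice]
  exact fun x hx => mem_dualLattice_iff.2 fun y hy =>
    mem_dualLattice_iff.1 (hN.le_dualLattice hx) y (hL hy)

theorem isTotallySingular_codeOf : IsTotallySingular (quadPow discQuad 3) (codeOf sqrtTwoE8 N) := by
  intro a ha
  obtain ⟨⟨v, hv⟩, rfl⟩ := discMapPow_surjective a
  obtain ⟨n, hn⟩ := hN.even v ((mem_codeOf_iff hL hv).1 ha)
  rw [quadPow_discQuad_discMapPow hv (n := 2 * n) (by rw [hn]; push_cast; rfl),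
    ZMod.intCast_eq_zero_iff_even]
  exact even_two_mul n

theorem orthogonal_codeOf :
    LinearMap.BilinForm.orthogonal (polarBilin (quadPow discQuad 3)) (codeOf sqrtTwoE8 N) =
      codeOf sqrtTwoE8 N := by
  refine le_antisymm (fun a ha => ?_) (hN.isTotallySingular_codeOf hL).le_orthogonal
  obtain ⟨⟨v, hv⟩, rfl⟩ := discMapPow_surjective a
  refine (mem_codeOf_iff hL hv).2 (hN.dualLattice_le (mem_dualLattice_iff.2 fun y hy => ?_))
  have hy' := hN.le_powLattice_dualLattice hL hy
  rw [real_inner_comm]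
  exact (polar_discMapPow_eq_zero_iff hy' hv).1 (ha _ ((mem_codeOf_iff hL hy').2 hy))

theorem isExtremalCode_codeOf : IsExtremalCode discQuad (codeOf sqrtTwoE8 N) where
  nondegenerate := discQuad_polarBilin_nondegenerate
  isTotallySingular := hN.isTotallySingular_codeOf hL
  two_mul_finrank := by
    have h := finrank_add_finrank_orthogonal
      (quadPow_polarBilin_nondegenerate discQuad_polarBilin_nondegenerate 3) (codeOf sqrtTwoE8 N)
    rwa [hN.orthogonal_codeOf hL, ← two_mul, finrank_pi_const] at h
  four_le_wtPow a ha ha0 := by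
    obtain ⟨v, hv, rfl, hn⟩ := exists_discMapPow_eq_inner_self_eq_wtPow a
    have h := hN.four_le v ((mem_codeOf_iff hL hv).1 ha) <| by
      rintro rfl
      exact ha0 (map_zero _)
    rw [hn] at h
    exact_mod_cast h

end IsExtremalLattice

end ExtremalLattices

/-! ### The isometries of `(√2 E₈)^k` -/

section LiftingIsometries

open CartanMatrix QuadraticMap Module

theorem exists_units_eq_mul_dynkinParent (s : Fin 8 → ℤˣ) :
    ∃ ε : Fin 8 → ℤˣ, ∀ k, k ≠ 7 → ε k = s k * ε (dynkinParent k) := by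
  let F (k : Fin 8) (ih : ∀ l, l > k → ℤˣ) : ℤˣ :=
    if hk : k ≠ 7 then s k * ih (dynkinParent k) (lt_dynkinParent hk) else 1
  exact ⟨wellFounded_gt.fix F, fun k hk => (wellFounded_gt.fix_eq F k).trans (dif_pos hk)⟩

theorem exists_units_mul_mul_eq_E₈ {d : Fin 8 → Fin 8 → ℤ} (hdiag : ∀ k, d k k = 2)
    (hsymm : ∀ k l, d k l = d l k) (hd : ∀ k l, k ≠ l → |d k l| < 2)
    (hmod : ∀ k l, (d k l : ZMod 2) = E₈ k l) :
    ∃ ε : Fin 8 → ℤˣ, ∀ k l, (ε k * ε l * d k l : ℤ) = E₈ k l := by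
  have hunit (k : Fin 8) : ∃ s : ℤˣ, k ≠ 7 → d k (dynkinParent k) = s := by
    by_cases hk : k = 7
    · exact ⟨1, fun h => absurd hk h⟩
    have habs := abs_lt.1 (hd k (dynkinParent k) (lt_dynkinParent hk).ne)
    have hodd : d k (dynkinParent k) ≠ 0 := fun h0 => by
      have h := hmod k (dynkinParent k)
      rw [h0, E₈_apply_of_lt (lt_dynkinParent hk), if_pos rfl] at h
      exact absurd h (by decide)
    obtain ⟨s, hs⟩ := Int.isUnit_iff.2
      (by omega : d k (dynkinParent k) = 1 ∨ d k (dynkinParent k) = -1)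
    exact ⟨s, fun _ => hs.symm⟩
  choose s hs using hunit
  obtain ⟨ε, hε⟩ := exists_units_eq_mul_dynkinParent fun k => -s k
  have hlt {k l : Fin 8} (hkl : k < l) : (ε k * ε l * d k l : ℤ) = E₈ k l := by
    rw [E₈_apply_of_lt hkl]
    split_ifs with hl
    · have hk : k ≠ 7 := (hkl.trans_le (Fin.le_last l)).ne
      rw [hl, hs k hk, hε k hk, ← Units.val_mul, ← Units.val_mul, mul_assoc (-s k),
        Int.units_mul_self, mul_one, neg_mul, Int.units_mul_self, Units.val_neg, Units.val_one]
    · have heven := hmod k l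
      rw [E₈_apply_of_lt hkl, if_neg hl, Int.cast_zero, ZMod.intCast_eq_zero_iff_even] at heven
      obtain ⟨n, hn⟩ := heven
      have habs := abs_lt.1 (hd k l hkl.ne)
      rw [show d k l = 0 by omega, mul_zero]
  refine ⟨ε, fun k l => ?_⟩
  rcases lt_trichotomy k l with hkl | rfl | hkl
  · exact hlt hkl
  · rw [hdiag, E₈_diag, ← Units.val_mul, Int.units_mul_self, Units.val_one, one_mul]
  · rw [mul_comm (ε k : ℤ), hsymm, hlt hkl]
    exact congrFun (congrFun E₈_transpose k) l

theorem units_smul_eq_self {M : Type*} [AddCommGroup M] [Module (ZMod 2) M] (ε : ℤˣ) (a : M) :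
    (ε : ℤ) • a = a := by
  rcases Int.units_eq_one_or ε with rfl | rfl
  · exact one_smul ℤ a
  · rw [Units.val_neg, Units.val_one, neg_one_smul, ZModModule.neg_eq_self]

theorem abs_two_mul_inner_lt_two {u w : EuclideanSpace ℝ (Fin 8)}
    (hu : u ∈ dualLattice sqrtTwoE8) (hw : w ∈ dualLattice sqrtTwoE8) (hu1 : ‖u‖ = 1)
    (hw1 : ‖w‖ = 1) (hne : discMap sqrtTwoE8 ⟨u, hu⟩ ≠ discMap sqrtTwoE8 ⟨w, hw⟩) :
    |2 * inner ℝ u w| < 2 := by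
  have hlt : inner ℝ u w < 1 := (inner_lt_one_iff_real_of_norm_eq_one hu1 hw1).2 fun h =>
    hne (congrArg _ (Subtype.ext h))
  have hneg : inner ℝ u (-w) < 1 :=
    (inner_lt_one_iff_real_of_norm_eq_one hu1 (by rw [norm_neg, hw1])).2 fun h => hne <| by
      rw [show (⟨u, hu⟩ : dualLattice sqrtTwoE8) = -⟨w, hw⟩ from Subtype.ext h, map_neg,
        ZModModule.neg_eq_self]
  rw [inner_neg_right] at hneg
  exact abs_lt.2 ⟨by linarith, by linarith⟩

theorem exists_dualRoot_lift (h : discQuad →qᵢ discQuad) :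
    ∃ u : Fin 8 → dualLattice sqrtTwoE8, (∀ k, discMap sqrtTwoE8 (u k) = h (rootClass k)) ∧
      ∀ k l, inner ℝ (u k : EuclideanSpace ℝ (Fin 8)) (u l) =
        inner ℝ (dualRoot k) (dualRoot l) := by
  choose u hu huh hn using fun k => exists_discMap_eq_inner_self_eq_wt (h (rootClass k))
  have hunit (k : Fin 8) : inner ℝ (u k) (u k) = (1 : ℝ) := by
    rw [hn, wt_of_eq_one (by rw [h.map_app, discQuad_rootClass]), Nat.cast_one]
  have hnorm (k : Fin 8) : ‖u k‖ = 1 := by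
    rw [norm_eq_sqrt_real_inner, hunit, Real.sqrt_one]
  choose d hd using fun k l => inner_dual_sqrtTwoE8' (hu k) (hu l)
  have hdne (k l : Fin 8) (hkl : k ≠ l) : |d k l| < 2 := by
    have hinj := (injective_of_isometry discQuad_polarBilin_nondegenerate.1 h).ne
      (linearIndependent_rootClass.injective.ne hkl)
    rw [← huh, ← huh] at hinj
    have hlt := abs_two_mul_inner_lt_two (hu k) (hu l) (hnorm k) (hnorm l) hinj
    rw [hd] at hlt
    exact_mod_cast hlt
  have hdiag (k : Fin 8) : d k k = 2 := by
    have h2 := hd k k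
    rw [hunit, mul_one] at h2
    exact_mod_cast h2.symm
  have hsymm (k l : Fin 8) : d k l = d l k := by
    have h2 := hd k l
    rw [real_inner_comm, hd] at h2
    exact_mod_cast h2.symm
  have hmod (k l : Fin 8) : (d k l : ZMod 2) = E₈ k l := by
    rw [← polar_discQuad_discMap (hu k) (hu l) (hd k l), huh, huh, polar_map_isometry,
      polar_rootClass]
  obtain ⟨ε, hε⟩ := exists_units_mul_mul_eq_E₈ hdiag hsymm hdne hmod
  refine ⟨fun k => (ε k : ℤ) • ⟨u k, hu k⟩, fun k => ?_, fun k l => ?_⟩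
  · rw [map_zsmul, units_smul_eq_self, huh]
  · refine mul_left_cancel₀ (two_ne_zero' ℝ) ?_
    rw [two_mul_inner_dualRoot, ← hε, Submodule.coe_smul, Submodule.coe_smul,
      ← Int.cast_smul_eq_zsmul ℝ, ← Int.cast_smul_eq_zsmul ℝ, real_inner_smul_left,
      real_inner_smul_right, Int.cast_mul, Int.cast_mul, ← hd]
    ring

theorem exists_mem_latticeAut_discMap_eq (h : discQuad →qᵢ discQuad) :
    ∃ γ ∈ latticeAut sqrtTwoE8, ∀ x (hx : x ∈ dualLattice sqrtTwoE8),
      ∃ hγx : γ x ∈ dualLattice sqrtTwoE8,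
        discMap sqrtTwoE8 ⟨γ x, hγx⟩ = h (discMap sqrtTwoE8 ⟨x, hx⟩) := by
  obtain ⟨u, huh, hgram⟩ := exists_dualRoot_lift h
  obtain ⟨γ, hγ⟩ := exists_linearIsometryEquiv_of_inner_eq dualRootBasis
    (fun k => (u k : EuclideanSpace ℝ (Fin 8))) rfl fun k l => by
      rw [dualRootBasis_apply, dualRootBasis_apply, hgram]
  have hlift (x) (hx : x ∈ dualLattice sqrtTwoE8) : ∃ hγx : γ x ∈ dualLattice sqrtTwoE8,
      discMap sqrtTwoE8 ⟨γ x, hγx⟩ = h (discMap sqrtTwoE8 ⟨x, hx⟩) := by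
    obtain ⟨c, rfl⟩ := (Submodule.mem_span_range_iff_exists_fun ℤ).1
      (dualLattice_sqrtTwoE8_le_span_dualRoot hx)
    have hγc : γ (∑ k, c k • dualRoot k) = (∑ k, c k • u k : dualLattice sqrtTwoE8) := by
      simp only [map_sum, map_zsmul, ← dualRootBasis_apply, hγ, Submodule.coe_sum,
        Submodule.coe_smul]
    have hc : (⟨∑ k, c k • dualRoot k, hx⟩ : dualLattice sqrtTwoE8) =
        ∑ k, c k • ⟨dualRoot k, dualRoot_mem_dualLattice k⟩ := Subtype.ext (by
      simp only [Submodule.coe_sum, Submodule.coe_smul])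
    refine ⟨hγc ▸ Subtype.prop _, ?_⟩
    rw [show (⟨γ _, _⟩ : dualLattice sqrtTwoE8) = ∑ k, c k • u k from Subtype.ext hγc, hc]
    simp only [map_sum, map_zsmul, huh]
    rfl
  refine ⟨γ, fun x => ⟨fun hx => ?_, fun hx => ?_⟩, hlift⟩
  · rw [← γ.symm_apply_apply x]
    refine dualLattice_dualLattice_sqrtTwoE8_le <|
      symm_apply_mem_dualLattice γ (fun y hy => (hlift y hy).1) ?_
    refine mem_dualLattice_iff.2 fun y hy => ?_
    rw [real_inner_comm]
    exact mem_dualLattice_iff.1 hy _ hx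
  · obtain ⟨hγx, hγh⟩ := hlift x (sqrtTwoE8_le_dualLattice hx)
    refine (discMap_eq_zero_iff ⟨γ x, hγx⟩).1 ?_
    rw [hγh, (discMap_eq_zero_iff _).2 hx, map_zero]

theorem exists_inducedAut_eq {k : ℕ}
    {g : (Fin k → DiscGroup sqrtTwoE8) ≃ₗ[ZMod 2] (Fin k → DiscGroup sqrtTwoE8)}
    (hg : g ∈ autWt discQuad k) : ∃ γ, inducedAut sqrtTwoE8 k γ = g := by
  obtain ⟨σ, h, hgh⟩ := isRootFamily_rootClass.exists_perm hg
  choose γ hγ hγh using fun i => exists_mem_latticeAut_discMap_eq (h i)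
  let Γ := (LinearIsometryEquiv.piLpCongrLeft 2 ℝ (EuclideanSpace ℝ (Fin 8)) σ).trans
    (LinearIsometryEquiv.piLpCongrRight 2 γ)
  have hΓ (x) (i : Fin k) : Γ x i = γ i (x (σ⁻¹ i)) := rfl
  have hmem : Γ ∈ latticeAut (powLattice sqrtTwoE8 k) := fun x =>
    (forall_congr' fun i => by rw [hΓ, hγ i]).trans σ⁻¹.forall_congr_right
  refine ⟨⟨Γ, hmem⟩, LinearEquiv.ext fun m => ?_⟩
  obtain ⟨⟨v, hv⟩, rfl⟩ := discMapPow_surjective m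
  rw [inducedAut_discMapPow]
  funext i
  rw [hgh]
  exact (hγh i _ (hv _)).2

end LiftingIsometries

section SignChanges

variable {E : Type*} [NormedAddCommGroup E] [InnerProductSpace ℝ E]

/-- The isometry `(-1)^z`, for a sign encoded as an element `z` of `𝔽₂`. -/
def signIsometry (z : ZMod 2) : E ≃ₗᵢ[ℝ] E :=
  if z = 0 then 1 else LinearIsometryEquiv.neg ℝ

theorem signIsometry_zero_apply (x : E) : signIsometry 0 x = x := by
  rw [signIsometry, if_pos rfl, LinearIsometryEquiv.coe_one, id]

theorem signIsometry_one_apply (x : E) : signIsometry 1 x = -x := by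
  rw [signIsometry, if_neg one_ne_zero, LinearIsometryEquiv.coe_neg]

theorem signIsometry_apply_eq_or_eq_neg (z : ZMod 2) (x : E) :
    signIsometry z x = x ∨ signIsometry z x = -x := by
  rcases zmod_two_eq z with rfl | rfl
  · exact .inl (signIsometry_zero_apply x)
  · exact .inr (signIsometry_one_apply x)

theorem signIsometry_add_apply (y z : ZMod 2) (x : E) :
    signIsometry (y + z) x = signIsometry y (signIsometry z x) := by
  rcases zmod_two_eq y with rfl | rfl <;> rcases zmod_two_eq z with rfl | rfl <;>
    simp only [add_zero, zero_add, signIsometry_zero_apply, signIsometry_one_apply, neg_neg,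
      CharTwo.add_self_eq_zero]

theorem signIsometry_apply_mem_iff (L : Submodule ℤ E) (z : ZMod 2) (x : E) :
    signIsometry z x ∈ L ↔ x ∈ L := by
  rcases signIsometry_apply_eq_or_eq_neg z x with h | h
  · rw [h]
  · rw [h, neg_mem_iff]

theorem signIsometry_injective [Nontrivial E] :
    Function.Injective (signIsometry : ZMod 2 → E ≃ₗᵢ[ℝ] E) := by
  obtain ⟨x, hx⟩ := exists_ne (0 : E)
  have := IsAddTorsionFree.of_isTorsionFree ℝ E
  have hne : (signIsometry 0 : E ≃ₗᵢ[ℝ] E) ≠ signIsometry 1 := fun h => hx <| by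
    have hxx := DFunLike.congr_fun h x
    rwa [signIsometry_zero_apply, signIsometry_one_apply, self_eq_neg] at hxx
  intro y z hyz
  rcases zmod_two_eq y with rfl | rfl <;> rcases zmod_two_eq z with rfl | rfl
  exacts [rfl, absurd hyz hne, absurd hyz.symm hne, rfl]

/-- The sign changes on the `k` summands of `E ⊕ ⋯ ⊕ E`. -/
def signChange (k : ℕ) : Multiplicative (Fin k → ZMod 2) →*
    ((PiLp 2 fun _ : Fin k => E) ≃ₗᵢ[ℝ] PiLp 2 fun _ : Fin k => E) :=
  MonoidHom.mk' (fun x => LinearIsometryEquiv.piLpCongrRight 2 fun i => signIsometry (x.toAdd i))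
    fun _ _ => LinearIsometryEquiv.ext fun v => PiLp.ext fun i =>
      signIsometry_add_apply _ _ (v i)

theorem signChange_single {k : ℕ} (x : Multiplicative (Fin k → ZMod 2)) (i : Fin k) (v : E) :
    signChange k x (PiLp.single 2 i v) = PiLp.single 2 i (signIsometry (x.toAdd i) v) :=
  LinearIsometryEquiv.piLpCongrRight_single (α := fun _ => E)
    (fun j => signIsometry (x.toAdd j)) i v

theorem signChange_injective [Nontrivial E] (k : ℕ) :
    Function.Injective (signChange (E := E) k) := fun x y h =>
  Multiplicative.toAdd.injective <| funext fun i => signIsometry_injective (E := E) <|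
    LinearIsometryEquiv.ext fun v => by
      have hv := congrArg (fun w : PiLp 2 fun _ : Fin k => E => w i)
        (DFunLike.congr_fun h (PiLp.single 2 i v))
      simpa only [signChange_single, PiLp.single_eq_same] using hv

theorem signChange_mem_latticeAut (L : Submodule ℤ E) {k : ℕ}
    (x : Multiplicative (Fin k → ZMod 2)) : signChange k x ∈ latticeAut (powLattice L k) :=
  fun v => forall_congr' fun i => signIsometry_apply_mem_iff L _ (v i)

theorem inducedAut_signChange (L : Submodule ℤ E) [Module (ZMod 2) (DiscGroup L)] {k : ℕ}
    (x : Multiplicative (Fin k → ZMod 2)) :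
    inducedAut L k ⟨signChange k x, signChange_mem_latticeAut L x⟩ = 1 := by
  refine LinearEquiv.ext <| discMapPow_surjective.forall.2 fun ⟨v, hv⟩ => ?_
  rw [inducedAut_discMapPow]
  funext i
  change discMap L ⟨signIsometry (x.toAdd i) (v i), _⟩ = discMap L ⟨v i, hv i⟩
  rcases signIsometry_apply_eq_or_eq_neg (x.toAdd i) (v i) with h | h
  · exact congrArg (discMap L) (Subtype.ext h)
  · rw [← ZModModule.neg_eq_self (discMap L ⟨v i, hv i⟩), ← map_neg]
    exact congrArg (discMap L) (Subtype.ext h)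

end SignChanges

section PiLpBasis

variable {E ι : Type*} [NormedAddCommGroup E] [InnerProductSpace ℝ E] (b : Module.Basis ι ℝ E)
  (k : ℕ)

/-- The basis of `E ⊕ ⋯ ⊕ E` obtained by placing a basis of `E` in each summand. -/
def piLpBasis : Module.Basis ((_ : Fin k) × ι) ℝ (PiLp 2 fun _ : Fin k => E) :=
  (Pi.basis fun _ : Fin k => b).map (WithLp.linearEquiv 2 ℝ (Fin k → E)).symm

theorem piLpBasis_apply (p : (_ : Fin k) × ι) : piLpBasis b k p = PiLp.single 2 p.1 (b p.2) := by
  rw [piLpBasis, Module.Basis.map_apply, Pi.basis_apply]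
  rfl

end PiLpBasis

section SignKernel

open CartanMatrix

theorem eq_or_eq_neg_of_sub_mem_powLattice {k : ℕ}
    {u v : PiLp 2 fun _ : Fin k => EuclideanSpace ℝ (Fin 8)} (hu : ‖u‖ = 1) (hv : ‖v‖ = 1)
    (huv : u - v ∈ powLattice sqrtTwoE8 k) : u = v ∨ u = -v := by
  refine or_iff_not_imp_left.2 fun hne => ?_
  have h4 := four_le_inner_self_of_mem_powLattice huv (sub_ne_zero.2 hne)
  have hpar := parallelogram_law_with_norm ℝ u v
  rw [real_inner_self_eq_norm_mul_norm] at h4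
  rw [hu, hv] at hpar
  refine eq_neg_of_add_eq_zero_left (norm_eq_zero.1 (mul_self_eq_zero.1 ?_))
  exact le_antisymm (by linarith) (mul_self_nonneg _)

theorem apply_eq_apply_of_inner_ne_zero {E F : Type*} [NormedAddCommGroup E]
    [InnerProductSpace ℝ E] [NormedAddCommGroup F] [InnerProductSpace ℝ F] {f g : E →ₗᵢ[ℝ] F}
    {v w : E} (hv : f v = g v ∨ f v = -g v) (hw : f w = g w) (hvw : inner ℝ v w ≠ 0) :
    f v = g v := by
  refine hv.resolve_right fun hneg => hvw (self_eq_neg.1 ?_)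
  calc inner ℝ v w = inner ℝ (f v) (f w) := (f.inner_map_map v w).symm
    _ = -inner ℝ (g v) (g w) := by rw [hneg, hw, inner_neg_left]
    _ = -inner ℝ v w := by rw [g.inner_map_map]

theorem apply_sub_mem_powLattice {E : Type*} [NormedAddCommGroup E] [InnerProductSpace ℝ E]
    {L : Submodule ℤ E} [Module (ZMod 2) (DiscGroup L)] {k : ℕ} {γ : latticeAut (powLattice L k)}
    (h : inducedAut L k γ = 1) {v : PiLp 2 fun _ : Fin k => E}
    (hv : v ∈ powLattice (dualLattice L) k) : γ.1 v - v ∈ powLattice L k := by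
  let w : powLattice (dualLattice L) k := ⟨γ.1 v, (mem_powLattice_dualLattice_iff γ.2 v).2 hv⟩
  refine (discMapPow_eq_zero_iff (w - ⟨v, hv⟩)).1 ?_
  rw [map_sub, ← inducedAut_discMapPow, h]
  exact sub_self _

theorem apply_single_dualRoot_eq_or_eq_neg {k : ℕ} {γ : latticeAut (powLattice sqrtTwoE8 k)}
    (h : inducedAut sqrtTwoE8 k γ = 1) (i : Fin k) (l : Fin 8) :
    γ.1 (PiLp.single 2 i (dualRoot l)) = PiLp.single 2 i (dualRoot l) ∨
      γ.1 (PiLp.single 2 i (dualRoot l)) = -PiLp.single 2 i (dualRoot l) := by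
  have hnorm : ‖(PiLp.single 2 i (dualRoot l) : PiLp 2 fun _ : Fin k => _)‖ = 1 := by
    rw [PiLp.norm_single, norm_eq_sqrt_real_inner, inner_self_dualRoot, Real.sqrt_one]
  exact eq_or_eq_neg_of_sub_mem_powLattice ((γ.1.norm_map _).trans hnorm) hnorm
    (apply_sub_mem_powLattice h (single_mem_powLattice (dualRoot_mem_dualLattice l)))

theorem exists_signChange_eq {k : ℕ} {γ : latticeAut (powLattice sqrtTwoE8 k)}
    (h : inducedAut sqrtTwoE8 k γ = 1) : ∃ x, signChange k x = γ.1 := by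
  have hpm := apply_single_dualRoot_eq_or_eq_neg h
  have hsign (i : Fin k) : ∃ z : ZMod 2,
      γ.1 (PiLp.single 2 i (dualRoot 7)) = PiLp.single 2 i (signIsometry z (dualRoot 7)) := by
    rcases hpm i 7 with h7 | h7
    · exact ⟨0, by rw [h7, signIsometry_zero_apply]⟩
    · exact ⟨1, by rw [h7, signIsometry_one_apply, PiLp.single_neg]⟩
  choose z hz using hsign
  refine ⟨Multiplicative.ofAdd z, LinearIsometryEquiv.toLinearEquiv_injective <|
    (piLpBasis dualRootBasis k).ext' fun ⟨i, l⟩ => ?_⟩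
  rw [piLpBasis_apply, dualRootBasis_apply]
  change signChange k _ (PiLp.single 2 i (dualRoot l)) = γ.1 (PiLp.single 2 i (dualRoot l))
  induction l using WellFoundedGT.induction with
  | ind l ih =>
    by_cases hl : l = 7
    · rw [hl, hz, signChange_single, toAdd_ofAdd]
    refine apply_eq_apply_of_inner_ne_zero (f := (signChange k _).toLinearIsometry)
      (g := γ.1.toLinearIsometry) ?_ (ih _ (lt_dynkinParent hl)) ?_
    · change signChange k _ _ = γ.1 _ ∨ signChange k _ _ = -γ.1 _
      rw [signChange_single, toAdd_ofAdd]
      rcases hpm i l with hγ | hγ <;>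
        rcases signIsometry_apply_eq_or_eq_neg (z i) (dualRoot l) with hs | hs <;>
        rw [hγ, hs] <;> simp [PiLp.single_neg]
    · rw [inner_piLpSingle, PiLp.single_eq_same]
      have h2 := two_mul_inner_dualRoot l (dynkinParent l)
      rw [E₈_apply_of_lt (lt_dynkinParent hl), if_pos rfl] at h2
      intro h0
      norm_num [h0] at h2

theorem map_subtype_ker_inducedAut (k : ℕ) :
    (inducedAut sqrtTwoE8 k).ker.map (Subgroup.subtype _) = (signChange k).range := by
  ext γ
  constructor
  · rintro ⟨γ, hγ, rfl⟩
    exact exists_signChange_eq hγ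
  · rintro ⟨x, rfl⟩
    exact ⟨⟨signChange k x, signChange_mem_latticeAut _ x⟩, inducedAut_signChange _ x, rfl⟩

end SignKernel

section Stabilizer

theorem nonempty_groupExtension_subgroupOf {N G G' : Type*} [Group N] [Group G] [Group G']
    {K H : Subgroup G} {K' H' : Subgroup G'} {i : N →* G} {φ : H →* G'}
    (hi : Function.Injective i) (hφ : φ.range = K') (hker : φ.ker.map H.subtype = i.range)
    (hK : ∀ a : H, a.1 ∈ K ↔ φ a ∈ H') :
    Nonempty (GroupExtension N (H.subgroupOf K) (H'.subgroupOf K')) := by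
  subst hφ
  have hmem (n : N) : ∃ hn : i n ∈ H, φ ⟨i n, hn⟩ = 1 := by
    obtain ⟨a, ha, han⟩ := hker.ge ⟨n, rfl⟩
    exact ⟨han ▸ a.2, by rwa [show (⟨i n, _⟩ : H) = a from Subtype.ext han.symm]⟩
  choose hiH hφi using hmem
  let inl : N →* H.subgroupOf K :=
    (i.codRestrict K fun n => (hK ⟨i n, hiH n⟩).2 (by rw [hφi]; exact one_mem H')).codRestrict _ hiH
  let toH : H.subgroupOf K →* H := (K.subtype.comp (Subgroup.subtype _)).codRestrict H fun a => a.2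
  let rightHom : H.subgroupOf K →* H'.subgroupOf φ.range :=
    (φ.rangeRestrict.comp toH).codRestrict _ fun a => (hK _).1 a.1.2
  refine ⟨⟨inl, rightHom, fun a b h => hi (congrArg (fun x => x.1.1) h), ?_, ?_⟩⟩
  · ext a
    rw [MonoidHom.mem_range, MonoidHom.mem_ker]
    constructor
    · rintro ⟨n, rfl⟩
      exact Subtype.ext (Subtype.ext (hφi n))
    · intro h
      have ha : φ (toH a) = 1 := congrArg (fun x => x.1.1) h
      obtain ⟨n, hn⟩ := hker.le ⟨toH a, ha, rfl⟩
      exact ⟨n, Subtype.ext (Subtype.ext hn)⟩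
  · rintro ⟨⟨_, a, rfl⟩, ha⟩
    exact ⟨⟨⟨a, (hK a).2 ha⟩, a.2⟩, rfl⟩

theorem range_inducedAut (k : ℕ) : (inducedAut sqrtTwoE8 k).range = autWt discQuad k :=
  le_antisymm (by rintro _ ⟨γ, rfl⟩; exact inducedAut_mem_autWt γ) fun _ => exists_inducedAut_eq

theorem nonempty_groupExtension_stabilizer {k : ℕ}
    (S : Submodule (ZMod 2) (Fin k → DiscGroup sqrtTwoE8)) :
    Nonempty (GroupExtension (Multiplicative (Fin k → ZMod 2))
      ((latticeAut (powLattice sqrtTwoE8 k)).subgroupOf (latticeAut (latticeOf sqrtTwoE8 S)))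
      ((subspaceStabilizer S).subgroupOf (autWt discQuad k))) :=
  nonempty_groupExtension_subgroupOf (signChange_injective k) (range_inducedAut k)
    (map_subtype_ker_inducedAut k) (mem_latticeAut_latticeOf_iff ·)

end Stabilizer

section Transitivity

variable {S T : Submodule (ZMod 2) (Fin 3 → DiscGroup sqrtTwoE8)}

theorem IsExtremalCode.exists_inducedAut_mem_iff (hS : IsExtremalCode discQuad S)
    (hT : IsExtremalCode discQuad T) :
    ∃ γ, ∀ a, inducedAut sqrtTwoE8 3 γ a ∈ T ↔ a ∈ S := by
  have hcard : 2 * Fintype.card (Fin 4) = Module.finrank (ZMod 2) (DiscGroup sqrtTwoE8) := by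
    rw [finrank_discGroup, Fintype.card_fin]
  obtain ⟨e, he⟩ := hS.exists_frames hcard
  obtain ⟨f, hf⟩ := hT.exists_frames hcard
  obtain ⟨γ, hγ⟩ := exists_inducedAut_eq <|
    mem_autWt_of_isometry discQuad_polarBilin_nondegenerate.1 1
      (g := LinearEquiv.piCongrRight fun i => ((e i).symm.trans (f i)).toLinearEquiv)
      (fun i => ((e i).symm.trans (f i)).toIsometry) fun _ _ => rfl
  refine ⟨γ, fun a => ?_⟩
  obtain ⟨m, rfl⟩ : ∃ m, (fun i => e i (m i)) = a :=
    ⟨fun i => (e i).symm (a i), funext fun i => (e i).apply_symm_apply (a i)⟩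
  have hγm : inducedAut sqrtTwoE8 3 γ (fun i => e i (m i)) = fun i => f i (m i) :=
    hγ ▸ funext fun i => congrArg (f i) ((e i).symm_apply_apply (m i))
  rw [hγm, he, hf]

theorem span_powLattice_sqrtTwoE8 (k : ℕ) :
    Submodule.span ℝ (powLattice sqrtTwoE8 k :
      Set (PiLp 2 fun _ : Fin k => EuclideanSpace ℝ (Fin 8))) = ⊤ := by
  rw [eq_top_iff, ← (piLpBasis dualRootBasis k).span_eq, Submodule.span_le]
  rintro _ ⟨p, rfl⟩
  rw [piLpBasis_apply, dualRootBasis_apply]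
  have h : PiLp.single 2 p.1 ((2 : ℝ) • dualRoot p.2) ∈ powLattice sqrtTwoE8 k :=
    single_mem_powLattice (two_smul_mem_sqrtTwoE8_iff.2 (dualRoot_mem_dualLattice p.2))
  rw [two_smul, PiLp.single_add, ← two_smul ℝ] at h
  exact (Submodule.smul_mem_iff _ two_ne_zero).1 (Submodule.subset_span h)

theorem IsExtremalCode.exists_mem_latticeAut_image_eq (hS : IsExtremalCode discQuad S)
    {J : Submodule ℤ (PiLp 2 fun _ : Fin 3 => EuclideanSpace ℝ (Fin 8))}
    (hJS : J ≤ latticeOf sqrtTwoE8 S) (hJ : LatticeIsomorphic J (powLattice sqrtTwoE8 3)) :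
    ∃ g ∈ latticeAut (latticeOf sqrtTwoE8 S), g '' powLattice sqrtTwoE8 3 = J := by
  obtain ⟨h, hh⟩ :=
    exists_linearIsometryEquiv_of_latticeIsomorphic hJ rfl (span_powLattice_sqrtTwoE8 3)
  have hN := (isExtremalLattice_latticeOf hS).comap h
  have hLN := fun x hx => hJS ((hh x).2 hx)
  obtain ⟨γ, hγ⟩ := hS.exists_inducedAut_mem_iff (hN.isExtremalCode_codeOf hLN)
  have hγN := mem_latticeOf_map_iff γ hγ
  rw [latticeOf_codeOf hLN (hN.le_powLattice_dualLattice hLN)] at hγN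
  refine ⟨h * γ.1, hγN, ?_⟩
  have hpre : (powLattice sqrtTwoE8 3 : Set (PiLp 2 fun _ : Fin 3 => EuclideanSpace ℝ (Fin 8))) =
      (h * γ.1) ⁻¹' J :=
    Set.ext fun v => ((hh (γ.1 v)).trans (γ.2 v)).symm
  rw [hpre, Set.image_preimage_eq _ (h * γ.1).surjective]

end Transitivity

end

theorem corollary3p11
    (S : Submodule (ZMod 2) (Fin 3 → DiscGroup sqrtTwoE8))
    (hS : IsMaxTotallySingular (quadPow discQuad 3) S)
    (hw : ∀ v ∈ S, v ≠ 0 → 4 ≤ wtPow discQuad 3 v) :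
    -- `Aut(𝔏(S))` is transitive on the sublattices isomorphic to `(√2 E₈)³`
    (∀ J K : Submodule ℤ (PiLp 2 fun _ : Fin 3 => EuclideanSpace ℝ (Fin 8)),
      J ≤ latticeOf sqrtTwoE8 S → LatticeIsomorphic J (powLattice sqrtTwoE8 3) →
      K ≤ latticeOf sqrtTwoE8 S → LatticeIsomorphic K (powLattice sqrtTwoE8 3) →
      ∃ g ∈ latticeAut (latticeOf sqrtTwoE8 S), g '' J = (K : Set _)) ∧
    -- the stabilizer of `(√2 E₈)³` in `Aut(𝔏(S))` is an extension of the stabilizer of `S` in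
    -- `Aut(R(L)³, w³)` by `2³`
    Nonempty (GroupExtension (Multiplicative (Fin 3 → ZMod 2))
      ((latticeAut (powLattice sqrtTwoE8 3)).subgroupOf (latticeAut (latticeOf sqrtTwoE8 S)))
      ((subspaceStabilizer S).subgroupOf (autWt discQuad 3))) ∧
    -- the stabilizer of `S` is a split extension `2¹² : (SL₄(2) × Sym₃)`
    ∃ X : GroupExtension (Multiplicative (Fin 12 → ZMod 2))
        ((subspaceStabilizer S).subgroupOf (autWt discQuad 3))
        (Matrix.SpecialLinearGroup (Fin 4) (ZMod 2) × Equiv.Perm (Fin 3)),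
      Nonempty X.Splitting := by
  have hSx := isExtremalCode_of_isMaxTotallySingular hS hw
  refine ⟨fun J K hJ hJL hK hKL => ?_, nonempty_groupExtension_stabilizer S, ?_⟩
  · obtain ⟨g, hg, hgJ⟩ := hSx.exists_mem_latticeAut_image_eq hJ hJL
    obtain ⟨h, hh, hhK⟩ := hSx.exists_mem_latticeAut_image_eq hK hKL
    refine ⟨h * g⁻¹, mul_mem hh (inv_mem hg), ?_⟩
    rw [← hgJ, ← hhK, Set.image_image]
    exact Set.image_congr fun v _ => congrArg h (g.symm_apply_apply v)
  · obtain ⟨e, he⟩ := hSx.exists_frames (ι := Fin 4) (by rw [finrank_discGroup, Fintype.card_fin])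
    exact exists_splitting_stabilizer isRootFamily_rootClass one_lt_two he rfl
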